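/- **Conventions.** $[w]$ is a set of $w$ states; $U_n$ is the uniform distribution on $\{0,1\}^n$; $\log$ is to base $2$. A $(w,d)$-automaton is a function $Q:[w]\times\{0,1\}^d\to[w]$, and $Q^m(q;y)$ is the state reached from $q$ after $Q$ reads the $m$ consecutive $d$-bit blocks of $y\in\{0,1\}^{md}$. $\mathbf{Q}^m_{w,d}$ is the class of functions $y\mapsto Q^m(q;y)$ from $\{0,1\}^{md}$ to $[w]$, each presented by a pair $(Q,q)$. A function $\mathsf{Sim}$ taking a pair $(Q,q)$ and a seed $x\in\{0,1\}^s$ to an element of $[w]$ is an *$\epsilon$-simulator for $\mathbf{Q}^m_{w,d}$ with seed length $s$* if for every $(Q,q)$ the total variation distance between $\mathsf{Sim}(Q,q,U_s)$ and $Q^m(q;U_{md})$ is at most $\epsilon$. A function $\mathsf{Gen}$ taking $(Q,q)$ and $x\in\{0,1\}^s$ to an element of $\{0,1\}^{md}$ is a *targeted $\epsilon$-pseudorandom generator against $\mathbf{Q}^m_{w,d}$ with seed length $s$* if $(Q,q,x)\mapsto Q^m(q;\mathsf{Gen}(Q,q,x))$ is an $\epsilon$-simulator for $\mathbf{Q}^m_{w,d}$.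 A *deterministic Ladner–Lynch oracle algorithm* is a deterministic multitape Turing machine with a two-way read-only input tape, finitely many work tapes, a write-only output tape and a write-only oracle tape. To consult an oracle $f$ (a function from strings to bit strings) it writes an index $i$ and a query string $y$ on the oracle tape; the bit $f(y)_i$ (or the information that there is no such bit) is stored in the finite control and the oracle tape is erased. Space is the number of work-tape cells used; the input, output and oracle tapes are not counted. An oracle for a simulator $\mathsf{Sim}$ is a function $f$ that maps the encoding of each triple $(Q,q,x)$ ($Q$ given by its transition table) to the binary representation of $\mathsf{Sim}(Q,q,x)$. **Lemma.** There exist a single deterministic Ladner–Lynch oracle algorithm $\mathsf{G}$ and a constant $C$ such that the following holds for all integers $w,m\ge 1$ and $d,s\ge 0$ and every real $\epsilon$. If $\mathsf{Sim}$ is an $\epsilon$-simulator for $\mathbf{Q}^m_{wm,d}$ with seed length $s$, then, given any oracle for $\mathsf{Sim}$ and, as input, the parameters $w,d,m,s$ in binary together with $(Q,q,x)$, where $Q$ is a $(w,d)$-automaton, $q\in[w]$ and $x\in\{0,1\}^s$, the algorithm $\mathsf{G}$ halts and outputs a string $\mathsf{G}^{\mathsf{Sim}}(Q,q,x)\in\{0,1\}^{md}$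 such that: 1. $\mathsf{G}^{\mathsf{Sim}}$ is a targeted $(2mw^2\epsilon)$-pseudorandom generator against $\mathbf{Q}^m_{w,d}$ with seed length $s$; 2. on every such input, $\mathsf{G}$ uses at most $C\,(s+d+\log w+\log m+1)$ space, i.e. space $O(s+d+\log w+\log m)$. -/

import Mathlib

/-! ### Simulators and targeted pseudorandom generators -/

/-- Bit strings of length `n`. -/
abbrev BitString (n : ℕ) : Type := Fin n → Bool

/-- Total variation distance on a finite set, as half of the `L¹` distance. -/
noncomputable def tvDist {α : Type*} [Fintype α] (μ ν : PMF α) : ℝ :=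
  (1 / 2) * ∑ a, |(μ a).toReal - (ν a).toReal|

/-- The distribution of `g (U_n)`, where `U_n` is uniform on `{0,1}^n`. -/
noncomputable def uniformImage {n : ℕ} {α : Type*} (g : BitString n → α) : PMF α :=
  (PMF.uniformOfFintype (BitString n)).map g

/-- Let `F` be a family of functions `{0,1}^n → [w]`, each specified by an element of `ι`.
`Sim` is an `ε`-simulator for the family if `Sim (a, U_s)` is within total variation distance `ε`
of `F a (U_n)`, for every `a`. -/
def IsSimulator {ι : Type*} {n w s : ℕ} (ε : ℝ) (F : ι → BitString n → Fin w)
    (Sim : ι → BitString s → Fin w) : Prop :=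
  ∀ a : ι, tvDist (uniformImage (Sim a)) (uniformImage (F a)) ≤ ε

/-- `Gen` is a targeted `ε`-pseudorandom generator against the family `F`. -/
def IsTargetedPRG {ι : Type*} {n w s : ℕ} (ε : ℝ) (F : ι → BitString n → Fin w)
    (Gen : ι → BitString s → BitString n) : Prop :=
  IsSimulator ε F fun a x => F a (Gen a x)

/-- A `(w, d)`-automaton; the state set `[w]` is `Fin w`. -/
abbrev Automaton (w d : ℕ) : Type := Fin w → BitString d → Fin w

/-- `Q^m (q; x)`: the state reached from `q` after reading the `m` consecutive `d`-bit blocks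
of `x`, first block first. -/
def Automaton.run {w d : ℕ} (m : ℕ) (Q : Automaton w d) (q : Fin w) (x : BitString (m * d)) :
    Fin w :=
  Fin.foldl m (fun v i => Q v fun j => x (finProdFinEquiv (i, j))) q

/-- The class of functions `x ↦ Q^m (q; x)`, an element being specified by the pair `(Q, q)`. -/
def automatonClass (w d m : ℕ) (a : Automaton w d × Fin w) : BitString (m * d) → Fin w :=
  Automaton.run m a.1 a.2

/-! ### Encodings -/

/-- The alphabet of the input tape and of the oracle tape: the two bits and a separator. -/
inductive TapeSym : Type
  | bit (b : Bool)
  | sep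

/-- A natural number, in binary (least significant bit first), followed by a separator. -/
def encodeNat (n : ℕ) : List TapeSym :=
  n.bits.map TapeSym.bit ++ [TapeSym.sep]

/-- The bit string of length `d` whose `j`-th bit is the binary digit of `k` of weight `2^j`. -/
def bitStringOfNat (d k : ℕ) : BitString d := fun j => k.testBit j

/-- The transition table of an automaton. -/
def encodeAutomaton {w d : ℕ} (Q : Automaton w d) : List TapeSym :=
  (List.finRange w).flatMap fun v =>
    (List.range (2 ^ d)).flatMap fun k => encodeNat (Q v (bitStringOfNat d k))

/-- The encoding of a triple `(Q, q, x)`. -/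
def encodeInstance {w d s : ℕ} (Q : Automaton w d) (q : Fin w) (x : BitString s) : List TapeSym :=
  encodeAutomaton Q ++ encodeNat q ++ (List.ofFn x).map TapeSym.bit

/-- The triple `(Q, q, x)` preceded by the numerical parameters. -/
def encodeInput {w d s : ℕ} (m : ℕ) (Q : Automaton w d) (q : Fin w) (x : BitString s) :
    List TapeSym :=
  encodeNat w ++ encodeNat d ++ encodeNat m ++ encodeNat s ++ encodeInstance Q q x

/-! ### Deterministic oracle machines in the Ladner–Lynch model -/

/-- Head movements. -/
inductive HeadMove : Type
  | left
  | stay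
  | right

/-- What the head on the input tape can see: the input is delimited by two end markers. -/
inductive InputSym : Type
  | leftEnd
  | sym (a : TapeSym)
  | rightEnd

/-- What a machine does in one step. `act` writes and moves on all the work tapes, moves the input
head, and possibly appends a symbol to the write-only output tape and one to the write-only oracle
tape. `query` submits the oracle tape; the next state is determined by the answer. -/
inductive LLAction (State Tape Γ : Type) : Type
  | halt
  | act (next : State) (write : Tape → Γ) (move : Tape → HeadMove) (inputMove : HeadMove)
      (output : Option Bool) (oracle : Option TapeSym)
  | query (next : Option Bool → State)

/-- A deterministic oracle Turing machine: a finite control, a two-way read-only input tape, finitely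
many one-way infinite work tapes over a finite alphabet, a write-only output tape and a write-only
oracle tape. -/
structure LLMachine : Type 1 where
  State : Type
  Tape : Type
  Γ : Type
  finite_state : Finite State
  finite_tape : Finite Tape
  finite_alphabet : Finite Γ
  blank : Γ
  start : State
  δ : State → InputSym → (Tape → Γ) → LLAction State Tape Γ

/-- A query is a string over the tape alphabet: the binary digits of an index `i` (least significant
first), a separator, and then the query string proper. -/
def splitQuery : List TapeSym → List Bool × List TapeSym
  | [] => ([], [])
  | TapeSym.sep :: u => ([], u)
  | TapeSym.bit b :: u => (b :: (splitQuery u).1, (splitQuery u).2)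

/-- The answer of the oracle `f` to a query with index `i` and query string `y`: the `i`-th symbol
(counting from `0`) of `f y`, or `none` if `f y` is too short. -/
def oracleAnswer (f : List TapeSym → List Bool) (u : List TapeSym) : Option Bool :=
  (f (splitQuery u).2)[Nat.ofDigits 2 ((splitQuery u).1.map Bool.toNat)]?

namespace LLMachine

/-- A configuration; the contents of the output and oracle tapes are listed in the order in which
they were written. -/
structure Config (M : LLMachine) : Type where
  state : M.State
  inputHead : ℕ
  head : M.Tape → ℕ
  cell : M.Tape → ℕ → M.Γ
  oracleTape : List TapeSym
  output : List Bool

/-- The new position of a head; at the left end of a tape, a move to the left has no effect. -/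
def moveHead : HeadMove → ℕ → ℕ
  | HeadMove.left, p => p - 1
  | HeadMove.stay, p => p
  | HeadMove.right, p => p + 1

/-- The symbol at position `p` of the input tape: the left end marker is at position `0`, and the
right end marker at position `inp.length + 1`. -/
def scan (inp : List TapeSym) : ℕ → InputSym
  | 0 => InputSym.leftEnd
  | p + 1 => match inp[p]? with
    | some a => InputSym.sym a
    | none => InputSym.rightEnd

/-- The initial configuration: empty tapes, and all heads at the left. -/
def init (M : LLMachine) : M.Config where
  state := M.start
  inputHead := 0
  head := fun _ => 0
  cell := fun _ _ => M.blank
  oracleTape := []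
  output := []

/-- One step of `M` on the input `inp` with the oracle `f`; the result is `none` if `M` halts.
A query erases the oracle tape. -/
def step (M : LLMachine) (f : List TapeSym → List Bool) (inp : List TapeSym) (c : M.Config) :
    Option M.Config :=
  match M.δ c.state (scan inp c.inputHead) (fun t => c.cell t (c.head t)) with
  | LLAction.halt => none
  | LLAction.act next write move inputMove output oracle =>
    some
      { state := next
        inputHead := min (moveHead inputMove c.inputHead) (inp.length + 1)
        head := fun t => moveHead (move t) (c.head t)
        cell := fun t => Function.update (c.cell t) (c.head t) (write t)
        oracleTape := c.oracleTape ++ oracle.toList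
        output := c.output ++ output.toList }
  | LLAction.query next =>
    some { c with state := next (oracleAnswer f c.oracleTape), oracleTape := [] }

/-- With the oracle `f`, the machine `M` halts on the input `inp` with the output `out`. -/
def Computes (M : LLMachine) (f : List TapeSym → List Bool) (inp : List TapeSym) (out : List Bool) :
    Prop :=
  ∃ c : M.Config, StateTransition.Reaches (M.step f inp) M.init c ∧ M.step f inp c = none ∧
    c.output = out

/-- Throughout the computation, every work-tape head stays within the first `S` cells of its tape.
(The number of work tapes and the work alphabet do not depend on the input. The input, output and
oracle tapes are not counted.) -/
def UsesSpaceAtMost (M : LLMachine) (f : List TapeSym → List Bool) (inp : List TapeSym) (S : ℕ) : Prop :=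
  ∀ c : M.Config, StateTransition.Reaches (M.step f inp) M.init c → ∀ t, c.head t < S

end LLMachine

/-- The string function `f` is an oracle for the simulator `Sim`: on the encoding of `(Q, q, x)` it
returns `Sim (Q, q, x)` in binary. On other strings `f` is arbitrary. -/
def IsOracleFor {w d s : ℕ} (f : List TapeSym → List Bool)
    (Sim : Automaton w d × Fin w → BitString s → Fin w) : Prop :=
  ∀ (Q : Automaton w d) (q : Fin w) (x : BitString s),
    f (encodeInstance Q q x) = (Sim (Q, q) x : ℕ).bits

theorem splitQuery_encodeNat (n : ℕ) (u : List TapeSym) :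
    splitQuery (encodeNat n ++ u) = (n.bits, u) := by
  have h : ∀ l : List Bool, splitQuery (l.map TapeSym.bit ++ TapeSym.sep :: u) = (l, u) := by
    intro l
    induction l with
    | nil => rfl
    | cons b l ih => simp [splitQuery, ih]
  simpa [encodeNat] using h n.bits

/-- A query with index `i` and query string `y` is answered by `(f y)_i`. -/
theorem oracleAnswer_encodeNat (f : List TapeSym → List Bool) (i : ℕ) (y : List TapeSym) :
    oracleAnswer f (encodeNat i ++ y) = (f y)[i]? := by
  have h : Nat.ofDigits 2 (i.bits.map Bool.toNat) = i := by
    conv_rhs => rw [← Nat.ofDigits_digits 2 i, Nat.digits_two_eq_bits]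
    congr 2
  simp only [oracleAnswer, splitQuery_encodeNat, h]

theorem encodeNat_append_inj {a b : ℕ} {u v : List TapeSym}
    (h : encodeNat a ++ u = encodeNat b ++ v) : a = b ∧ u = v := by
  have h' := congrArg splitQuery h
  rw [splitQuery_encodeNat, splitQuery_encodeNat, Prod.mk.injEq] at h'
  refine ⟨?_, h'.2⟩
  have := congrArg (fun l : List Bool => l.map fun b => cond b 1 0) h'.1
  simp only [← Nat.digits_two_eq_bits] at this
  exact Nat.digits_inj_iff.1 this

theorem flatMap_append_inj {α β : Type*} {e e' : α → List β}
    (he : ∀ a u v, e a ++ u = e' a ++ v → e a = e' a ∧ u = v) :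
    ∀ (l : List α) (u v : List β), l.flatMap e ++ u = l.flatMap e' ++ v →
      (∀ a ∈ l, e a = e' a) ∧ u = v
  | [], u, v, h => ⟨by simp, by simpa using h⟩
  | a :: l, u, v, h => by
    simp only [List.flatMap_cons, List.append_assoc] at h
    obtain ⟨h1, h2⟩ := he _ _ _ h
    obtain ⟨h3, h4⟩ := flatMap_append_inj he l u v h2
    exact ⟨by simpa using ⟨h1, h3⟩, h4⟩

theorem exists_bitStringOfNat {d : ℕ} (z : BitString d) :
    ∃ k < 2 ^ d, bitStringOfNat d k = z := by
  refine ⟨Nat.ofBits z, Nat.ofBits_lt_two_pow z, ?_⟩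
  funext j
  simp [bitStringOfNat]

/-- Distinct triples have distinct encodings. -/
theorem encodeInstance_inj {w d s : ℕ} {Q Q' : Automaton w d} {q q' : Fin w} {x x' : BitString s}
    (h : encodeInstance Q q x = encodeInstance Q' q' x') : Q = Q' ∧ q = q' ∧ x = x' := by
  have henc : ∀ (a b : ℕ) (u v : List TapeSym), encodeNat a ++ u = encodeNat b ++ v →
      encodeNat a = encodeNat b ∧ u = v := fun a b u v h =>
    ⟨by rw [(encodeNat_append_inj h).1], (encodeNat_append_inj h).2⟩
  simp only [encodeInstance, encodeAutomaton, List.append_assoc] at h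
  obtain ⟨h1, h2⟩ := flatMap_append_inj (fun v u u' hu => by
    obtain ⟨h3, h4⟩ := flatMap_append_inj (fun k u u' hu => henc _ _ _ _ hu) _ _ _ hu
    exact ⟨List.flatMap_congr h3, h4⟩) _ _ _ h
  obtain ⟨h3, h4⟩ := encodeNat_append_inj h2
  refine ⟨?_, Fin.ext h3, ?_⟩
  · funext v z
    obtain ⟨k, hk, rfl⟩ := exists_bitStringOfNat z
    have h5 := h1 v (List.mem_finRange v)
    have h6 := (flatMap_append_inj (fun k u u' hu => henc _ _ _ _ hu) _ [] []
      (by simpa using h5)).1 k (List.mem_range.2 hk)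
    exact Fin.ext (encodeNat_append_inj (u := []) (v := []) (by simpa using h6)).1
  · have : Function.Injective TapeSym.bit := fun a b hab => by injection hab
    exact List.ofFn_injective (this.list_map h4)

/-- Every simulator is presented by some oracle. -/
theorem exists_isOracleFor {w d s : ℕ} (Sim : Automaton w d × Fin w → BitString s → Fin w) :
    ∃ f : List TapeSym → List Bool, IsOracleFor f Sim := by
  classical
  refine ⟨fun u => if h : ∃ p : Automaton w d × Fin w × BitString s,
      encodeInstance p.1 p.2.1 p.2.2 = u then
        (Sim (h.choose.1, h.choose.2.1) h.choose.2.2 : ℕ).bits else [], ?_⟩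
  intro Q q x
  have h : ∃ p : Automaton w d × Fin w × BitString s,
      encodeInstance p.1 p.2.1 p.2.2 = encodeInstance Q q x := ⟨(Q, q, x), rfl⟩
  obtain ⟨h1, h2, h3⟩ := encodeInstance_inj h.choose_spec
  simp only [dif_pos h]
  rw [h1, h2, h3]

/-! ### Structured programs for oracle machines whose work tapes hold binary counters -/

/-! Write p_l(u) for the probability that `Q` reaches a fixed target t from u in l random steps
(`hitProb`). The generator consults the simulator for two purposes, both with automata on w·m
states. The states form m layers of copies of [w], the copy of u in layer l having number u + l·w.
Above layer 0, each step follows `Q` and descends one layer.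

Drawing a target: if layer 0 moves like `Q` (flag 1), running m steps from q in layer 0 is just
Q^m(q; ·). So `Sim` with the seed x yields a target V that has each value t with probability at
least p_m(q) − ε (`hitProb_layered_moving`).

Finding a path: if layer 0 is frozen (flag 0), running m steps from layer l stops moving after l of
them. Hence the fraction of seeds y on which `Sim` goes from u + l·w to t is within ε of p_l(u)
(`hitProb_layered_frozen`, `abs_hitCount_sub_le`). Starting from q, the generator repeatedly picks
the block z that maximizes this fraction at Q(u, z), where l steps remain after the block. Only l ≤
m − 1 is needed, so m layers suffice. Since p_{l+1}(u) is the average of p_l(Q(u, z)) over z, a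
greedy step loses at most 2ε (`hitProb_le_greedyState`). If p_m(q) > 2mε, the final state has p_0 >
0, so it is t (`greedyState_eq`).

Thus every t is reached with probability at least p_m(q) − 2mε: trivially if p_m(q) ≤ 2mε, and
otherwise because the path reaches every drawn target t. A one-sided pointwise bound δ gives total
variation distance at most wδ, here 2mwε (`isTargetedPRG_greedyGen`).

For the space bound, no path and no table is stored. Blocks go to the output as soon as they are
chosen. The long query containing the layered transition table is produced by nested loops directly
on the uncounted oracle tape, and is written afresh for every bit of every answer. What remains is a
fixed number of binary counters with values O(w·m·2^d·2^s), whose width is O(s + d + log w + log m).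

The machine is built from program fragments with designated exits. A correctness statement
`Block.Runs` describes their effect on counter values, the input head, the oracle tape and the
output, and includes the space bound. It holds for every machine containing the fragment, so it is
preserved by composition and by loops. -/

/-- The work alphabet: a marker for the left end of a tape, a blank, and the two bits. -/
inductive WorkSym : Type
  | mark
  | blank
  | bit (b : Bool)

theorem finite_workSym : Finite WorkSym := by
  refine Finite.of_injective (β := Option (Option Bool)) (fun a => match a with
    | .mark => none
    | .blank => some none
    | .bit b => some (some b)) ?_
  rintro (_ | _ | _) (_ | _ | _) h <;> simp_all

/-- The number with binary digits `l`, least significant first. -/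
def binVal : List Bool → ℕ
  | [] => 0
  | b :: l => b.toNat + 2 * binVal l

/-- The contents of a work tape that holds the binary digits `l`. -/
def workTape (l : List Bool) : ℕ → WorkSym
  | 0 => WorkSym.mark
  | p + 1 => match l[p]? with
    | some b => WorkSym.bit b
    | none => WorkSym.blank

/-- The successor on binary digits. -/
def bump : List Bool → List Bool
  | [] => [true]
  | false :: l => true :: l
  | true :: l => false :: bump l

theorem binVal_bump (l : List Bool) : binVal (bump l) = binVal l + 1 := by
  induction l with
  | nil => rfl
  | cons b l ih => cases b <;> simp [bump, binVal, ih] <;> omega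

/-- A carry lengthens the digit string only when all digits are 1. Tape width is therefore
controlled by the largest value held, not by the number of increments. -/
theorem length_bump (l : List Bool) : (bump l).length = l.length ∨
    (bump l).length = l.length + 1 ∧ binVal l + 1 = 2 ^ l.length := by
  induction l with
  | nil => simp [bump, binVal]
  | cons b l ih =>
    cases b
    · simp [bump]
    · simp only [bump, binVal, List.length_cons, pow_succ, Bool.toNat_true]
      omega

theorem binVal_lt (l : List Bool) : binVal l < 2 ^ l.length := by
  induction l with
  | nil => simp [binVal]
  | cons b l ih =>
    have := Bool.toNat_le b
    simp only [binVal, List.length_cons, pow_succ]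
    omega

theorem binVal_append (l l' : List Bool) :
    binVal (l ++ l') = binVal l + 2 ^ l.length * binVal l' := by
  induction l with
  | nil => simp [binVal]
  | cons b l ih => simp only [List.cons_append, binVal, ih, List.length_cons]; ring

theorem binVal_bits (n : ℕ) : binVal n.bits = n := by
  induction n using Nat.binaryRec' with
  | zero => simp [binVal]
  | bit b n h ih =>
    rw [Nat.bits_append_bit _ _ h, binVal, ih, Nat.bit_val]; omega

theorem workTape_append_cons (A l : List Bool) (b : Bool) :
    workTape (A ++ b :: l) (A.length + 1) = WorkSym.bit b := by
  simp [workTape]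

theorem workTape_length_succ (A : List Bool) :
    workTape A (A.length + 1) = WorkSym.blank := by
  simp [workTape]

theorem workTape_succ_ne_mark (l : List Bool) (p : ℕ) : workTape l (p + 1) ≠ WorkSym.mark := by
  simp only [workTape]; split <;> simp

theorem update_workTape (A l : List Bool) (b c : Bool) :
    Function.update (workTape (A ++ b :: l)) (A.length + 1) (WorkSym.bit c) =
      workTape (A ++ c :: l) := by
  funext p
  rcases p with _ | p
  · simp [workTape]
  · rcases lt_trichotomy p A.length with h | h | h
    · rw [Function.update_of_ne (by omega)]
      simp [workTape, List.getElem?_append_left h]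
    · subst h; simp [workTape]
    · rw [Function.update_of_ne (by omega)]
      obtain ⟨k, rfl⟩ := Nat.exists_eq_add_of_lt h
      simp only [workTape]
      rw [List.getElem?_append_right (by omega), List.getElem?_append_right (by omega),
        show A.length + k + 1 - A.length = k + 1 by omega]
      rfl

theorem update_workTape_end (A : List Bool) (c : Bool) :
    Function.update (workTape A) (A.length + 1) (WorkSym.bit c) = workTape (A ++ [c]) := by
  funext p
  rcases p with _ | p
  · simp [workTape]
  · rcases lt_trichotomy p A.length with h | h | h
    · rw [Function.update_of_ne (by omega)]
      simp [workTape, List.getElem?_append_left h]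
    · subst h; simp [workTape]
    · rw [Function.update_of_ne (by omega)]
      simp only [workTape]
      rw [List.getElem?_eq_none (by omega), List.getElem?_eq_none (by simp; omega)]

/-! ### Program fragments, counter states and their representation on tapes -/

/-- Relabelling of the states in an action. -/
def LLAction.mapState {A B T Γ : Type} (g : A → B) : LLAction A T Γ → LLAction B T Γ
  | LLAction.halt => LLAction.halt
  | LLAction.act n w m i o q => LLAction.act (g n) w m i o q
  | LLAction.query n => LLAction.query fun a => g (n a)

theorem LLAction.mapState_mapState {A B C T Γ : Type} (g : A → B) (h : B → C)
    (a : LLAction A T Γ) : (a.mapState g).mapState h = a.mapState fun x => h (g x) := by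
  cases a <;> rfl

/-- An action on the tape `r` only, when the scanned work symbols are `g`. -/
def LLAction.onTape {S R : Type} [DecidableEq R] (r : R) (next : S) (a : WorkSym) (mv : HeadMove)
    (g : R → WorkSym) : LLAction S R WorkSym :=
  LLAction.act next (fun t => if t = r then a else g t)
    (fun t => if t = r then mv else HeadMove.stay) HeadMove.stay none none

/-- An action that leaves the work tapes alone, when the scanned work symbols are `g`. -/
def LLAction.external {S R : Type} (next : S) (mv : HeadMove) (out : Option Bool)
    (orc : Option TapeSym) (g : R → WorkSym) : LLAction S R WorkSym :=
  LLAction.act next g (fun _ => HeadMove.stay) mv out orc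

/-- A program fragment with counters in `R`: part of the control of a machine, which is left
through one of the exits in `O`. -/
structure Block (R O : Type) where
  P : Type
  finite : Finite P
  entry : P
  δ : P → InputSym → (R → WorkSym) → LLAction (P ⊕ O) R WorkSym

/-- What a program fragment sees of a configuration: the values of the counters, the position of the
input head, the contents of the oracle tape and of the output tape. -/
@[ext]
structure CounterState (R : Type) where
  reg : R → ℕ
  inputHead : ℕ
  orc : List TapeSym
  out : List Bool

/-- The machine with a given control and one work tape for each counter. -/
def counterMachine {R : Type} (hR : Finite R) {P : Type} (hP : Finite P) (start : P)
    (δ : P → InputSym → (R → WorkSym) → LLAction P R WorkSym) : LLMachine where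
  State := P
  Tape := R
  Γ := WorkSym
  finite_state := hP
  finite_tape := hR
  finite_alphabet := finite_workSym
  blank := WorkSym.blank
  start := start
  δ := δ

/-- Fixed data of a run: a bound for the counters, the oracle and the input. -/
structure RunEnv where
  bound : ℕ
  oracle : List TapeSym → List Bool
  input : List TapeSym

/-- The number of cells available on each work tape. -/
def RunEnv.space (E : RunEnv) : ℕ := Nat.log 2 E.bound + 4

/-- A finite run in which all heads stay within the first `S` cells. -/
def SpaceReaches (M : LLMachine) (f : List TapeSym → List Bool) (inp : List TapeSym) (S : ℕ) :
    M.Config → M.Config → Prop :=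
  Relation.ReflTransGen fun a b => M.step f inp a = some b ∧ ∀ t, a.head t < S

/-- The tape contents `cell` represent the counter value `n`. -/
def RepresentsNat (N n : ℕ) (cell : ℕ → WorkSym) : Prop :=
  ∃ l, cell = workTape l ∧ binVal l = n ∧ 2 ^ l.length ≤ 2 * N

/-- The tape contents `cell` represent the counters of `σ`. -/
def RunEnv.Represents {R : Type} (E : RunEnv) (σ : CounterState R) (cell : R → ℕ → WorkSym) :
    Prop :=
  σ.inputHead ≤ E.input.length + 1 ∧ ∀ r, RepresentsNat E.bound (σ.reg r) (cell r)

/-! ### Single steps of a counter machine -/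

section Machine

variable {R P : Type} {hR : Finite R} {hP : Finite P} {start : P}
  {δ : P → InputSym → (R → WorkSym) → LLAction P R WorkSym}

/-- A configuration of a counter machine. -/
def counterConfig (st : P) (σ : CounterState R) (head : R → ℕ) (cell : R → ℕ → WorkSym) :
    (counterMachine hR hP start δ).Config where
  state := st
  inputHead := σ.inputHead
  head := head
  cell := cell
  oracleTape := σ.orc
  output := σ.out

theorem step_counterConfig_act {f inp} {st st' : P} {σ : CounterState R} {head : R → ℕ}
    {cell : R → ℕ → WorkSym} {write move im o q}
    (h : δ st (LLMachine.scan inp σ.inputHead) (fun t => cell t (head t)) =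
      LLAction.act st' write move im o q) :
    (counterMachine hR hP start δ).step f inp (counterConfig st σ head cell) =
      some (counterConfig st' ⟨σ.reg, min (LLMachine.moveHead im σ.inputHead) (inp.length + 1),
        σ.orc ++ q.toList, σ.out ++ o.toList⟩ (fun t => LLMachine.moveHead (move t) (head t))
        (fun t => Function.update (cell t) (head t) (write t))) := by
  have h' : (counterMachine hR hP start δ).δ st (LLMachine.scan inp σ.inputHead)
    (fun t => cell t (head t)) = LLAction.act st' write move im o q := h
  simp only [LLMachine.step, counterConfig]
  rw [h']
  rfl

theorem step_counterConfig_query {f inp} {st : P} {st' : Option Bool → P} {σ : CounterState R}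
    {head : R → ℕ} {cell : R → ℕ → WorkSym}
    (h : δ st (LLMachine.scan inp σ.inputHead) (fun t => cell t (head t)) =
      LLAction.query st') :
    (counterMachine hR hP start δ).step f inp (counterConfig st σ head cell) =
      some (counterConfig (st' (oracleAnswer f σ.orc)) ⟨σ.reg, σ.inputHead, [], σ.out⟩
        head cell) := by
  have h' : (counterMachine hR hP start δ).δ st (LLMachine.scan inp σ.inputHead)
    (fun t => cell t (head t)) = LLAction.query st' := h
  simp only [LLMachine.step, counterConfig]
  rw [h']

/-- Between fragments all heads rest on cell 1, the lowest digit. During an operation on the counter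
r only the head of r leaves it, which is why the head positions are an update of the constant 1. -/
theorem step_onTape [DecidableEq R] {f inp} {st st' : P} {σ : CounterState R}
    (hσ : σ.inputHead ≤ inp.length + 1) {cell : R → ℕ → WorkSym} {r : R} {p : ℕ}
    {X : ℕ → WorkSym} {a : WorkSym} {mv : HeadMove}
    (h : ∀ i g, g r = X p → δ st i g = LLAction.onTape r st' a mv g) :
    (counterMachine hR hP start δ).step f inp (counterConfig st σ
      (Function.update (fun _ => 1) r p) (Function.update cell r X)) =
      some (counterConfig st' σ (Function.update (fun _ => 1) r (LLMachine.moveHead mv p))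
        (Function.update cell r (Function.update X p a))) := by
  rw [step_counterConfig_act (h _ _ (by simp))]
  congr 2
  · cases σ; simp_all [LLMachine.moveHead]
  · funext t
    by_cases ht : t = r
    · subst ht; simp
    · simp [ht, LLMachine.moveHead]
  · funext t
    by_cases ht : t = r
    · subst ht; simp
    · simp [ht]

end Machine

/-! ### Composition and iteration of fragments -/

namespace Block

variable {R O O₂ : Type}

/-- The fragment `B`, started with the counters `σ`, is left through the exit `o` with the counters
`σ'`, whatever the machine it is part of. -/
def Runs (B : Block R O) (E : RunEnv) (σ : CounterState R) (o : O) (σ' : CounterState R) : Prop :=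
  ∀ (hR : Finite R) (P : Type) (hP : Finite P) (start : P)
    (δ : P → InputSym → (R → WorkSym) → LLAction P R WorkSym) (e : B.P ⊕ O → P),
    (∀ p i g, δ (e (Sum.inl p)) i g = (B.δ p i g).mapState e) →
    ∀ cell, E.Represents σ cell → ∃ cell₁, E.Represents σ' cell₁ ∧
      SpaceReaches (counterMachine hR hP start δ) E.oracle E.input E.space
        (counterConfig (e (Sum.inl B.entry)) σ (fun _ => 1) cell)
        (counterConfig (e (Sum.inr o)) σ' (fun _ => 1) cell₁)

/-- Run `A`, then the fragment that its exit selects. -/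
def bind (hO : Finite O) (A : Block R O) (B : O → Block R O₂) : Block R O₂ where
  P := A.P ⊕ (Σ o, (B o).P)
  finite := by
    have := A.finite
    have := fun o => (B o).finite
    infer_instance
  entry := Sum.inl A.entry
  δ p i g := match p with
    | Sum.inl p => (A.δ p i g).mapState fun x => match x with
      | Sum.inl p => Sum.inl (Sum.inl p)
      | Sum.inr o => Sum.inl (Sum.inr ⟨o, (B o).entry⟩)
    | Sum.inr ⟨o, p⟩ => ((B o).δ p i g).mapState fun x => match x with
      | Sum.inl p => Sum.inl (Sum.inr ⟨o, p⟩)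
      | Sum.inr o => Sum.inr o

/-- Run `A` until it is left through the exit `false`. -/
def loop (A : Block R Bool) : Block R Unit where
  P := A.P
  finite := A.finite
  entry := A.entry
  δ p i g := (A.δ p i g).mapState fun x => match x with
      | Sum.inl p => Sum.inl p
      | Sum.inr true => Sum.inl A.entry
      | Sum.inr false => Sum.inr ()

variable {E : RunEnv} {σ σ₁ σ₂ : CounterState R}

/-- Because `Runs` speaks of all host machines, it suffices to choose the embeddings: in the one for
`A`, the exit o is identified with the entry of `B o`. The two runs then take place in the same
machine and are concatenated. -/
theorem runs_bind {hO : Finite O} {A : Block R O} {B : O → Block R O₂} {o : O} {o₂ : O₂}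
    (hA : A.Runs E σ o σ₁) (hB : (B o).Runs E σ₁ o₂ σ₂) : (bind hO A B).Runs E σ o₂ σ₂ := by
  intro hR P hP start δ e he cell hc
  obtain ⟨c₁, h₁, r₁⟩ := hA hR P hP start δ (fun x => match x with
      | Sum.inl p => e (Sum.inl (Sum.inl p))
      | Sum.inr o => e (Sum.inl (Sum.inr ⟨o, (B o).entry⟩))) (by
    intro p i g
    refine (he (Sum.inl p) i g).trans ((LLAction.mapState_mapState _ _ _).trans ?_)
    congr 1
    funext x
    rcases x with x | x <;> rfl) cell hc
  obtain ⟨c₂, h₂, r₂⟩ := hB hR P hP start δ (fun x => match x with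
      | Sum.inl p => e (Sum.inl (Sum.inr ⟨o, p⟩))
      | Sum.inr o => e (Sum.inr o)) (by
    intro p i g
    refine (he (Sum.inr ⟨o, p⟩) i g).trans ((LLAction.mapState_mapState _ _ _).trans ?_)
    congr 1
    funext x
    rcases x with x | x <;> rfl) c₁ h₁
  exact ⟨c₂, h₂, r₁.trans r₂⟩

/-- The exit `true` is identified with the entry of the same fragment, so one pass through the body
ends where the remaining loop begins. Embeddings need not be injective. -/
theorem runs_loop_true {A : Block R Bool} (hA : A.Runs E σ true σ₁)
    (hB : A.loop.Runs E σ₁ () σ₂) : A.loop.Runs E σ () σ₂ := by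
  intro hR P hP start δ e he cell hc
  obtain ⟨c₁, h₁, r₁⟩ := hA hR P hP start δ (fun x => match x with
      | Sum.inl p => e (Sum.inl p)
      | Sum.inr true => e (Sum.inl A.entry)
      | Sum.inr false => e (Sum.inr ())) (by
    intro p i g
    refine (he p i g).trans ((LLAction.mapState_mapState _ _ _).trans ?_)
    congr 1
    funext x
    rcases x with x | _ | _ <;> rfl) cell hc
  obtain ⟨c₂, h₂, r₂⟩ := hB hR P hP start δ e he c₁ h₁
  exact ⟨c₂, h₂, r₁.trans r₂⟩

theorem runs_loop_false {A : Block R Bool} (hA : A.Runs E σ false σ₁) :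
    A.loop.Runs E σ () σ₁ := by
  intro hR P hP start δ e he cell hc
  exact hA hR P hP start δ (fun x => match x with
      | Sum.inl p => e (Sum.inl p)
      | Sum.inr true => e (Sum.inl A.entry)
      | Sum.inr false => e (Sum.inr ())) (by
    intro p i g
    refine (he p i g).trans ((LLAction.mapState_mapState _ _ _).trans ?_)
    congr 1
    funext x
    rcases x with x | _ | _ <;> rfl) cell hc

/-- One step that leaves the work tapes alone; the exit depends on the scanned input symbol. -/
def external (o : InputSym → O) (mv : HeadMove) (out : Option Bool) (orc : Option TapeSym) :
    Block R O where
  P := Unit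
  finite := inferInstance
  entry := ()
  δ _ i g := LLAction.external (Sum.inr (o i)) mv out orc g

/-- Submit the oracle tape; the exit is the answer. -/
def ask : Block R (Option Bool) where
  P := Unit
  finite := inferInstance
  entry := ()
  δ _ _ _ := LLAction.query fun a => Sum.inr a

theorem one_lt_space (E : RunEnv) : 1 < E.space := by simp [RunEnv.space]

theorem runs_external {o : InputSym → O} {mv : HeadMove} {out : Option Bool}
    {orc : Option TapeSym} : (external o mv out orc).Runs E σ
      (o (LLMachine.scan E.input σ.inputHead))
      ⟨σ.reg, min (LLMachine.moveHead mv σ.inputHead) (E.input.length + 1),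
        σ.orc ++ orc.toList, σ.out ++ out.toList⟩ := by
  intro hR P hP start δ e he cell hc
  refine ⟨cell, ⟨min_le_right _ _, hc.2⟩,
    Relation.ReflTransGen.single ⟨?_, fun _ => one_lt_space E⟩⟩
  rw [step_counterConfig_act (he _ _ _)]
  congr 2
  funext t
  simp

theorem runs_ask : (ask (R := R)).Runs E σ (oracleAnswer E.oracle σ.orc)
    ⟨σ.reg, σ.inputHead, [], σ.out⟩ := by
  intro hR P hP start δ e he cell hc
  refine ⟨cell, hc, Relation.ReflTransGen.single ⟨?_, fun _ => one_lt_space E⟩⟩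
  exact step_counterConfig_query (he () _ _)

/-! ### Binary increment and decrement -/

variable [DecidableEq R]

/-- The transitions of `inc`: the carry runs to the right (`false`), the head returns (`true`). -/
def incStep (r : R) (p : Bool) (g : R → WorkSym) : LLAction (Bool ⊕ Unit) R WorkSym :=
  match p, g r with
    | false, WorkSym.bit true => LLAction.onTape r (Sum.inl false) (WorkSym.bit false) .right g
    | false, _ => LLAction.onTape r (Sum.inl true) (WorkSym.bit true) .left g
    | true, WorkSym.mark => LLAction.onTape r (Sum.inr ()) WorkSym.mark .right g
    | true, a => LLAction.onTape r (Sum.inl true) a .left g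

/-- Increment the counter `r`. -/
def inc (r : R) : Block R Unit where
  P := Bool
  finite := inferInstance
  entry := false
  δ p _ g := incStep r p g

/-- The transitions of `dec`: the head looks for the lowest digit `1` (`none`), and returns with a
borrow (`some true`) or without (`some false`). -/
def decStep (r : R) (p : Option Bool) (g : R → WorkSym) :
    LLAction (Option Bool ⊕ Bool) R WorkSym :=
  match p, g r with
    | none, WorkSym.bit true => LLAction.onTape r (Sum.inl (some true)) (WorkSym.bit false) .left g
    | none, WorkSym.bit false => LLAction.onTape r (Sum.inl none) (WorkSym.bit false) .right g
    | none, a => LLAction.onTape r (Sum.inl (some false)) a .left g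
    | some b, WorkSym.mark => LLAction.onTape r (Sum.inr b) WorkSym.mark .right g
    | some true, _ => LLAction.onTape r (Sum.inl (some true)) (WorkSym.bit true) .left g
    | some false, a => LLAction.onTape r (Sum.inl (some false)) a .left g

/-- Decrement the counter `r` if it is positive; the exit tells whether it was. -/
def dec (r : R) : Block R Bool where
  P := Option Bool
  finite := inferInstance
  entry := none
  δ p _ g := decStep r p g

end Block

/-- The state with the counter `r` set to `n`. -/
def CounterState.set {R : Type} [DecidableEq R] (σ : CounterState R) (r : R) (n : ℕ) :
    CounterState R :=
  { σ with reg := Function.update σ.reg r n }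

theorem head_update_lt {R : Type} [DecidableEq R] {S p : ℕ} (hS : 1 < S) (hp : p < S) (r t : R) :
    Function.update (fun _ => 1) r p t < S := by
  by_cases h : t = r
  · subst h; simpa
  · simpa [h]

theorem update_const_self {R : Type} [DecidableEq R] (r : R) :
    Function.update (fun _ : R => 1) r 1 = fun _ => 1 := by
  funext t; by_cases h : t = r <;> simp [Function.update_apply]

section Machine

variable {R P : Type} [DecidableEq R] {hR : Finite R} {hP : Finite P} {start : P}
  {δ : P → InputSym → (R → WorkSym) → LLAction P R WorkSym} {f : List TapeSym → List Bool}
  {inp : List TapeSym} {S : ℕ}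

/-- A head that moves left without writing until it finds the marker ends up at the first digit. -/
theorem spaceReaches_home {st st' : P} {σ : CounterState R} (hσ : σ.inputHead ≤ inp.length + 1)
    {r : R} (hS : 1 < S)
    (h₁ : ∀ i g, g r = WorkSym.mark → δ st i g = LLAction.onTape r st' WorkSym.mark .right g)
    (h₂ : ∀ i g, g r ≠ WorkSym.mark → δ st i g = LLAction.onTape r st (g r) .left g)
    (cell : R → ℕ → WorkSym) (l : List Bool) (p : ℕ) (hp : p < S) :
    SpaceReaches (counterMachine hR hP start δ) f inp S
      (counterConfig st σ (Function.update (fun _ => 1) r p) (Function.update cell r (workTape l)))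
      (counterConfig st' σ (fun _ => 1) (Function.update cell r (workTape l))) := by
  induction p with
  | zero =>
    refine Relation.ReflTransGen.single ⟨?_, head_update_lt hS hp r⟩
    rw [step_onTape hσ fun i g hg => h₁ i g hg]
    simp only [LLMachine.moveHead, zero_add, update_const_self]
    congr 3
    exact Function.update_eq_self 0 (workTape l)
  | succ p ih =>
    refine Relation.ReflTransGen.head ⟨?_, head_update_lt hS hp r⟩ (ih (by omega))
    rw [step_onTape hσ fun i g hg => (h₂ i g (by rw [hg]; exact workTape_succ_ne_mark l p)).trans
      (by rw [hg])]
    simp [LLMachine.moveHead]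

end Machine

/-- The digit string has at most log N + 1 digits. The marker and the first blank behind the digits
are scanned as well, which accounts for the 4 in `RunEnv.space`. -/
theorem length_lt_space {E : RunEnv} {l : List Bool} (h : 2 ^ l.length ≤ 2 * E.bound) :
    l.length + 2 < E.space := by
  have hN : E.bound ≠ 0 := by rintro h0; simp [h0] at h
  have := Nat.le_log_of_pow_le (b := 2) (by norm_num) h
  rw [mul_comm, Nat.log_mul_base (by norm_num) hN] at this
  simp only [RunEnv.space]
  omega

/-! ### Correctness of increment and decrement -/

namespace Block

variable {R : Type} [DecidableEq R] {E : RunEnv} {σ : CounterState R}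

theorem represents_set {cell : R → ℕ → WorkSym} (h : E.Represents σ cell) (r : R) {n : ℕ}
    {X : ℕ → WorkSym} (hX : RepresentsNat E.bound n X) :
    E.Represents (σ.set r n) (Function.update cell r X) := by
  refine ⟨h.1, fun t => ?_⟩
  by_cases ht : t = r
  · subst ht; simpa [CounterState.set]
  · simpa [CounterState.set, ht] using h.2 t

/-- The invariant 2^length ≤ 2N survives an overflow: if the string grows, the old value plus one is
exactly 2^length, and this is at most N because the old value is below the bound. -/
theorem runs_inc {r : R} (hr : σ.reg r < E.bound) :
    (inc r).Runs E σ () (σ.set r (σ.reg r + 1)) := by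
  intro hR P hP start δ (e : Bool ⊕ Unit → P) he cell hc
  replace he : ∀ (p : Bool) i g, δ (e (Sum.inl p)) i g = (incStep r p g).mapState e := he
  obtain ⟨l, hl, hv, hb⟩ := hc.2 r
  have hsp := length_lt_space hb
  -- `A` is the part already passed by the carry. The final head position is left unspecified, since
  -- the return to the first digit works from any cell.
  have carry : ∀ l A : List Bool, (A ++ l).length + 2 < E.space → ∃ p < E.space,
      SpaceReaches (counterMachine hR hP start δ) E.oracle E.input E.space
        (counterConfig (e (Sum.inl false)) σ (Function.update (fun _ => 1) r (A.length + 1))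
          (Function.update cell r (workTape (A ++ l))))
        (counterConfig (e (Sum.inl true)) σ (Function.update (fun _ => 1) r p)
          (Function.update cell r (workTape (A ++ bump l)))) := by
    intro l
    induction l with
    | nil =>
      intro A hA
      simp only [List.append_nil] at hA
      refine ⟨A.length, by omega, Relation.ReflTransGen.single
        ⟨?_, head_update_lt (one_lt_space E) (by omega) r⟩⟩
      rw [step_onTape hc.1 (st' := e (Sum.inl true)) (a := WorkSym.bit true) (mv := .left)]
      · simp [LLMachine.moveHead, bump, update_workTape_end]
      · intro i g hg
        rw [List.append_nil, workTape_length_succ] at hg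
        simp only [he, incStep, hg]
        rfl
    | cons b l ih =>
      intro A hA
      simp only [List.length_append, List.length_cons] at hA
      cases b
      · refine ⟨A.length, by omega, Relation.ReflTransGen.single
          ⟨?_, head_update_lt (one_lt_space E) (by omega) r⟩⟩
        rw [step_onTape hc.1 (st' := e (Sum.inl true)) (a := WorkSym.bit true) (mv := .left)]
        · simp [LLMachine.moveHead, bump, update_workTape]
        · intro i g hg
          rw [workTape_append_cons] at hg
          simp only [he, incStep, hg]
          rfl
      · obtain ⟨p, hp, ih⟩ := ih (A ++ [false]) (by simp at hA ⊢; omega)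
        simp only [List.append_assoc, List.singleton_append, List.length_append,
          List.length_singleton] at ih
        refine ⟨p, hp, Relation.ReflTransGen.head
          ⟨?_, head_update_lt (one_lt_space E) (by omega) r⟩ ih⟩
        rw [step_onTape hc.1 (st' := e (Sum.inl false)) (a := WorkSym.bit false) (mv := .right)]
        · simp [LLMachine.moveHead, update_workTape]
        · intro i g hg
          rw [workTape_append_cons] at hg
          simp only [he, incStep, hg]
          rfl
  obtain ⟨p, hp, h₁⟩ := carry l [] (by simpa using hsp)
  simp only [List.nil_append, List.length_nil, zero_add, update_const_self] at h₁
  rw [← hl, Function.update_eq_self] at h₁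
  refine ⟨Function.update cell r (workTape (bump l)), represents_set hc r
    ⟨bump l, rfl, by rw [binVal_bump, hv], ?_⟩, h₁.trans ?_⟩
  · rcases length_bump l with h | ⟨h, h'⟩
    · rwa [h]
    · rw [h, pow_succ, ← h']; omega
  · refine spaceReaches_home hc.1 (st := e (Sum.inl true)) (st' := e (Sum.inr ()))
      (one_lt_space E) ?_ ?_ _ _ p hp
    · intro i g hg
      simp only [he, incStep, hg]
      rfl
    · intro i g hg
      rcases h : g r with _ | _ | _
      · exact absurd h hg
      · simp only [he, incStep, h]; rfl
      · simp only [he, incStep, h]; rfl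

theorem binVal_eq_zero {l : List Bool} (h : ∀ b ∈ l, b = false) : binVal l = 0 := by
  induction l with
  | nil => rfl
  | cons b l ih => simp_all [binVal]

/-- This is the arithmetic of borrowing: to subtract one, turn the lowest 1 into 0 and all the zeros
below it into 1. -/
theorem binVal_replicate_false (k : ℕ) (l : List Bool) :
    binVal (List.replicate k false ++ true :: l) =
      binVal (List.replicate k true ++ false :: l) + 1 := by
  induction k with
  | zero => simp [binVal]; omega
  | succ k ih => simp [List.replicate_succ, binVal, ih]; omega

theorem eq_replicate_or (l : List Bool) : l = List.replicate l.length false ∨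
    ∃ k l', l = List.replicate k false ++ true :: l' := by
  induction l with
  | nil => simp
  | cons b l ih =>
    cases b
    · rcases ih with ih | ⟨k, l', rfl⟩
      · left; rw [List.length_cons, List.replicate_succ, ← ih]
      · right; exact ⟨k + 1, l', by simp [List.replicate_succ]⟩
    · exact Or.inr ⟨0, l, by simp⟩

/-- The search for the lowest digit `1` runs over the digits `0`. -/
theorem spaceReaches_dec_scan {hR : Finite R} {P : Type} {hP : Finite P} {start : P}
    {δ : P → InputSym → (R → WorkSym) → LLAction P R WorkSym} {r : R} {e : Option Bool ⊕ Bool → P}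
    (he : ∀ p i g, δ (e (Sum.inl p)) i g = (decStep r p g).mapState e)
    {cell : R → ℕ → WorkSym} (hc : σ.inputHead ≤ E.input.length + 1) (l : List Bool) (k : ℕ) :
    ∀ A : List Bool, A.length + k < E.space →
    SpaceReaches (counterMachine hR hP start δ) E.oracle E.input E.space
      (counterConfig (e (Sum.inl (none : Option Bool))) σ
        (Function.update (fun _ => 1) r (A.length + 1))
        (Function.update cell r (workTape (A ++ (List.replicate k false ++ l)))))
      (counterConfig (e (Sum.inl (none : Option Bool))) σ
        (Function.update (fun _ => 1) r (A.length + k + 1))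
        (Function.update cell r (workTape (A ++ (List.replicate k false ++ l))))) := by
  induction k with
  | zero => intro A _; exact Relation.ReflTransGen.refl
  | succ k ih =>
    intro A hA
    have := ih (A ++ [false]) (by simp; omega)
    simp only [List.append_assoc, List.length_append, List.length_singleton, List.cons_append,
      List.nil_append] at this
    rw [show A.length + 1 + k + 1 = A.length + (k + 1) + 1 by omega] at this
    rw [List.replicate_succ, List.cons_append]
    refine Relation.ReflTransGen.head ⟨?_, head_update_lt (one_lt_space E) (by omega) r⟩ this
    rw [step_onTape hc (st' := e (Sum.inl none)) (a := WorkSym.bit false) (mv := .right)]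
    · simp [LLMachine.moveHead, update_workTape]
    · intro i g hg
      rw [workTape_append_cons] at hg
      simp only [he, decStep, hg]
      rfl

/-- Decrementing never shortens the digit string, so zero may appear as any string of digits 0. The
search then meets the blank behind them, and the head returns without having changed the tape. -/
theorem runs_dec_zero {r : R} (hr : σ.reg r = 0) : (dec r).Runs E σ false σ := by
  intro hR P hP start δ (e : Option Bool ⊕ Bool → P) he cell hc
  replace he : ∀ (p : Option Bool) i g, δ (e (Sum.inl p)) i g = (decStep r p g).mapState e := he
  obtain ⟨l, hl, hv, hb⟩ := hc.2 r
  have hsp := length_lt_space hb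
  rcases eq_replicate_or l with h | ⟨k, l', rfl⟩
  · have h₁ := spaceReaches_dec_scan (hR := hR) (hP := hP) (start := start) he (cell := cell)
      hc.1 [] l.length [] (by simp; omega)
    simp only [List.nil_append, List.append_nil, List.length_nil, zero_add,
      update_const_self] at h₁
    rw [← h, ← hl, Function.update_eq_self] at h₁
    refine ⟨cell, hc, h₁.trans ?_⟩
    have h₂ := spaceReaches_home (hR := hR) (hP := hP) (start := start) (δ := δ)
      (f := E.oracle) hc.1 (st := e (Sum.inl (some false))) (st' := e (Sum.inr false)) (r := r)
      (one_lt_space E) (by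
        intro i g hg
        simp only [he, decStep, hg]
        rfl) (by
        intro i g hg
        rcases h : g r with _ | _ | _
        · exact absurd h hg
        · simp only [he, decStep, h]; rfl
        · simp only [he, decStep, h]; rfl) cell l l.length (by omega)
    rw [← hl, Function.update_eq_self] at h₂
    refine Relation.ReflTransGen.head ⟨?_, head_update_lt (one_lt_space E) (by omega) r⟩ h₂
    have := step_onTape (hR := hR) (hP := hP) (start := start) (f := E.oracle) hc.1 (cell := cell)
      (X := cell r) (r := r) (p := l.length + 1) (st := e (Sum.inl none))
      (st' := e (Sum.inl (some false))) (a := WorkSym.blank) (mv := .left) (δ := δ) (by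
        intro i g hg
        rw [hl, workTape_length_succ] at hg
        simp only [he, decStep, hg]
        rfl)
    rw [Function.update_eq_self] at this
    rw [this]
    -- The blank at the end is overwritten by itself.
    congr 2
    rw [hl, ← workTape_length_succ l, Function.update_eq_self, ← hl, Function.update_eq_self]
  · rw [binVal_replicate_false] at hv; omega

/-- Leading zeros are kept, hence the length and with it the width invariant are unchanged; only the
value has to be checked. -/
theorem runs_dec_succ {r : R} {n : ℕ} (hr : σ.reg r = n + 1) :
    (dec r).Runs E σ true (σ.set r n) := by
  intro hR P hP start δ (e : Option Bool ⊕ Bool → P) he cell hc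
  replace he : ∀ (p : Option Bool) i g, δ (e (Sum.inl p)) i g = (decStep r p g).mapState e := he
  obtain ⟨l, hl, hv, hb⟩ := hc.2 r
  have hsp := length_lt_space hb
  rcases eq_replicate_or l with h | ⟨k, l', rfl⟩
  · rw [h, binVal_eq_zero (by simp), hr] at hv; omega
  · have h₁ := spaceReaches_dec_scan (hR := hR) (hP := hP) (start := start) he (cell := cell) hc.1
      (true :: l') k [] (by simp at hsp ⊢; omega)
    simp only [List.nil_append, List.length_nil, zero_add, update_const_self] at h₁
    rw [← hl, Function.update_eq_self] at h₁
    refine ⟨Function.update cell r (workTape (List.replicate k true ++ false :: l')),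
      represents_set hc r ⟨_, rfl, ?_, by simpa using hb⟩, h₁.trans ?_⟩
    · rw [binVal_replicate_false] at hv; omega
    -- After the lowest 1 has been cleared, the head walks back to the marker and turns the j zeros
    -- on its way into ones. `A` collects the digits already behind it.
    have borrow : ∀ j A, j < E.space → SpaceReaches (counterMachine hR hP start δ)
        E.oracle E.input E.space
        (counterConfig (e (Sum.inl (some true))) σ (Function.update (fun _ => 1) r j)
          (Function.update cell r (workTape (List.replicate j false ++ A))))
        (counterConfig (e (Sum.inr true)) σ (fun _ => 1)
          (Function.update cell r (workTape (List.replicate j true ++ A)))) := by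
      intro j
      induction j with
      | zero =>
        intro A hj
        refine Relation.ReflTransGen.single ⟨?_, head_update_lt (one_lt_space E) hj r⟩
        rw [step_onTape hc.1 (st' := e (Sum.inr true)) (a := WorkSym.mark) (mv := .right)]
        · simp only [LLMachine.moveHead, zero_add, update_const_self]
          congr 3
          exact Function.update_eq_self 0 (workTape _)
        · intro i g hg
          replace hg : g r = WorkSym.mark := hg
          simp only [he, decStep, hg]
          rfl
      | succ j ih =>
        intro A hj
        have := ih (true :: A) (by omega)
        rw [List.replicate_succ', List.replicate_succ', List.append_assoc, List.append_assoc]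
        refine Relation.ReflTransGen.head ⟨?_, head_update_lt (one_lt_space E) hj r⟩ this
        have hw := workTape_append_cons (List.replicate j false) A false
        have hu := update_workTape (List.replicate j false) A false true
        rw [List.length_replicate] at hw hu
        rw [step_onTape hc.1 (st' := e (Sum.inl (some true))) (a := WorkSym.bit true)
          (mv := .left)]
        · rw [List.singleton_append, hu]
          simp [LLMachine.moveHead]
        · intro i g hg
          rw [List.singleton_append, hw] at hg
          simp only [he, decStep, hg]
          rfl
    simp only [List.length_append, List.length_replicate, List.length_cons] at hsp
    refine Relation.ReflTransGen.head ⟨?_, head_update_lt (one_lt_space E) (by omega) r⟩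
      (borrow k (false :: l') (by omega))
    have hw := workTape_append_cons (List.replicate k false) l' true
    have hu := update_workTape (List.replicate k false) l' true false
    rw [List.length_replicate] at hw hu
    have := step_onTape (hR := hR) (hP := hP) (start := start) (f := E.oracle) hc.1 (cell := cell)
      (X := cell r) (r := r) (p := k + 1) (st := e (Sum.inl none))
      (st' := e (Sum.inl (some true))) (a := WorkSym.bit false) (mv := .left) (δ := δ) (by
        intro i g hg
        rw [hl, hw] at hg
        simp only [he, decStep, hg]
        rfl)
    rw [Function.update_eq_self] at this
    rw [this, hl, hu]
    rfl

end Block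

/-! ### Algebra of counter states -/

namespace CounterState

section

variable {R : Type} [DecidableEq R]

theorem reg_set (σ : CounterState R) (a b : R) (n : ℕ) :
    (σ.set a n).reg b = if b = a then n else σ.reg b := by
  simp [set, Function.update_apply]

@[simp] theorem reg_set_self (σ : CounterState R) (a : R) (n : ℕ) : (σ.set a n).reg a = n := by
  simp [set]

@[simp] theorem set_set (σ : CounterState R) (a : R) (n k : ℕ) :
    (σ.set a n).set a k = σ.set a k := by
  simp [set]

theorem set_reg (σ : CounterState R) (a : R) : σ.set a (σ.reg a) = σ := by
  simp [set]

theorem set_eq_self {σ : CounterState R} {a : R} {n : ℕ} (h : σ.reg a = n) : σ.set a n = σ := by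
  rw [← h, set_reg]

theorem set_comm (σ : CounterState R) {a b : R} (h : a ≠ b) (n k : ℕ) :
    (σ.set a n).set b k = (σ.set b k).set a n := by
  simp only [set]
  rw [Function.update_comm h]

@[simp] theorem inputHead_set (σ : CounterState R) (a : R) (n : ℕ) :
    (σ.set a n).inputHead = σ.inputHead := rfl

@[simp] theorem orc_set (σ : CounterState R) (a : R) (n : ℕ) : (σ.set a n).orc = σ.orc := rfl

@[simp] theorem out_set (σ : CounterState R) (a : R) (n : ℕ) : (σ.set a n).out = σ.out := rfl

end

variable {R : Type}

/-- The state after writing `l` to the oracle tape. -/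
def query (σ : CounterState R) (l : List TapeSym) : CounterState R :=
  { σ with orc := σ.orc ++ l }

/-- The state after writing the bits `l`, to the output tape or to the oracle tape. -/
def put (σ : CounterState R) : Bool → List Bool → CounterState R
  | true, l => { σ with out := σ.out ++ l }
  | false, l => { σ with orc := σ.orc ++ l.map TapeSym.bit }

/-- The state after the input head has moved to `p`. -/
def seek (σ : CounterState R) (p : ℕ) : CounterState R :=
  { σ with inputHead := p }

@[simp] theorem reg_query (σ : CounterState R) (l) : (σ.query l).reg = σ.reg := rfl
@[simp] theorem inputHead_query (σ : CounterState R) (l) :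
    (σ.query l).inputHead = σ.inputHead := rfl
@[simp] theorem orc_query (σ : CounterState R) (l) : (σ.query l).orc = σ.orc ++ l := rfl
@[simp] theorem reg_seek (σ : CounterState R) (p) : (σ.seek p).reg = σ.reg := rfl
@[simp] theorem inputHead_seek (σ : CounterState R) (p) : (σ.seek p).inputHead = p := rfl
@[simp] theorem reg_put (σ : CounterState R) (ch l) : (σ.put ch l).reg = σ.reg := by
  cases ch <;> rfl
@[simp] theorem inputHead_put (σ : CounterState R) (ch l) :
    (σ.put ch l).inputHead = σ.inputHead := by
  cases ch <;> rfl

theorem put_put (σ : CounterState R) (ch : Bool) (l l' : List Bool) :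
    (σ.put ch l).put ch l' = σ.put ch (l ++ l') := by
  cases ch <;> simp [put]

theorem put_nil (σ : CounterState R) (ch : Bool) : σ.put ch [] = σ := by
  cases ch <;> simp [put]

theorem query_query (σ : CounterState R) (l l' : List TapeSym) :
    (σ.query l).query l' = σ.query (l ++ l') := by
  simp [query]

theorem put_false (σ : CounterState R) (l : List Bool) :
    σ.put false l = σ.query (l.map TapeSym.bit) := rfl

theorem seek_seek (σ : CounterState R) (p q : ℕ) : (σ.seek p).seek q = σ.seek q := rfl

theorem set_put [DecidableEq R] (σ : CounterState R) (ch : Bool) (l : List Bool) (a : R) (n : ℕ) :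
    (σ.put ch l).set a n = (σ.set a n).put ch l := by
  cases ch <;> rfl

theorem set_query [DecidableEq R] (σ : CounterState R) (l : List TapeSym) (a : R) (n : ℕ) :
    (σ.query l).set a n = (σ.set a n).query l := rfl

theorem set_seek [DecidableEq R] (σ : CounterState R) (p : ℕ) (a : R) (n : ℕ) :
    (σ.seek p).set a n = (σ.set a n).seek p := rfl

end CounterState

/-! ### Control structures and arithmetic on counters -/

namespace Block

variable {R O O₂ : Type} {E : RunEnv} {σ σ₁ σ₂ τ : CounterState R}

theorem Runs.congr {B : Block R O} {o : O} (h : B.Runs E σ o σ₁) (e : σ₁ = σ₂) :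
    B.Runs E σ o σ₂ := e ▸ h

theorem Runs.congr_left {B : Block R O} {o : O} (h : B.Runs E σ o σ₁) (e : τ = σ) :
    B.Runs E τ o σ₁ := e ▸ h

/-- The position bound is part of `Represents`, so it may be assumed when a run is established. -/
theorem runs_of_inputHead_le {B : Block R O} {o : O}
    (h : σ.inputHead ≤ E.input.length + 1 → B.Runs E σ o σ₁) : B.Runs E σ o σ₁ :=
  fun hR P hP start δ e he cell hc => h hc.1 hR P hP start δ e he cell hc

/-- Leave through the exit that the scanned input symbol selects. -/
def look (o : InputSym → O) : Block R O := external o .stay none none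

/-- Leave through the exit `o`. -/
def ret (o : O) : Block R O := look fun _ => o

/-- Move the input head. -/
def moveInput (mv : HeadMove) : Block R Unit := external (fun _ => ()) mv none none

/-- Write a bit to the output tape or to the oracle tape. -/
def putBit (ch b : Bool) : Block R Unit :=
  external (fun _ => ()) .stay (if ch then some b else none)
    (if ch then none else some (TapeSym.bit b))

/-- Write a separator to the oracle tape. -/
def putSep : Block R Unit := external (fun _ => ()) .stay none (some TapeSym.sep)

theorem runs_look {o : InputSym → O} :
    (look o).Runs E σ (o (LLMachine.scan E.input σ.inputHead)) σ := by
  refine runs_of_inputHead_le fun h => runs_external.congr ?_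
  cases σ
  simp_all [LLMachine.moveHead]

theorem runs_ret {o : O} : (ret o).Runs E σ o σ := runs_look

theorem runs_moveLeft {p : ℕ} (h : σ.inputHead = p + 1) :
    (moveInput .left).Runs E σ () (σ.seek p) := by
  refine runs_of_inputHead_le fun h' => runs_external.congr ?_
  cases σ
  simp_all [LLMachine.moveHead, CounterState.seek]
  omega

theorem runs_moveRight (h : σ.inputHead ≤ E.input.length) :
    (moveInput .right).Runs E σ () (σ.seek (σ.inputHead + 1)) := by
  refine runs_external.congr ?_
  cases σ
  simp_all [LLMachine.moveHead, CounterState.seek]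

theorem runs_putBit {ch b : Bool} : (putBit ch b).Runs E σ () (σ.put ch [b]) := by
  refine runs_of_inputHead_le fun h => runs_external.congr ?_
  cases σ
  cases ch <;> simp_all [LLMachine.moveHead, CounterState.put]

theorem runs_putSep : putSep.Runs E σ () (σ.query [TapeSym.sep]) := by
  refine runs_of_inputHead_le fun h => runs_external.congr ?_
  cases σ
  simp_all [LLMachine.moveHead, CounterState.query]

/-- Run two fragments one after the other. -/
def seq (A : Block R Unit) (B : Block R O) : Block R O := bind inferInstance A fun _ => B

theorem runs_seq {A : Block R Unit} {B : Block R O} {o : O} (hA : A.Runs E σ () σ₁)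
    (hB : B.Runs E σ₁ o σ₂) : (seq A B).Runs E σ o σ₂ :=
  runs_bind hA hB

/-- Branch on a predicate of the scanned input symbol. -/
def ifLook (p : InputSym → Bool) (A B : Block R O) : Block R O :=
  bind inferInstance (look p) fun b => cond b A B

theorem runs_ifLook_true {p : InputSym → Bool} {A B : Block R O} {o : O}
    (h : p (LLMachine.scan E.input σ.inputHead) = true) (hA : A.Runs E σ o σ₁) :
    (ifLook p A B).Runs E σ o σ₁ := by
  have hlook := runs_look (E := E) (σ := σ) (o := p)
  rw [h] at hlook
  exact runs_bind hlook hA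

theorem runs_ifLook_false {p : InputSym → Bool} {A B : Block R O} {o : O}
    (h : p (LLMachine.scan E.input σ.inputHead) = false) (hB : B.Runs E σ o σ₁) :
    (ifLook p A B).Runs E σ o σ₁ := by
  have hlook := runs_look (E := E) (σ := σ) (o := p)
  rw [h] at hlook
  exact runs_bind hlook hB

/-- Repeat `A` as long as the scanned input symbol satisfies `p`. -/
def whileLook (p : InputSym → Bool) (A : Block R Unit) : Block R Unit :=
  loop (ifLook p (seq A (ret true)) (ret false))

theorem runs_whileLook_true {p : InputSym → Bool} {A : Block R Unit}
    (h : p (LLMachine.scan E.input σ.inputHead) = true) (hA : A.Runs E σ () σ₁)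
    (hB : (whileLook p A).Runs E σ₁ () σ₂) : (whileLook p A).Runs E σ () σ₂ :=
  runs_loop_true (runs_ifLook_true h (runs_seq hA runs_ret)) hB

theorem runs_whileLook_false {p : InputSym → Bool} {A : Block R Unit}
    (h : p (LLMachine.scan E.input σ.inputHead) = false) : (whileLook p A).Runs E σ () σ :=
  runs_loop_false (runs_ifLook_false h runs_ret)

variable [DecidableEq R]

/-- If the counter `r` is positive, decrement it and run `A`, otherwise run `B`. -/
def ifDec (r : R) (A B : Block R O) : Block R O :=
  bind inferInstance (dec r) fun b => cond b A B

theorem runs_ifDec_succ {r : R} {n : ℕ} {A B : Block R O} {o : O} (h : σ.reg r = n + 1)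
    (hA : A.Runs E (σ.set r n) o σ₁) : (ifDec r A B).Runs E σ o σ₁ :=
  runs_bind (runs_dec_succ h) hA

theorem runs_ifDec_zero {r : R} {A B : Block R O} {o : O} (h : σ.reg r = 0)
    (hB : B.Runs E σ o σ₁) : (ifDec r A B).Runs E σ o σ₁ :=
  runs_bind (runs_dec_zero h) hB

/-- As long as the counter `r` is positive, decrement it and run `A`. -/
def whileDec (r : R) (A : Block R Unit) : Block R Unit :=
  loop (ifDec r (seq A (ret true)) (ret false))

theorem runs_whileDec_succ {r : R} {n : ℕ} {A : Block R Unit} (h : σ.reg r = n + 1)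
    (hA : A.Runs E (σ.set r n) () σ₁) (hB : (whileDec r A).Runs E σ₁ () σ₂) :
    (whileDec r A).Runs E σ () σ₂ :=
  runs_loop_true (runs_ifDec_succ h (runs_seq hA runs_ret)) hB

theorem runs_whileDec_zero {r : R} {A : Block R Unit} (h : σ.reg r = 0) :
    (whileDec r A).Runs E σ () σ :=
  runs_loop_false (runs_ifDec_zero h runs_ret)

/-- `h j` is the state after j rounds apart from the loop counter, whose value in `h j` is
irrelevant. The counter is decremented before the body, so round j sees n − 1 − j. -/
theorem runs_whileDec {r : R} {A : Block R Unit} (n : ℕ) (h : ℕ → CounterState R)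
    (hA : ∀ j < n, A.Runs E ((h j).set r (n - 1 - j)) () ((h (j + 1)).set r (n - 1 - j))) :
    (whileDec r A).Runs E ((h 0).set r n) () ((h n).set r 0) := by
  induction n generalizing h with
  | zero => exact runs_whileDec_zero (by simp)
  | succ n ih =>
    refine runs_whileDec_succ (n := n) (by simp) ?_ (ih (fun j => h (j + 1)) ?_)
    · have := hA 0 (by omega)
      simpa using this
    · intro j hj
      have := hA (j + 1) (by omega)
      simpa [show n - (j + 1) = n - 1 - j by omega] using this

/-- Set the counter `a` to `0`. -/
def clear (a : R) : Block R Unit := whileDec a (ret ())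

theorem runs_clear {a : R} : (clear a).Runs E σ () (σ.set a 0) :=
  (runs_whileDec (σ.reg a) (fun _ => σ) fun _ _ => runs_ret).congr_left (σ.set_reg a).symm

/-- Add the counter `a` to `b` and set `a` to `0`. -/
def moveTo (a b : R) : Block R Unit := whileDec a (inc b)

theorem runs_moveTo {a b : R} (hab : a ≠ b) (h : σ.reg a + σ.reg b ≤ E.bound) :
    (moveTo a b).Runs E σ () ((σ.set b (σ.reg b + σ.reg a)).set a 0) := by
  refine (runs_whileDec (σ.reg a) (fun j => σ.set b (σ.reg b + j)) fun j hj => ?_).congr_left ?_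
  · refine (runs_inc ?_).congr ?_
    · simp [CounterState.reg_set, hab.symm]; omega
    · simp [CounterState.reg_set, hab.symm]
      rw [CounterState.set_comm _ hab]
      simp; rfl
  · simp [CounterState.set_reg]

/-- Add the counter `a` to `b`, with `t` as an auxiliary counter. -/
def addTo (t a b : R) : Block R Unit :=
  seq (whileDec a (seq (inc b) (inc t))) (moveTo t a)

/-- Reading a counter destroys it, so `a` is emptied into both `b` and `t` and then restored from
`t`. -/
theorem runs_addTo {t a b : R} (hab : a ≠ b) (hat : a ≠ t) (hbt : b ≠ t) (ht : σ.reg t = 0)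
    (h : σ.reg a + σ.reg b ≤ E.bound) :
    (addTo t a b).Runs E σ () (σ.set b (σ.reg b + σ.reg a)) := by
  refine runs_seq ((runs_whileDec (σ.reg a)
    (fun j => (σ.set b (σ.reg b + j)).set t j) fun j hj => ?_).congr_left (τ := σ) ?_) ?_
  · refine (runs_seq (runs_inc ?_) (runs_inc ?_)).congr ?_
    · simp [CounterState.reg_set, hab.symm, hbt]; omega
    · simp [CounterState.reg_set, hat.symm, hbt.symm]; omega
    · ext r
      · simp only [CounterState.reg_set]
        split_ifs <;> simp_all <;> omega
      all_goals rfl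
  · ext r
    · simp only [CounterState.reg_set]
      split_ifs <;> simp_all
    all_goals rfl
  · refine (runs_moveTo hat.symm ?_).congr ?_
    · simp [CounterState.reg_set, hat.symm]; omega
    · ext r
      · simp only [CounterState.reg_set]
        split_ifs <;> simp_all
      all_goals rfl

/-- Double the counter `a`, with `t` as an auxiliary counter. -/
def double (t a : R) : Block R Unit :=
  seq (whileDec a (seq (inc t) (inc t))) (moveTo t a)

theorem runs_double {t a : R} (hat : a ≠ t) (ht : σ.reg t = 0) (h : 2 * σ.reg a ≤ E.bound) :
    (double t a).Runs E σ () (σ.set a (2 * σ.reg a)) := by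
  refine runs_seq ((runs_whileDec (σ.reg a)
    (fun j => σ.set t (2 * j)) fun j hj => ?_).congr_left (τ := σ) ?_) ?_
  · refine (runs_seq (runs_inc ?_) (runs_inc ?_)).congr ?_
    · simp [CounterState.reg_set, hat.symm]; omega
    · simp [CounterState.reg_set, hat.symm]; omega
    · ext r
      · simp only [CounterState.reg_set]
        split_ifs <;> simp_all <;> omega
      all_goals rfl
  · ext r
    · simp only [CounterState.reg_set]
      split_ifs <;> simp_all
    all_goals rfl
  · refine (runs_moveTo hat.symm ?_).congr ?_
    · simp [CounterState.reg_set, hat.symm]; omega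
    · ext r
      · simp only [CounterState.reg_set]
        split_ifs <;> simp_all
      all_goals rfl

/-- Add the product of `a` and `b` to `c`, with `t` and `t'` as auxiliary counters. -/
def mulAddTo (t t' a b c : R) : Block R Unit :=
  seq (addTo t a t') (whileDec t' (addTo t b c))

theorem runs_mulAddTo {t t' a b c : R} (htt : t ≠ t') (hat : a ≠ t) (hat' : a ≠ t') (hbt : b ≠ t)
    (hbt' : b ≠ t') (hct : c ≠ t) (hct' : c ≠ t') (hbc : b ≠ c) (ht : σ.reg t = 0)
    (ht' : σ.reg t' = 0) (ha : σ.reg a ≤ E.bound)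
    (h : σ.reg c + σ.reg a * σ.reg b ≤ E.bound) :
    (mulAddTo t t' a b c).Runs E σ () (σ.set c (σ.reg c + σ.reg a * σ.reg b)) := by
  refine runs_seq (runs_addTo hat' hat htt.symm ht (by omega)) (((runs_whileDec (σ.reg a)
    (fun j => σ.set c (σ.reg c + j * σ.reg b)) fun j hj => ?_).congr_left ?_).congr ?_)
  · refine (runs_addTo hbc hbt hct ?_ ?_).congr ?_
    · simp [CounterState.reg_set, htt, hct.symm, ht]
    · have : (j + 1) * σ.reg b ≤ σ.reg a * σ.reg b := Nat.mul_le_mul_right _ hj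
      simp [CounterState.reg_set, hct', hbt', hbc]
      linarith
    · ext r
      · simp only [CounterState.reg_set]
        split_ifs <;> simp_all <;> ring
      all_goals rfl
  · ext r
    · simp only [CounterState.reg_set]
      split_ifs <;> simp_all
    all_goals rfl
  · ext r
    · simp only [CounterState.reg_set]
      split_ifs <;> simp_all
    all_goals rfl

/-- Subtract the counter `b` from `a`, with `t` and `t'` as auxiliary counters. -/
def subFrom (t t' b a : R) : Block R Unit :=
  seq (addTo t b t') (whileDec t' (ifDec a (ret ()) (ret ())))

/-- A failed decrement leaves the counter at 0, so the result is the truncated difference. -/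
theorem runs_subFrom {t t' a b : R} (htt : t ≠ t') (hbt : b ≠ t)
    (hbt' : b ≠ t') (hat' : a ≠ t') (ht : σ.reg t = 0)
    (ht' : σ.reg t' = 0) (hb : σ.reg b ≤ E.bound) :
    (subFrom t t' b a).Runs E σ () (σ.set a (σ.reg a - σ.reg b)) := by
  refine runs_seq (runs_addTo hbt' hbt htt.symm ht (by omega)) (((runs_whileDec (σ.reg b)
    (fun j => σ.set a (σ.reg a - j)) fun j hj => ?_).congr_left ?_).congr ?_)
  · rcases h : σ.reg a - j with _ | k
    · refine (runs_ifDec_zero ?_ runs_ret).congr ?_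
      · simp [CounterState.reg_set, hat']
      · rw [show σ.reg a - (j + 1) = 0 by omega]
    · refine (runs_ifDec_succ (n := k) ?_ runs_ret).congr ?_
      · simp [CounterState.reg_set, hat']
      · rw [show σ.reg a - (j + 1) = k by omega, CounterState.set_comm _ hat'.symm]
        simp
  · ext r
    · simp only [CounterState.reg_set]
      split_ifs <;> simp_all
    all_goals rfl
  · ext r
    · simp only [CounterState.reg_set]
      split_ifs <;> simp_all
    all_goals rfl

/-- Halve the counter `a` and write its last bit, with `t` and `t'` as auxiliary counters. -/
def putDigit (ch : Bool) (t t' a : R) : Block R Unit :=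
  seq (whileDec a (ifDec a (inc t) (inc t')))
    (seq (moveTo t a) (ifDec t' (putBit ch true) (putBit ch false)))

/-- Units are removed from `a` two at a time: complete pairs are counted in `t`, giving the
quotient, and a single leftover unit goes to `t'`, giving the bit. -/
theorem runs_putDigit {ch : Bool} {t t' a : R} (htt : t ≠ t') (hat : a ≠ t) (hat' : a ≠ t')
    (ht : σ.reg t = 0) (ht' : σ.reg t' = 0) (ha : σ.reg a ≤ E.bound) :
    (putDigit ch t t' a).Runs E σ ()
      ((σ.set a (σ.reg a / 2)).put ch [decide (σ.reg a % 2 = 1)]) := by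
  have key : ∀ n k (σ : CounterState R), σ.reg a = n → σ.reg t = k → σ.reg t' = 0 →
      k + n ≤ E.bound → (whileDec a (ifDec a (inc t) (inc t'))).Runs E σ ()
        (((σ.set a 0).set t (k + n / 2)).set t' (n % 2)) := by
    intro n
    induction n using Nat.strong_induction_on with
    | _ n ih =>
      intro k σ h1 h2 h3 h4
      rcases n with _ | _ | n
      · refine (runs_whileDec_zero h1).congr ?_
        ext r
        · simp only [CounterState.reg_set]
          split_ifs <;> simp_all
        all_goals rfl
      · refine (runs_whileDec_succ (n := 0) h1 (runs_ifDec_zero (by simp) (runs_inc ?_))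
          (runs_whileDec_zero ?_)).congr ?_
        · simp [CounterState.reg_set, hat'.symm]; omega
        · simp [CounterState.reg_set, hat']
        · ext r
          · simp only [CounterState.reg_set]
            split_ifs <;> simp_all
          all_goals rfl
      · refine (runs_whileDec_succ (n := n + 1) h1
          (runs_ifDec_succ (n := n) (by simp) (runs_inc ?_)) (ih n (by omega) (k + 1) _ ?_ ?_ ?_ ?_)).congr ?_
        · simp [CounterState.reg_set, hat.symm]; omega
        · simp [CounterState.reg_set, hat]
        · simp [CounterState.reg_set, hat.symm, h2]
        · simp [CounterState.reg_set, hat'.symm, htt.symm, h3]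
        · omega
        · ext r
          · simp only [CounterState.reg_set]
            split_ifs <;> simp_all <;> omega
          all_goals rfl
  refine runs_seq (key _ 0 σ rfl ht ht' (by omega)) (runs_seq (runs_moveTo hat.symm ?_) ?_)
  · simp [CounterState.reg_set, htt, hat, hat']; omega
  · rcases Nat.mod_two_eq_zero_or_one (σ.reg a) with h | h
    · refine (runs_ifDec_zero ?_ runs_putBit).congr ?_
      · simp [CounterState.reg_set, htt.symm, hat'.symm, h]
      · simp only [h, decide_eq_false (show ¬ (0 = 1) by omega)]
        congr 1
        ext r
        · simp only [CounterState.reg_set]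
          split_ifs <;> simp_all
        all_goals rfl
    · refine (runs_ifDec_succ (n := 0) ?_ runs_putBit).congr ?_
      · simp [CounterState.reg_set, htt.symm, hat'.symm, h]
      · simp only [h, decide_true]
        congr 1
        ext r
        · simp only [CounterState.reg_set]
          split_ifs <;> simp_all
        all_goals rfl

end Block

/-! ### From a program to a complete machine -/

/-- The machine with the program `B`: it first marks the left ends of its work tapes. -/
def Block.machine {R : Type} (hR : Finite R) (B : Block R Unit) : LLMachine :=
  counterMachine hR (P := Option (B.P ⊕ Unit)) (by have := B.finite; infer_instance) none
    fun p i g => match p with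
      | none => LLAction.act (some (Sum.inl B.entry)) (fun _ => WorkSym.mark)
        (fun _ => HeadMove.right) HeadMove.stay none none
      | some (Sum.inl p) => (B.δ p i g).mapState some
      | some (Sum.inr _) => LLAction.halt

theorem SpaceReaches.reaches {M : LLMachine} {f inp S} {a b : M.Config}
    (h : SpaceReaches M f inp S a b) : StateTransition.Reaches (M.step f inp) a b :=
  Relation.ReflTransGen.mono (fun _ _ h => by simpa using h.1) _ _ h

/-- The machine is deterministic, so every reachable configuration lies on the given halting run.
`SpaceReaches` bounds only the sources of its steps, hence the separate assumption on the last
configuration. -/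
theorem SpaceReaches.head_lt {M : LLMachine} {f inp S} {a b c : M.Config}
    (h : SpaceReaches M f inp S a b) (hb : M.step f inp b = none) (hbS : ∀ t, b.head t < S)
    (hc : StateTransition.Reaches (M.step f inp) a c) : ∀ t, c.head t < S := by
  induction h using Relation.ReflTransGen.head_induction_on with
  | refl =>
    rcases Relation.ReflTransGen.cases_head hc with rfl | ⟨d, hd, _⟩
    · exact hbS
    · simp [hb] at hd
  | head h₁ _ ih =>
    rcases Relation.ReflTransGen.cases_head hc with rfl | ⟨d, hd, hd'⟩
    · exact h₁.2
    · rw [h₁.1, Option.mem_some_iff] at hd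
      subst hd
      exact ih hd'

/-- After the single initial step that writes the markers, every tape represents 0 by the empty
digit string. This is admissible as soon as the bound is at least 1. -/
theorem Block.machine_correct {R : Type} {hR : Finite R} {B : Block R Unit} {E : RunEnv}
    {σ : CounterState R} (hE : 1 ≤ E.bound) (h : B.Runs E ⟨fun _ => 0, 0, [], []⟩ () σ) :
    (B.machine hR).Computes E.oracle E.input σ.out ∧
      (B.machine hR).UsesSpaceAtMost E.oracle E.input E.space := by
  obtain ⟨cell, hc, hr⟩ := h hR (Option (B.P ⊕ Unit)) (by have := B.finite; infer_instance) none
    (fun p i g => match p with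
      | none => LLAction.act (some (Sum.inl B.entry)) (fun _ => WorkSym.mark)
        (fun _ => HeadMove.right) HeadMove.stay none none
      | some (Sum.inl p) => (B.δ p i g).mapState some
      | some (Sum.inr _) => LLAction.halt) some (fun p i g => rfl) (fun _ => workTape [])
      ⟨Nat.zero_le _, fun r => ⟨[], rfl, rfl, by simpa using by omega⟩⟩
  have h0 : SpaceReaches (B.machine hR) E.oracle E.input E.space (B.machine hR).init
      (counterConfig (some (Sum.inr ())) σ (fun _ => 1) cell) := by
    refine Relation.ReflTransGen.head ⟨?_, fun _ => ?_⟩ hr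
    · refine (step_counterConfig_act (st := none) (σ := ⟨fun _ => 0, 0, [], []⟩)
        (head := fun _ => 0) (cell := fun _ _ => WorkSym.blank) rfl).trans ?_
      congr 2
      funext t p
      rcases p with _ | p
      · rfl
      · simp [workTape]
    · simp [RunEnv.space, LLMachine.init]
  have hhalt : (B.machine hR).step E.oracle E.input
      (counterConfig (some (Sum.inr ())) σ (fun _ => 1) cell) = none := rfl
  exact ⟨⟨_, h0.reaches, hhalt, rfl⟩, fun c hc => h0.head_lt hhalt (fun _ => one_lt_space E) hc⟩

/-! ### The counters of the generator -/

/-- The counters of the generator. -/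
inductive Reg : Type
  | w | d | m | s | D | S | u | V | l | z | cz | cy | cnt | best | bz | st | sd | fl
  | A | cA | B | cB | K | cK | I | P₂ | R₂ | R | P | J | t₁ | t₂ | t₃ | t₄
  deriving DecidableEq

theorem finite_reg : Finite Reg :=
  Finite.of_surjective (fun i : Fin 34 => Reg.ofNat i) fun r =>
    ⟨⟨r.ctorIdx, by cases r <;> decide⟩, by cases r <;> rfl⟩

/-- The state between two basic operations: the auxiliary counters are `0`. -/
structure Ready (σ : CounterState Reg) : Prop where
  inputHead : σ.inputHead = 0
  P : σ.reg .P = 0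
  J : σ.reg .J = 0
  t₁ : σ.reg .t₁ = 0
  t₂ : σ.reg .t₂ = 0
  t₃ : σ.reg .t₃ = 0
  t₄ : σ.reg .t₄ = 0

theorem Ready.set {σ : CounterState Reg} (h : Ready σ) {r : Reg} {n : ℕ}
    (hr : r ≠ .P ∧ r ≠ .J ∧ r ≠ .t₁ ∧ r ≠ .t₂ ∧ r ≠ .t₃ ∧ r ≠ .t₄) : Ready (σ.set r n) := by
  obtain ⟨h1, h2, h3, h4, h5, h6⟩ := hr
  constructor <;>
    simp [CounterState.reg_set, h1.symm, h2.symm, h3.symm, h4.symm, h5.symm, h6.symm,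
      h.inputHead, h.P, h.J, h.t₁, h.t₂, h.t₃, h.t₄]

theorem Ready.put {σ : CounterState Reg} (h : Ready σ) {ch : Bool} {l : List Bool} :
    Ready (σ.put ch l) := by
  constructor <;> simp [h.inputHead, h.P, h.J, h.t₁, h.t₂, h.t₃, h.t₄]

theorem Ready.query {σ : CounterState Reg} (h : Ready σ) {l : List TapeSym} :
    Ready (σ.query l) := by
  constructor <;> simp [h.inputHead, h.P, h.J, h.t₁, h.t₂, h.t₃, h.t₄]

/-! ### Writing and reading numbers -/

namespace Block

variable {E : RunEnv} {σ : CounterState Reg}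

/-- Write the `n` lowest bits of the counter `a`. -/
def putFixed (ch : Bool) (a n : Reg) : Block Reg Unit :=
  seq (addTo .t₁ a .t₃) (seq (addTo .t₁ n .t₄)
    (seq (whileDec .t₄ (putDigit ch .t₁ .t₂ .t₃)) (clear .t₃)))

/-- The digits are split off a copy in `t₃`, with a copy of the length in `t₄`. After j rounds `t₃`
holds the value divided by 2^j, whose last bit is digit j of the original. -/
theorem runs_putFixed {ch : Bool} {a n : Reg} (hσ : Ready σ)
    (ha : a ≠ .t₁ ∧ a ≠ .t₃) (hn : n ≠ .t₁ ∧ n ≠ .t₃ ∧ n ≠ .t₄)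
    (hab : σ.reg a ≤ E.bound) (hnb : σ.reg n ≤ E.bound) :
    (putFixed ch a n).Runs E σ () (σ.put ch ((List.range (σ.reg n)).map (σ.reg a).testBit)) := by
  obtain ⟨-, -, -, h₁, h₂, h₃, h₄⟩ := hσ
  obtain ⟨ha1, ha3⟩ := ha
  obtain ⟨hn1, hn3, hn4⟩ := hn
  refine runs_seq (runs_addTo ha3 ha1 (by decide) h₁ (by omega))
    (runs_seq (runs_addTo hn4 hn1 (by decide) ?_ ?_) (runs_seq (((runs_whileDec (σ.reg n)
      (fun j => (σ.set .t₃ (σ.reg a / 2 ^ j)).put ch ((List.range j).map (σ.reg a).testBit))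
      fun j hj => ?_).congr_left ?_)) (runs_clear.congr ?_)))
  · simp [CounterState.reg_set, h₁]
  · simp [CounterState.reg_set, h₄, hn3]; omega
  · refine (runs_putDigit (by decide) (by decide) (by decide) ?_ ?_ ?_).congr ?_
    · simp [CounterState.reg_set, h₁]
    · simp [CounterState.reg_set, h₂]
    · simp [CounterState.reg_set]
      exact (Nat.div_le_self _ _).trans hab
    · simp only [CounterState.set_put, CounterState.put_put, CounterState.reg_put,
        List.range_succ, List.map_append, List.map_singleton]
      congr 1
      · ext r
        · simp only [CounterState.reg_set, reduceCtorEq, if_false, if_true]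
          split_ifs <;> simp_all [Nat.div_div_eq_div_mul, pow_succ]
        all_goals rfl
      · simp [CounterState.reg_set, Nat.testBit_eq_decide_div_mod_eq]
  · simp only [CounterState.reg_set, hn3, if_false, h₃, h₄, reduceCtorEq, List.range_zero,
      List.map_nil, CounterState.put_nil, pow_zero, Nat.div_one, zero_add]
  · rw [CounterState.set_put, CounterState.set_put]
    congr 1
    ext r
    · simp only [CounterState.reg_set]
      split_ifs <;> simp_all
    all_goals rfl

/-- Write the counter `a` in binary to the oracle tape. -/
def putNat (a : Reg) : Block Reg Unit :=
  seq (addTo .t₁ a .t₃) (seq (whileDec .t₃ (seq (inc .t₃) (putDigit false .t₁ .t₂ .t₃))) putSep)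

theorem bits_eq_cons {n : ℕ} (hn : n ≠ 0) : n.bits = decide (n % 2 = 1) :: (n / 2).bits := by
  conv_lhs => rw [← Nat.bit_bodd_div2 n]
  rw [Nat.bits_append_bit, Nat.div2_val]
  · congr 1
    rw [Nat.mod_two_of_bodd]
    cases n.bodd <;> rfl
  · intro h
    rw [← Nat.bit_bodd_div2 n, h] at hn
    revert hn
    cases n.bodd <;> simp [Nat.bit]

theorem runs_putNat {a : Reg} (hσ : Ready σ) (ha : a ≠ .t₁ ∧ a ≠ .t₃)
    (hab : σ.reg a ≤ E.bound) :
    (putNat a).Runs E σ () (σ.query (encodeNat (σ.reg a))) := by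
  -- The decrement serves only as a test for zero and is undone at once by the increment. For the
  -- value 0 no digit is written, in agreement with `Nat.bits`.
  have key : ∀ n (σ : CounterState Reg), σ.reg .t₃ = n → σ.reg .t₁ = 0 → σ.reg .t₂ = 0 →
      n ≤ E.bound →
      (whileDec .t₃ (seq (inc .t₃) (putDigit false .t₁ .t₂ .t₃))).Runs E σ ()
        ((σ.set .t₃ 0).put false n.bits) := by
    intro n
    induction n using Nat.strong_induction_on with
    | _ n ih =>
      intro σ h3 h1 h2 hb
      rcases n with _ | n
      · refine (runs_whileDec_zero h3).congr ?_
        rw [Nat.zero_bits, CounterState.put_nil, CounterState.set_eq_self h3]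
      · refine (runs_whileDec_succ h3 (runs_seq (runs_inc ?_)
          (runs_putDigit (by decide) (by decide) (by decide) ?_ ?_ ?_))
          (ih ((n + 1) / 2) (by omega) _ ?_ ?_ ?_ (by omega))).congr ?_
        · simp; omega
        · simp [CounterState.reg_set, h1]
        · simp [CounterState.reg_set, h2]
        · simpa
        · simp
        · simp [CounterState.reg_set, h1]
        · simp [CounterState.reg_set, h2]
        · rw [bits_eq_cons (Nat.succ_ne_zero n)]
          simp [CounterState.set_put, CounterState.put_put]
  refine runs_seq (runs_addTo ha.2 ha.1 (by decide) hσ.t₁ (by simp [hσ.t₃, hab]))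
    (runs_seq (key (σ.reg a) _ ?_ ?_ ?_ hab) (runs_putSep.congr ?_))
  · simp [hσ.t₃]
  · simp [CounterState.reg_set, hσ.t₁]
  · simp [CounterState.reg_set, hσ.t₂]
  · simp only [CounterState.set_set, CounterState.set_eq_self hσ.t₃, CounterState.put_false,
      CounterState.query_query]
    rfl

/-- Does the input head scan a bit? -/
def isBit : InputSym → Bool
  | .sym (.bit _) => true
  | _ => false

/-- Does the input head scan the bit `1`? -/
def isOne : InputSym → Bool
  | .sym (.bit true) => true
  | _ => false

/-- Is the input head away from the left end? -/
def notLeftEnd : InputSym → Bool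
  | .leftEnd => false
  | _ => true

theorem scan_append (A : List TapeSym) (a : TapeSym) (B : List TapeSym) :
    LLMachine.scan (A ++ a :: B) (A.length + 1) = InputSym.sym a := by
  simp [LLMachine.scan]

theorem notLeftEnd_scan (inp : List TapeSym) (p : ℕ) :
    notLeftEnd (LLMachine.scan inp (p + 1)) = true := by
  simp only [LLMachine.scan]
  split <;> rfl

/-- `B` is empty or starts with a separator. -/
def EndsField (B : List TapeSym) : Prop := B = [] ∨ ∃ C, B = TapeSym.sep :: C

theorem isBit_scan_of_endsField (A : List TapeSym) {B : List TapeSym} (h : EndsField B) :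
    isBit (LLMachine.scan (A ++ B) (A.length + 1)) = false := by
  rcases h with rfl | ⟨C, rfl⟩
  · simp [LLMachine.scan, isBit]
  · rw [scan_append]; rfl

theorem runs_rewind : (whileLook notLeftEnd (moveInput .left)).Runs E σ () (σ.seek 0) := by
  obtain ⟨p, hp⟩ : ∃ p, σ.inputHead = p := ⟨_, rfl⟩
  induction p generalizing σ with
  | zero =>
    refine (runs_whileLook_false (by rw [hp]; rfl)).congr ?_
    cases σ; simp_all [CounterState.seek]
  | succ p ih =>
    exact runs_whileLook_true (by rw [hp]; exact notLeftEnd_scan _ _) (runs_moveLeft hp)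
      (ih rfl)

theorem runs_skipBits (l : List Bool) : ∀ {A B : List TapeSym} {σ : CounterState Reg},
    E.input = A ++ (l.map TapeSym.bit ++ B) → EndsField B → σ.inputHead = A.length + 1 →
    (whileLook isBit (moveInput .right)).Runs E σ () (σ.seek (A.length + l.length + 1)) := by
  induction l with
  | nil =>
    intro A B σ hE hB hσ
    refine (runs_whileLook_false ?_).congr ?_
    · rw [hE, hσ]; exact isBit_scan_of_endsField A hB
    · cases σ; simp_all [CounterState.seek]
  | cons b l ih =>
    intro A B σ hE hB hσ
    refine (runs_whileLook_true ?_ (runs_moveRight ?_) (ih (A := A ++ [TapeSym.bit b]) (B := B)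
      ?_ hB ?_)).congr ?_
    · rw [hE, hσ, List.map_cons, List.cons_append, scan_append]; rfl
    · rw [hE, hσ]; simp
    · simp [hE]
    · simp [hσ]
    · rw [CounterState.seek_seek]
      congr 1
      simp; omega

theorem runs_skipFields (L : List ℕ) : ∀ {A B : List TapeSym} {σ : CounterState Reg},
    E.input = A ++ (L.flatMap encodeNat ++ B) → σ.inputHead = A.length + 1 →
    σ.reg .J = L.length →
    (whileDec .J (seq (whileLook isBit (moveInput .right)) (moveInput .right))).Runs E σ ()
      ((σ.set .J 0).seek ((A ++ L.flatMap encodeNat).length + 1)) := by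
  induction L with
  | nil =>
    intro A B σ hE hσ hJ
    refine (runs_whileDec_zero hJ).congr ?_
    rw [CounterState.set_eq_self (by simpa using hJ)]
    cases σ; simp_all [CounterState.seek]
  | cons n L ih =>
    intro A B σ hE hσ hJ
    have hE' : E.input = A ++ (n.bits.map TapeSym.bit ++
        (TapeSym.sep :: (L.flatMap encodeNat ++ B))) := by
      rw [hE]; simp [encodeNat]
    refine (runs_whileDec_succ (n := L.length) hJ (runs_seq (runs_skipBits n.bits hE'
      (Or.inr ⟨_, rfl⟩) hσ) (runs_moveRight ?_))
      (ih (A := A ++ encodeNat n) (B := B) ?_ ?_ ?_)).congr ?_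
    · rw [hE']; simp
    · rw [hE]; simp
    · simp [encodeNat]; omega
    · simp
    · simp [CounterState.set_seek, CounterState.seek_seek]

/-- Digits come least significant first, so `P` carries the weight of the next digit and `R` the sum
so far. `P` is doubled even after the last digit, which is why 2^length must fit under the bound. -/
theorem runs_readBits (l : List Bool) : ∀ {A B : List TapeSym} {σ : CounterState Reg},
    E.input = A ++ (l.map TapeSym.bit ++ B) → EndsField B → σ.inputHead = A.length + 1 →
    σ.reg .t₁ = 0 → σ.reg .R + σ.reg .P * binVal l ≤ E.bound →
    σ.reg .P * 2 ^ l.length ≤ E.bound →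
    (whileLook isBit (seq (ifLook isOne (addTo .t₁ .P .R) (ret ()))
      (seq (double .t₁ .P) (moveInput .right)))).Runs E σ ()
      (((σ.set .R (σ.reg .R + σ.reg .P * binVal l)).set .P (σ.reg .P * 2 ^ l.length)).seek
        (A.length + l.length + 1)) := by
  induction l with
  | nil =>
    intro A B σ hE hB hσ _ _ _
    refine (runs_whileLook_false ?_).congr ?_
    · rw [hE, hσ]; exact isBit_scan_of_endsField A hB
    · simp only [binVal, mul_zero, add_zero, CounterState.set_reg, List.length_nil, pow_zero,
        mul_one]
      cases σ; simp_all [CounterState.seek]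
  | cons b l ih =>
    intro A B σ hE hB hσ ht hv hb
    rw [List.length_cons, pow_succ] at hb
    rw [binVal] at hv
    have h1 : 1 ≤ 2 ^ l.length := Nat.one_le_two_pow
    have h2 : σ.reg .P * 1 ≤ σ.reg .P * 2 ^ l.length := Nat.mul_le_mul_left _ h1
    have hs : LLMachine.scan E.input σ.inputHead = InputSym.sym (.bit b) := by
      rw [hE, hσ, List.map_cons, List.cons_append, scan_append]
    have h3 : (ifLook isOne (addTo .t₁ .P .R) (ret ())).Runs E σ ()
        (σ.set .R (σ.reg .R + σ.reg .P * b.toNat)) := by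
      cases b
      · refine (runs_ifLook_false (by rw [hs]; rfl) runs_ret).congr ?_
        simp [CounterState.set_reg]
      · refine (runs_ifLook_true (by rw [hs]; rfl) (runs_addTo (by decide) (by decide) (by decide)
          ht (by
            have := Nat.zero_le (σ.reg .P * binVal l)
            simp only [Bool.toNat_true] at hv
            linarith))).congr ?_
        simp
    refine (runs_whileLook_true (by rw [hs]; rfl) (runs_seq h3 (runs_seq
      (runs_double (by decide) ?_ ?_) (runs_moveRight ?_)))
      (ih (A := A ++ [TapeSym.bit b]) (B := B) ?_ hB ?_ ?_ ?_ ?_)).congr ?_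
    · simp [CounterState.reg_set, ht]
    · simp [CounterState.reg_set]; linarith
    · rw [hE]; simp [hσ]
    · simp [hE]
    · simp [hσ]
    · simp [CounterState.reg_set, ht]
    · simp [CounterState.reg_set]; linarith
    · simp [CounterState.reg_set]; linarith
    · ext r
      · simp only [CounterState.reg_seek, CounterState.reg_set, binVal, List.length_cons, pow_succ]
        split_ifs <;> simp_all <;> ring
      · simp; omega
      all_goals rfl

/-- Read field number `J` of the input into the counter `R`. -/
def getField : Block Reg Unit :=
  seq (moveInput .right)
    (seq (whileDec .J (seq (whileLook isBit (moveInput .right)) (moveInput .right)))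
    (seq (inc .P)
    (seq (whileLook isBit (seq (ifLook isOne (addTo .t₁ .P .R) (ret ()))
      (seq (double .t₁ .P) (moveInput .right))))
    (seq (clear .P) (whileLook notLeftEnd (moveInput .left))))))

/-- The field is an arbitrary bit string, not necessarily a canonical binary representation, so that
the same fragment also reads the seed. The seed ends at the right end marker instead of at a
separator. -/
theorem runs_getField {L : List ℕ} {l : List Bool} {B : List TapeSym}
    (hE : E.input = L.flatMap encodeNat ++ (l.map TapeSym.bit ++ B)) (hB : EndsField B)
    (h0 : σ.inputHead = 0) (hJ : σ.reg .J = L.length) (hR : σ.reg .R = 0) (hP : σ.reg .P = 0)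
    (ht : σ.reg .t₁ = 0) (hb : 2 ^ l.length ≤ E.bound) :
    getField.Runs E σ () ((σ.set .J 0).set .R (binVal l)) := by
  have h1 : 1 ≤ 2 ^ l.length := Nat.one_le_two_pow
  refine runs_seq (runs_moveRight (by omega)) (runs_seq (runs_skipFields L (A := [])
    (B := l.map TapeSym.bit ++ B) (by simpa using hE) (by simp [h0]) (by simpa using hJ))
    (runs_seq (runs_inc ?_) (runs_seq (runs_readBits l (A := L.flatMap encodeNat) hE hB ?_ ?_ ?_ ?_)
      (runs_seq runs_clear (runs_rewind.congr ?_)))))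
  · simp [CounterState.reg_set, hP]; omega
  · simp
  · simp [CounterState.reg_set, ht]
  · simpa [CounterState.reg_set, hP, hR] using (binVal_lt l).le.trans hb
  · simpa [CounterState.reg_set, hP]
  · ext r
    · simp only [CounterState.reg_seek, CounterState.reg_set]
      split_ifs <;> simp_all
    · simp [h0]
    all_goals rfl

end Block

/-! ### Parameters, table lookup and the table of the layered automaton -/

/-- The counters that may change while the parameters are loaded. -/
def Reg.free : Reg → Bool
  | .w | .d | .m | .s | .D | .S | .P | .J | .t₁ | .t₂ | .t₃ | .t₄ => false
  | _ => true

/-- The parameters are loaded, and the auxiliary counters are `0`. -/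
structure Loaded (w d m s : ℕ) (σ : CounterState Reg) : Prop extends Ready σ where
  D : σ.reg .D = 2 ^ d
  S : σ.reg .S = 2 ^ s
  w : σ.reg .w = w
  d : σ.reg .d = d
  m : σ.reg .m = m
  s : σ.reg .s = s

/-- What the input and the bound on the counters have to satisfy: the input consists of the
parameters, the transition table `tab`, the initial state `q` and the seed `xs`. -/
structure Setup (E : RunEnv) (w d m s : ℕ) (tab : ℕ → ℕ → ℕ) (q : ℕ) (xs : List Bool) :
    Prop where
  input : E.input = ([w, d, m, s] ++ (List.range (w * 2 ^ d)).map
    (fun i => tab (i / 2 ^ d) (i % 2 ^ d)) ++ [q]).flatMap encodeNat ++ xs.map TapeSym.bit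
  tab_lt : ∀ v k, v < w → k < 2 ^ d → tab v k < w
  q_lt : q < w
  m_pos : 0 < m
  length_xs : xs.length = s
  w_le : 2 * w ≤ E.bound
  d_le : 2 * d ≤ E.bound
  m_le : 2 * m ≤ E.bound
  s_le : 2 * s ≤ E.bound
  D_le : 2 * 2 ^ d ≤ E.bound
  S_le : 2 * 2 ^ s ≤ E.bound
  wD_le : w * 2 ^ d + 6 ≤ E.bound
  wm_le : 2 * (w * m) + 2 * w ≤ E.bound

theorem Loaded.set {w d m s : ℕ} {σ : CounterState Reg} (h : Loaded w d m s σ) {r : Reg} {n : ℕ}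
    (hr : r.free = true) : Loaded w d m s (σ.set r n) := by
  have key : ∀ t : Reg, t.free = false → (σ.set r n).reg t = σ.reg t := by
    intro t ht
    rw [CounterState.reg_set, if_neg]
    rintro rfl
    simp [ht] at hr
  exact ⟨⟨h.inputHead, (key _ rfl).trans h.P, (key _ rfl).trans h.J, (key _ rfl).trans h.t₁,
    (key _ rfl).trans h.t₂, (key _ rfl).trans h.t₃, (key _ rfl).trans h.t₄⟩,
    (key _ rfl).trans h.D, (key _ rfl).trans h.S, (key _ rfl).trans h.w, (key _ rfl).trans h.d,
    (key _ rfl).trans h.m, (key _ rfl).trans h.s⟩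

theorem Loaded.put {w d m s : ℕ} {σ : CounterState Reg} (h : Loaded w d m s σ) {ch : Bool}
    {l : List Bool} : Loaded w d m s (σ.put ch l) :=
  ⟨h.toReady.put, by simp [h.D], by simp [h.S], by simp [h.w], by simp [h.d], by simp [h.m],
    by simp [h.s]⟩

theorem Loaded.query {w d m s : ℕ} {σ : CounterState Reg} (h : Loaded w d m s σ)
    {l : List TapeSym} : Loaded w d m s (σ.query l) :=
  ⟨h.toReady.query, by simp [h.D], by simp [h.S], by simp [h.w], by simp [h.d], by simp [h.m],
    by simp [h.s]⟩

theorem Reg.ne_of_free {a b : Reg} (ha : a.free = true) (hb : b.free = false) : a ≠ b := by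
  rintro rfl
  simp [ha] at hb

/-- The entry of the transition table of the layered automaton: in layer `l`, there are `l` steps
left; in layer `0`, the state is frozen if `f = 0` and moves within the layer otherwise. -/
def layerEntry (w : ℕ) (tab : ℕ → ℕ → ℕ) (f l v k : ℕ) : ℕ :=
  (if l = 0 ∧ f = 0 then v else tab v k) + (l - 1) * w

/-- The encoding of the transition table of the layered automaton. -/
def layerTable (w d m : ℕ) (tab : ℕ → ℕ → ℕ) (f : ℕ) : List TapeSym :=
  (List.range m).flatMap fun l => (List.range w).flatMap fun v =>
    (List.range (2 ^ d)).flatMap fun k => encodeNat (layerEntry w tab f l v k)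

/-- A positive n has its top digit of weight at most n, and 2^length is twice that weight. This is
the source of the factors 2 in `Setup`. -/
theorem two_pow_length_bits {n N : ℕ} (h : 2 * n ≤ N) (hN : 1 ≤ N) :
    2 ^ n.bits.length ≤ N := by
  rcases Nat.eq_zero_or_pos n with rfl | hn
  · simpa
  · rw [Nat.size_eq_bits_len]
    have : 2 ^ (n.size - 1) ≤ n := by
      rw [← Nat.lt_size]
      have := Nat.size_pos.2 hn
      omega
    have h2 := Nat.size_pos.2 hn
    obtain ⟨k, hk⟩ := Nat.exists_eq_add_of_lt h2
    rw [hk] at this ⊢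
    simp [pow_succ] at this ⊢
    omega

namespace Block

variable {E : RunEnv} {σ : CounterState Reg} {w d m s q : ℕ} {tab : ℕ → ℕ → ℕ} {xs : List Bool}

theorem runs_getField_nat {L : List ℕ} {B : List TapeSym}
    (hE : E.input = L.flatMap encodeNat ++ B) (hσ : σ.inputHead = 0) {n v : ℕ}
    (hv : L[n]? = some v) (hJ : σ.reg .J = n) (hR : σ.reg .R = 0) (hP : σ.reg .P = 0)
    (ht : σ.reg .t₁ = 0) (hN : 1 ≤ E.bound) (hb : 2 * v ≤ E.bound) :
    getField.Runs E σ () ((σ.set .J 0).set .R v) := by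
  obtain ⟨hn, rfl⟩ := List.getElem?_eq_some_iff.1 hv
  have hL : L.flatMap encodeNat = (L.take n ++ L[n] :: L.drop (n + 1)).flatMap encodeNat := by
    rw [← List.drop_eq_getElem_cons hn, List.take_append_drop]
  have h := runs_getField (E := E) (σ := σ) (L := L.take n) (l := L[n].bits)
    (B := TapeSym.sep :: ((L.drop (n + 1)).flatMap encodeNat ++ B)) (by
      rw [hE, hL, List.flatMap_append, List.flatMap_cons, encodeNat]
      simp only [List.append_assoc, List.cons_append, List.nil_append])
      (Or.inr ⟨_, rfl⟩) hσ (by rw [hJ, List.length_take]; omega) hR hP ht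
      (two_pow_length_bits hb hN)
  rwa [binVal_bits] at h

/-- Look up the entry for the state `a` and the block `b` in the transition table. -/
def lookup (a b : Reg) : Block Reg Unit :=
  seq (inc .J) (seq (inc .J) (seq (inc .J) (seq (inc .J)
    (seq (mulAddTo .t₁ .t₂ a .D .J) (seq (addTo .t₁ b .J) getField)))))

/-- The table is listed row by row after the four parameters, so the entry for state a and block b
is field number 4 + a·2^d + b. It is reread from the input each time. -/
theorem runs_lookup (hE : Setup E w d m s tab q xs) (hσ : Loaded w d m s σ)
    (hR : σ.reg .R = 0) {a b : Reg} (ha : a.free = true) (hb : b.free = true)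
    (hav : σ.reg a < w) (hbv : σ.reg b < 2 ^ d) :
    (lookup a b).Runs E σ () (σ.set .R (tab (σ.reg a) (σ.reg b))) := by
  have hlt : σ.reg a * 2 ^ d + σ.reg b < w * 2 ^ d := by
    calc σ.reg a * 2 ^ d + σ.reg b < (σ.reg a + 1) * 2 ^ d := by linarith
      _ ≤ w * 2 ^ d := Nat.mul_le_mul_right _ hav
  have h1 := hE.wD_le
  have h2 := hE.w_le
  have hL : ([w, d, m, s] ++ (List.range (w * 2 ^ d)).map
    (fun i => tab (i / 2 ^ d) (i % 2 ^ d)) ++ [q])[4 + (σ.reg a * 2 ^ d + σ.reg b)]? =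
      some (tab (σ.reg a) (σ.reg b)) := by
    rw [List.append_assoc, List.getElem?_append_right (by simp),
      List.getElem?_append_left (by simpa using hlt)]
    simp only [List.length_cons, List.length_nil, zero_add, Nat.reduceAdd, add_tsub_cancel_left,
      List.getElem?_map, List.getElem?_range hlt, Option.map_some]
    rw [mul_comm, Nat.mul_add_div (by positivity), Nat.div_eq_of_lt hbv, Nat.mul_add_mod,
      Nat.mod_eq_of_lt hbv, add_zero]
  have haJ := Reg.ne_of_free ha (b := .J) rfl
  have hbJ := Reg.ne_of_free hb (b := .J) rfl
  have ht := hE.tab_lt _ _ hav hbv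
  refine runs_seq (runs_inc ?_) (runs_seq (runs_inc ?_) (runs_seq (runs_inc ?_) (runs_seq
    (runs_inc ?_) (runs_seq (runs_mulAddTo (by decide) (Reg.ne_of_free ha rfl)
      (Reg.ne_of_free ha rfl) (by decide) (by decide) (by decide) (by decide) (by decide)
      ?_ ?_ ?_ ?_) (runs_seq (runs_addTo hbJ (Reg.ne_of_free hb rfl) (by decide) ?_ ?_)
      ((runs_getField_nat hE.input ?_ hL ?_ ?_ ?_ ?_ (by omega) (by omega)).congr ?_))))))
  · simp [hσ.J]; omega
  · simp [hσ.J]; omega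
  · simp [hσ.J]; omega
  · simp [hσ.J]; omega
  · simp [CounterState.reg_set, hσ.t₁]
  · simp [CounterState.reg_set, hσ.t₂]
  · simp [CounterState.reg_set, haJ]; omega
  · simp [CounterState.reg_set, haJ, hσ.D, hσ.J]; omega
  · simp [CounterState.reg_set, hσ.t₁]
  · simp [CounterState.reg_set, haJ, hbJ, hσ.D, hσ.J]; omega
  · simp [hσ.inputHead]
  · simp [CounterState.reg_set, haJ, hbJ, hσ.D, hσ.J]; omega
  · simp [CounterState.reg_set, hR]
  · simp [CounterState.reg_set, hσ.P]
  · simp [CounterState.reg_set, hσ.t₁]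
  · simp only [CounterState.set_set]
    rw [CounterState.set_eq_self hσ.J]

/-- Write the entry for the layer `A`, the state `B` and the block `K` of the transition table of
the layered automaton. -/
def putEntry : Block Reg Unit :=
  seq (ifDec .A (seq (lookup .B .K) (seq (mulAddTo .t₁ .t₂ .A .w .R) (inc .A)))
    (ifDec .fl (seq (inc .fl) (lookup .B .K)) (addTo .t₁ .B .R)))
    (seq (putNat .R) (clear .R))

/-- The test of `A` by decrementing also supplies the factor: while `A` is one lower, it is exactly
the index of the next layer. Both `A` and the flag are restored after their tests. -/
theorem runs_putEntry (hE : Setup E w d m s tab q xs) (hσ : Loaded w d m s σ)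
    (hR : σ.reg .R = 0) (hA : σ.reg .A < m) (hB : σ.reg .B < w) (hK : σ.reg .K < 2 ^ d)
    (hf : σ.reg .fl ≤ 1) :
    putEntry.Runs E σ () (σ.query
      (encodeNat (layerEntry w tab (σ.reg .fl) (σ.reg .A) (σ.reg .B) (σ.reg .K)))) := by
  have ht := hE.tab_lt _ _ hB hK
  have h1 := hE.wm_le
  have hAw : σ.reg .A * w ≤ m * w := Nat.mul_le_mul_right _ hA.le
  have hAw' : (σ.reg .A - 1) * w ≤ σ.reg .A * w := Nat.mul_le_mul_right _ (by omega)
  have hmw : m * w = w * m := mul_comm _ _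
  have hm := hE.m_le
  set v := layerEntry w tab (σ.reg .fl) (σ.reg .A) (σ.reg .B) (σ.reg .K) with hv
  have hvb : v ≤ E.bound := by
    rw [hv, layerEntry]; split_ifs <;> omega
  have key : (ifDec .A (seq (lookup .B .K) (seq (mulAddTo .t₁ .t₂ .A .w .R) (inc .A)))
      (ifDec .fl (seq (inc .fl) (lookup .B .K)) (addTo .t₁ .B .R))).Runs E σ ()
      (σ.set .R v) := by
    rcases hA0 : σ.reg .A with _ | l
    · rcases hf0 : σ.reg .fl with _ | f
      · refine runs_ifDec_zero hA0 (runs_ifDec_zero hf0 ((runs_addTo (by decide) (by decide)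
          (by decide) hσ.t₁ ?_).congr ?_))
        · rw [hR]; omega
        · rw [hv, hA0, hf0, hR]; simp [layerEntry]
      · refine runs_ifDec_zero hA0 (runs_ifDec_succ hf0 (runs_seq (runs_inc ?_)
          ((runs_lookup hE ((hσ.set rfl).set rfl) ?_ rfl rfl ?_ ?_).congr ?_)))
        · simp; omega
        · simp [CounterState.reg_set, hR]
        · simpa [CounterState.reg_set]
        · simpa [CounterState.reg_set]
        · simp only [CounterState.set_set, CounterState.reg_set_self]
          rw [CounterState.set_eq_self hf0, hv, hA0, hf0]; simp [layerEntry]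
    · rw [hA0] at hA hAw hAw'
      rw [show l + 1 - 1 = l by omega] at hAw'
      refine runs_ifDec_succ hA0 (runs_seq (runs_lookup hE (hσ.set rfl) ?_ rfl rfl ?_ ?_)
        (runs_seq (runs_mulAddTo (by decide) (by decide) (by decide) (by decide) (by decide)
          (by decide) (by decide) (by decide) ?_ ?_ ?_ ?_) ((runs_inc ?_).congr ?_)))
      · simp [CounterState.reg_set, hR]
      · simpa [CounterState.reg_set]
      · simpa [CounterState.reg_set]
      · simp [CounterState.reg_set, hσ.t₁]
      · simp [CounterState.reg_set, hσ.t₂]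
      · simp [CounterState.reg_set]; omega
      · simp [CounterState.reg_set, hσ.w]; omega
      · simp [CounterState.reg_set]; omega
      · rw [hv, hA0]
        ext r
        · simp only [CounterState.reg_set, layerEntry]
          split_ifs <;> simp_all [hσ.w]
        all_goals rfl
  refine runs_seq key (runs_seq (runs_putNat (hσ.set rfl).toReady (by decide) ?_)
    (runs_clear.congr ?_))
  · simpa
  · simp [CounterState.set_query, CounterState.set_eq_self hR]

/-- Run `A` for each value of the counter `i` below that of `n`; the counter `c` tells how often `A`
is still to be run. -/
def forUp (n i c : Reg) (A : Block Reg Unit) : Block Reg Unit :=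
  seq (addTo .t₁ n c) (seq (whileDec c (seq A (inc i))) (clear i))

/-- The invariant `h` is stated with both loop counters at 0. In round j they hold j and k − 1 − j,
and both are back at 0 at the end. -/
theorem runs_forUp {n i c : Reg} (hd : n ≠ c ∧ n ≠ .t₁ ∧ c ≠ .t₁ ∧ i ≠ c) {A : Block Reg Unit}
    {k : ℕ} (hk : k ≤ E.bound) (h : ℕ → CounterState Reg) (hn : (h 0).reg n = k)
    (ht : (h 0).reg .t₁ = 0) (hi : ∀ j, (h j).reg i = 0) (hc : ∀ j, (h j).reg c = 0)
    (hA : ∀ j < k, A.Runs E (((h j).set i j).set c (k - 1 - j)) ()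
      (((h (j + 1)).set i j).set c (k - 1 - j))) :
    (forUp n i c A).Runs E (h 0) () (h k) := by
  obtain ⟨hnc, hn1, hc1, hic⟩ := hd
  refine runs_seq (runs_addTo hnc hn1 hc1 ht (by rw [hn, hc]; omega)) (runs_seq
    ((runs_whileDec k (fun j => (h j).set i j) fun j hj => ?_).congr_left ?_)
      (runs_clear.congr ?_))
  · refine runs_seq (hA j hj) ((runs_inc ?_).congr ?_)
    · simp [CounterState.reg_set, hic]; omega
    · simp only [CounterState.reg_set, hic, if_false, if_true]
      rw [CounterState.set_comm _ hic.symm, CounterState.set_set]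
  · rw [hc, hn, zero_add, CounterState.set_eq_self (hi 0)]
  · rw [CounterState.set_comm _ hic.symm, CounterState.set_set, CounterState.set_eq_self (hi k),
      CounterState.set_eq_self (hc k)]

/-- Write the transition table of the layered automaton. -/
def putTable : Block Reg Unit := forUp .m .A .cA (forUp .w .B .cB (forUp .D .K .cK putEntry))

/-- In each of the three nested loops the invariant says that the oracle tape has received the
corresponding prefix of the table. Nothing but the loop counters has to be remembered. -/
theorem runs_putTable (hE : Setup E w d m s tab q xs) (hσ : Loaded w d m s σ)
    (hR : σ.reg .R = 0) (hA : σ.reg .A = 0) (hcA : σ.reg .cA = 0) (hB : σ.reg .B = 0)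
    (hcB : σ.reg .cB = 0) (hK : σ.reg .K = 0) (hcK : σ.reg .cK = 0) (hf : σ.reg .fl ≤ 1) :
    putTable.Runs E σ () (σ.query (layerTable w d m tab (σ.reg .fl))) := by
  have hm := hE.m_le
  have hw := hE.w_le
  have hD := hE.D_le
  refine (runs_forUp (by decide) (k := m) (by omega) (fun j => σ.query ((List.range j).flatMap
    fun l => (List.range w).flatMap fun v =>
    (List.range (2 ^ d)).flatMap fun k => encodeNat (layerEntry w tab (σ.reg .fl) l v k)))
    (by simp [hσ.m]) (by simp [hσ.t₁]) (by simp [hA]) (by simp [hcA]) ?_).congr_left ?_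
  swap
  · simp [CounterState.query]
  intro a ha
  simp only [CounterState.set_query]
  have h1 : Loaded w d m s ((σ.set .A a).set .cA (m - 1 - a)) := (hσ.set rfl).set rfl
  have h2 : ((σ.set .A a).set .cA (m - 1 - a)).reg .R = 0 := by simp [CounterState.reg_set, hR]
  have h3 : ((σ.set .A a).set .cA (m - 1 - a)).reg .A = a := by simp [CounterState.reg_set]
  have h4 : ((σ.set .A a).set .cA (m - 1 - a)).reg .fl = σ.reg .fl := by
    simp [CounterState.reg_set]
  have h5 : ((σ.set .A a).set .cA (m - 1 - a)).reg .B = 0 := by simp [CounterState.reg_set, hB]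
  have h6 : ((σ.set .A a).set .cA (m - 1 - a)).reg .cB = 0 := by simp [CounterState.reg_set, hcB]
  have h7 : ((σ.set .A a).set .cA (m - 1 - a)).reg .K = 0 := by simp [CounterState.reg_set, hK]
  have h8 : ((σ.set .A a).set .cA (m - 1 - a)).reg .cK = 0 := by simp [CounterState.reg_set, hcK]
  -- From here on only the listed register values of this state matter. Forgetting how it arose
  -- keeps the invariants of the inner loops small.
  generalize (σ.set .A a).set .cA (m - 1 - a) = ρ at *
  refine ((runs_forUp (by decide) (k := w) (by omega) (fun j => ρ.query (((List.range a).flatMap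
    fun l => (List.range w).flatMap fun v =>
    (List.range (2 ^ d)).flatMap fun k => encodeNat (layerEntry w tab (σ.reg .fl) l v k)) ++
    (List.range j).flatMap fun v =>
    (List.range (2 ^ d)).flatMap fun k => encodeNat (layerEntry w tab (σ.reg .fl) a v k)))
    (by simp [h1.w]) (by simp [h1.t₁]) (by simp [h5]) (by simp [h6]) ?_).congr_left ?_).congr ?_
  rotate_left
  · simp
  · simp [List.range_succ]
  intro b hb
  simp only [CounterState.set_query]
  have g1 : Loaded w d m s ((ρ.set .B b).set .cB (w - 1 - b)) := (h1.set rfl).set rfl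
  have g2 : ((ρ.set .B b).set .cB (w - 1 - b)).reg .R = 0 := by simp [CounterState.reg_set, h2]
  have g3 : ((ρ.set .B b).set .cB (w - 1 - b)).reg .A = a := by simp [CounterState.reg_set, h3]
  have g4 : ((ρ.set .B b).set .cB (w - 1 - b)).reg .fl = σ.reg .fl := by
    simp [CounterState.reg_set, h4]
  have g5 : ((ρ.set .B b).set .cB (w - 1 - b)).reg .B = b := by simp [CounterState.reg_set]
  have g7 : ((ρ.set .B b).set .cB (w - 1 - b)).reg .K = 0 := by simp [CounterState.reg_set, h7]
  have g8 : ((ρ.set .B b).set .cB (w - 1 - b)).reg .cK = 0 := by simp [CounterState.reg_set, h8]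
  generalize (ρ.set .B b).set .cB (w - 1 - b) = θ at *
  refine ((runs_forUp (by decide) (k := 2 ^ d) (by omega) (fun j => θ.query
    ((((List.range a).flatMap
    fun l => (List.range w).flatMap fun v =>
    (List.range (2 ^ d)).flatMap fun k => encodeNat (layerEntry w tab (σ.reg .fl) l v k)) ++
    (List.range b).flatMap fun v =>
    (List.range (2 ^ d)).flatMap fun k => encodeNat (layerEntry w tab (σ.reg .fl) a v k)) ++
    (List.range j).flatMap fun k => encodeNat (layerEntry w tab (σ.reg .fl) a b k)))
    (by simp [g1.D]) (by simp [g1.t₁]) (by simp [g7]) (by simp [g8]) ?_).congr_left ?_).congr ?_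
  rotate_left
  · simp
  · simp [List.range_succ]
  intro k hk
  refine (runs_putEntry hE ((g1.query.set rfl).set rfl) ?_ ?_ ?_ ?_ ?_).congr ?_
  · simp [CounterState.reg_set, g2]
  · simp [CounterState.reg_set, g3, ha]
  · simp [CounterState.reg_set, g5, hb]
  · simp [CounterState.reg_set, hk]
  · simp [CounterState.reg_set, g4, hf]
  · simp [CounterState.reg_set, g3, g4, g5, CounterState.set_query, CounterState.query_query,
      List.range_succ]

end Block

/-! ### Consulting the simulator and choosing a block -/

/-- The counters that may change between the consultations of the simulator. -/
def Reg.outer : Reg → Bool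
  | .u | .V | .l | .z | .cz | .cy | .cnt | .best | .bz | .st | .sd | .fl | .R₂ => true
  | _ => false

/-- The state between two consultations of the simulator. -/
structure Idle (w d m s : ℕ) (σ : CounterState Reg) : Prop extends Loaded w d m s σ where
  orc : σ.orc = []
  A : σ.reg .A = 0
  cA : σ.reg .cA = 0
  B : σ.reg .B = 0
  cB : σ.reg .cB = 0
  K : σ.reg .K = 0
  cK : σ.reg .cK = 0
  I : σ.reg .I = 0
  P₂ : σ.reg .P₂ = 0
  R : σ.reg .R = 0

theorem Idle.set {w d m s : ℕ} {σ : CounterState Reg} (h : Idle w d m s σ) {r : Reg} {n : ℕ}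
    (hr : r.outer = true) : Idle w d m s (σ.set r n) := by
  have key : ∀ t : Reg, t.outer = false → (σ.set r n).reg t = σ.reg t := by
    intro t ht
    rw [CounterState.reg_set, if_neg]
    rintro rfl
    simp [ht] at hr
  exact ⟨h.toLoaded.set (by cases r <;> simp_all [Reg.outer, Reg.free]), h.orc,
    (key _ rfl).trans h.A, (key _ rfl).trans h.cA, (key _ rfl).trans h.B, (key _ rfl).trans h.cB,
    (key _ rfl).trans h.K, (key _ rfl).trans h.cK, (key _ rfl).trans h.I, (key _ rfl).trans h.P₂,
    (key _ rfl).trans h.R⟩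

theorem Idle.put_true {w d m s : ℕ} {σ : CounterState Reg} (h : Idle w d m s σ) {l : List Bool} :
    Idle w d m s (σ.put true l) :=
  ⟨h.toLoaded.put, h.orc, by simp [h.A], by simp [h.cA], by simp [h.B], by simp [h.cB],
    by simp [h.K], by simp [h.cK], by simp [h.I], by simp [h.P₂], by simp [h.R]⟩

/-- The oracle answers queries about the layered automaton by `sim`. -/
def Simulates (E : RunEnv) (w d m s : ℕ) (tab : ℕ → ℕ → ℕ) (sim : ℕ → ℕ → ℕ → ℕ) : Prop :=
  ∀ f a y, a < w * m → y < 2 ^ s → E.oracle (layerTable w d m tab f ++ encodeNat a ++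
    ((List.range s).map y.testBit).map TapeSym.bit) = (sim f a y).bits ∧ sim f a y < w * m

/-- A running maximum of `c` and the first place where it is attained. -/
def argmaxBelow (c : ℕ → ℕ) : ℕ → ℕ × ℕ
  | 0 => (0, 0)
  | j + 1 => if (argmaxBelow c j).1 < c j then (c j, j) else argmaxBelow c j

/-- The number of seeds for which the simulator goes from `a` to `V`. -/
def hitCount (s : ℕ) (sim : ℕ → ℕ → ℕ → ℕ) (V a : ℕ) : ℕ :=
  Nat.count (fun y => sim 0 a y = V) (2 ^ s)

/-- The block that is chosen in state `u` when `l` steps remain after it. -/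
def bestBlock (w d s : ℕ) (tab : ℕ → ℕ → ℕ) (sim : ℕ → ℕ → ℕ → ℕ) (V l u : ℕ) : ℕ :=
  (argmaxBelow (fun z => hitCount s sim V (tab u z + l * w)) (2 ^ d)).2

/-- The states along the chosen path. -/
def pathState (w d m s : ℕ) (tab : ℕ → ℕ → ℕ) (sim : ℕ → ℕ → ℕ → ℕ) (V q : ℕ) : ℕ → ℕ
  | 0 => q
  | j + 1 => tab (pathState w d m s tab sim V q j)
      (bestBlock w d s tab sim V (m - 1 - j) (pathState w d m s tab sim V q j))

/-- The blocks along the chosen path. -/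
def pathBlock (w d m s : ℕ) (tab : ℕ → ℕ → ℕ) (sim : ℕ → ℕ → ℕ → ℕ) (V q j : ℕ) : ℕ :=
  bestBlock w d s tab sim V (m - 1 - j) (pathState w d m s tab sim V q j)

/-- The initial value (0, 0) is a legitimate choice because the range is nonempty; it survives when
all counts vanish. -/
theorem argmaxBelow_lt (c : ℕ → ℕ) {n : ℕ} (hn : 0 < n) : (argmaxBelow c n).2 < n := by
  induction n with
  | zero => omega
  | succ n ih =>
    simp only [argmaxBelow]
    split_ifs
    · simp
    · rcases Nat.eq_zero_or_pos n with rfl | h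
      · simp [argmaxBelow]
      · have := ih h; omega

theorem argmaxBelow_fst_le (c : ℕ → ℕ) {n N : ℕ} (h : ∀ j < n, c j ≤ N) :
    (argmaxBelow c n).1 ≤ N := by
  induction n with
  | zero => simp [argmaxBelow]
  | succ n ih =>
    simp only [argmaxBelow]
    split_ifs
    · exact h n (by omega)
    · exact ih fun j hj => h j (by omega)

theorem hitCount_le (s : ℕ) (sim : ℕ → ℕ → ℕ → ℕ) (V a : ℕ) : hitCount s sim V a ≤ 2 ^ s :=
  Nat.count_le _

namespace Block

variable {E : RunEnv} {σ : CounterState Reg} {w d m s q : ℕ} {tab : ℕ → ℕ → ℕ} {xs : List Bool}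
  {sim : ℕ → ℕ → ℕ → ℕ}

/-- Ask for bit number `I` of the answer of the simulator, and add it to `R₂` with weight `P₂`. The
exit tells whether there is such a bit. -/
def askBit : Block Reg Bool :=
  seq (putNat .I) (seq putTable (seq (putNat .st) (seq (putFixed false .sd .s)
    (bind inferInstance ask fun a => match a with
      | none => ret false
      | some b => seq (cond b (addTo .t₁ .P₂ .R₂) (ret ()))
          (seq (double .t₁ .P₂) (seq (inc .I) (ret true)))))))

/-- Consult the simulator, for the initial state `st` and the seed `sd`. -/
def askSim : Block Reg Unit := seq (inc .P₂) (seq (loop askBit) (seq (clear .P₂) (clear .I)))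

/-- The state in the course of `askSim`, when the bits `l` are known. -/
def askState (σ : CounterState Reg) (l : List Bool) : CounterState Reg :=
  ((σ.set .I l.length).set .P₂ (2 ^ l.length)).set .R₂ (binVal l)

/-- The query consists of the bit index, the layered table, the initial state and the seed. It is
stated with an arbitrary continuation `B`, so that the case of a further bit and the case of an
exhausted answer share it. -/
theorem runs_askQuery (hE : Setup E w d m s tab q xs) (hσ : Idle w d m s σ)
    (hf : σ.reg .fl ≤ 1) (ha : σ.reg .st < w * m) (hy : σ.reg .sd < 2 ^ s) {o : Bool}
    {σ' : CounterState Reg} {l : List Bool} (hl : l.length ≤ E.bound)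
    {B : Option Bool → Block Reg Bool}
    (hB : (B (E.oracle (layerTable w d m tab (σ.reg .fl) ++ encodeNat (σ.reg .st) ++
      ((List.range s).map (σ.reg .sd).testBit).map TapeSym.bit))[l.length]?).Runs E
      (askState σ l) o σ') :
    (seq (putNat .I) (seq putTable (seq (putNat .st) (seq (putFixed false .sd .s)
      (bind inferInstance ask B))))).Runs E (askState σ l) o σ' := by
  have h1 : Loaded w d m s (askState σ l) := ((hσ.toLoaded.set rfl).set rfl).set rfl
  have h2 := hE.wm_le
  have h3 := hE.S_le
  have h4 := hE.s_le
  refine runs_seq (runs_putNat h1.toReady (by decide) ?_) (runs_seq (runs_putTable hE h1.query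
    ?_ ?_ ?_ ?_ ?_ ?_ ?_ ?_) (runs_seq (runs_putNat h1.query.query.toReady (by decide) ?_)
    (runs_seq (runs_putFixed h1.query.query.query.toReady (by decide) (by decide) ?_ ?_)
      (runs_bind runs_ask ?_))))
  · simp [askState, CounterState.reg_set, hl]
  · simp [askState, CounterState.reg_set, hσ.R]
  · simp [askState, CounterState.reg_set, hσ.A]
  · simp [askState, CounterState.reg_set, hσ.cA]
  · simp [askState, CounterState.reg_set, hσ.B]
  · simp [askState, CounterState.reg_set, hσ.cB]
  · simp [askState, CounterState.reg_set, hσ.K]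
  · simp [askState, CounterState.reg_set, hσ.cK]
  · simpa [askState, CounterState.reg_set]
  · simp [askState, CounterState.reg_set]; omega
  · simp [askState, CounterState.reg_set]; omega
  · simp [askState, CounterState.reg_set, hσ.s]; omega
  · simp only [CounterState.put_false, CounterState.query_query, CounterState.orc_query,
      CounterState.reg_query]
    have e1 : (askState σ l).orc = [] := hσ.orc
    have e2 : (askState σ l).reg .I = l.length := by simp [askState, CounterState.reg_set]
    have e3 : (askState σ l).reg .fl = σ.reg .fl := by simp [askState, CounterState.reg_set]
    have e4 : (askState σ l).reg .st = σ.reg .st := by simp [askState, CounterState.reg_set]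
    have e5 : (askState σ l).reg .sd = σ.reg .sd := by simp [askState, CounterState.reg_set]
    have e6 : (askState σ l).reg .s = s := h1.s
    rw [e1, e2, e3, e4, e5, e6, List.nil_append]
    simp only [List.append_assoc] at hB ⊢
    rw [oracleAnswer_encodeNat]
    refine hB.congr_left ?_
    rw [← e1]
    rfl

/-- The length of the answer is not known beforehand: bits are requested one at a time until the
oracle reports that there is none. Since the oracle tape is erased by each request, the whole query
is written again for every bit. -/
theorem runs_askSim (hE : Setup E w d m s tab q xs) (hsim : Simulates E w d m s tab sim)
    (hσ : Idle w d m s σ) (hf : σ.reg .fl ≤ 1) (ha : σ.reg .st < w * m)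
    (hy : σ.reg .sd < 2 ^ s) (hR₂ : σ.reg .R₂ = 0) :
    askSim.Runs E σ () (σ.set .R₂ (sim (σ.reg .fl) (σ.reg .st) (σ.reg .sd))) := by
  obtain ⟨hv, hvlt⟩ := hsim (σ.reg .fl) _ _ ha hy
  set v := sim (σ.reg .fl) (σ.reg .st) (σ.reg .sd)
  have h2 := hE.wm_le
  have h3 := hE.w_le
  have h4 := hE.D_le
  have h5 : 0 < 2 ^ d := by positivity
  have hlen : 2 ^ v.bits.length ≤ E.bound := two_pow_length_bits (by omega) (by omega)
  have hlen' : v.bits.length < 2 ^ v.bits.length := Nat.lt_two_pow_self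
  -- Induction on the digits `l'` still unknown; those in `l` have been summed up in `R₂`.
  have key : ∀ l' l : List Bool, v.bits = l ++ l' →
      (loop askBit).Runs E (askState σ l) () (askState σ v.bits) := by
    intro l'
    induction l' with
    | nil =>
      intro l hl
      rw [List.append_nil] at hl
      refine runs_loop_false (runs_askQuery hE hσ hf ha hy (by rw [← hl]; omega) ?_)
      rw [hv, hl, List.getElem?_eq_none le_rfl]
      exact runs_ret
    | cons b l' ih =>
      intro l hl
      have hll : l.length + 1 ≤ v.bits.length := by rw [hl]; simp
      have hp : 2 ^ (l.length + 1) ≤ 2 ^ v.bits.length := Nat.pow_le_pow_right (by norm_num) hll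
      rw [pow_succ] at hp
      have hlv := binVal_lt l
      refine runs_loop_true (runs_askQuery hE hσ hf ha hy (by omega) ?_)
        (ih (l ++ [b]) (by simpa using hl))
      rw [hv, hl, List.getElem?_append_right le_rfl]
      simp only [Nat.sub_self, List.getElem?_cons_zero]
      have h6 : (cond b (addTo .t₁ .P₂ .R₂) (ret ())).Runs E (askState σ l) ()
          ((askState σ l).set .R₂ (binVal l + b.toNat * 2 ^ l.length)) := by
        cases b
        · refine runs_ret.congr (CounterState.set_eq_self ?_).symm
          simp [askState]
        · refine (runs_addTo (by decide) (by decide) (by decide) ?_ ?_).congr ?_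
          · simp [askState, CounterState.reg_set, hσ.t₁]
          · simp [askState, CounterState.reg_set]; omega
          · simp [askState, CounterState.reg_set]
      refine runs_seq h6 (runs_seq (runs_double (by decide) ?_ ?_)
        (runs_seq (runs_inc ?_) (runs_ret.congr ?_)))
      · simp [askState, CounterState.reg_set, hσ.t₁]
      · simp [askState, CounterState.reg_set]; omega
      · simp [askState, CounterState.reg_set]; omega
      · ext r
        · simp only [askState, CounterState.reg_set, List.length_append, List.length_singleton,
            binVal_append, binVal]
          split_ifs <;> simp_all [pow_succ, mul_comm]
        all_goals rfl
  refine runs_seq (runs_inc ?_) (runs_seq ((key v.bits [] rfl).congr_left ?_)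
    (runs_seq runs_clear (runs_clear.congr ?_)))
  · rw [hσ.P₂]; omega
  · rw [hσ.P₂]
    ext r
    · simp only [askState, CounterState.reg_set]
      split_ifs <;> simp_all [hσ.I, binVal]
    all_goals rfl
  · ext r
    · simp only [askState, CounterState.reg_set, binVal_bits]
      split_ifs <;> simp_all [hσ.I, hσ.P₂]
    all_goals rfl

/-- Increment `cnt` if `R₂` and `V` agree. -/
def countHit : Block Reg Unit :=
  seq (addTo .t₁ .R₂ .t₃) (seq (subFrom .t₁ .t₂ .V .t₃) (seq (addTo .t₁ .V .t₄)
    (seq (subFrom .t₁ .t₂ .R₂ .t₄) (seq (moveTo .t₃ .t₄)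
      (ifDec .t₄ (clear .t₄) (inc .cnt))))))

/-- Equality is tested by adding the two truncated differences: the sum is 0 exactly when the
numbers agree. -/
theorem runs_countHit (hσ : Ready σ) (hR : σ.reg .R₂ ≤ E.bound) (hV : σ.reg .V ≤ E.bound)
    (hc : σ.reg .cnt < E.bound) : countHit.Runs E σ ()
      (σ.set .cnt (σ.reg .cnt + if σ.reg .R₂ = σ.reg .V then 1 else 0)) := by
  obtain ⟨-, -, -, h1, h2, h3, h4⟩ := hσ
  refine runs_seq (runs_addTo (by decide) (by decide) (by decide) h1 ?_) (runs_seq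
    (runs_subFrom (by decide) (by decide) (by decide) (by decide) ?_ ?_ ?_) (runs_seq
    (runs_addTo (by decide) (by decide) (by decide) ?_ ?_) (runs_seq (runs_subFrom (by decide)
      (by decide) (by decide) (by decide) ?_ ?_ ?_) (runs_seq (runs_moveTo (by decide) ?_) ?_))))
  · simpa [h3]
  · simp [CounterState.reg_set, h1]
  · simp [CounterState.reg_set, h2]
  · simpa [CounterState.reg_set]
  · simp [CounterState.reg_set, h1]
  · simpa [CounterState.reg_set, h4]
  · simp [CounterState.reg_set, h1]
  · simp [CounterState.reg_set, h2]
  · simpa [CounterState.reg_set]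
  · simp [CounterState.reg_set, h3, h4]; omega
  · simp only [CounterState.reg_set, h3, h4, reduceCtorEq, if_true, if_false, zero_add]
    by_cases h : σ.reg .R₂ = σ.reg .V
    · refine (runs_ifDec_zero ?_ (runs_inc ?_)).congr ?_
      · simp [CounterState.reg_set, h]
      · simpa [CounterState.reg_set]
      · ext r
        · simp only [CounterState.reg_set]
          split_ifs <;> simp_all
        all_goals rfl
    · obtain ⟨k, hk⟩ : ∃ k, σ.reg .V - σ.reg .R₂ + (σ.reg .R₂ - σ.reg .V) = k + 1 :=
        ⟨_, (Nat.sub_add_cancel (by omega)).symm⟩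
      refine (runs_ifDec_succ (n := k) ?_ runs_clear).congr ?_
      · simp [CounterState.reg_set, hk]
      · ext r
        · simp only [CounterState.reg_set]
          split_ifs <;> simp_all
        all_goals rfl

/-- Count the seeds for which the simulator goes from `st` to `V`. -/
def countSeeds : Block Reg Unit := forUp .S .sd .cy (seq askSim (seq countHit (clear .R₂)))

theorem runs_countSeeds (hE : Setup E w d m s tab q xs) (hsim : Simulates E w d m s tab sim)
    (hσ : Idle w d m s σ) (hf : σ.reg .fl = 0) (ha : σ.reg .st < w * m) (hR₂ : σ.reg .R₂ = 0)
    (hsd : σ.reg .sd = 0) (hcy : σ.reg .cy = 0) (hcnt : σ.reg .cnt = 0)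
    (hV : σ.reg .V ≤ E.bound) :
    countSeeds.Runs E σ () (σ.set .cnt (hitCount s sim (σ.reg .V) (σ.reg .st))) := by
  have h1 := hE.S_le
  have h2 := hE.wm_le
  refine (runs_forUp (by decide) (k := 2 ^ s) (by omega)
    (fun j => σ.set .cnt (Nat.count (fun y => sim 0 (σ.reg .st) y = σ.reg .V) j)) ?_ ?_ ?_ ?_
    ?_).congr_left ?_
  · simp [CounterState.reg_set, hσ.S]
  · simp [CounterState.reg_set, hσ.t₁]
  · simp [CounterState.reg_set, hsd]
  · simp [CounterState.reg_set, hcy]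
  · intro j hj
    have hlt := (hsim 0 _ j ha hj).2
    have hcl := Nat.count_le (p := fun y => sim 0 (σ.reg .st) y = σ.reg .V) (n := j)
    refine runs_seq (runs_askSim hE hsim (((hσ.set rfl).set rfl).set rfl) ?_ ?_ ?_ ?_)
      (runs_seq (runs_countHit ((((hσ.set rfl).set rfl).set rfl).set rfl).toReady ?_ ?_ ?_)
        (runs_clear.congr ?_))
    · simp [CounterState.reg_set, hf]
    · simpa [CounterState.reg_set]
    · simpa [CounterState.reg_set]
    · simp [CounterState.reg_set, hR₂]
    · simp [CounterState.reg_set, hf]; omega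
    · simpa [CounterState.reg_set]
    · simp [CounterState.reg_set]; omega
    · ext r
      · simp only [CounterState.reg_set, reduceCtorEq, if_true, if_false, hf, Nat.count_succ]
        split_ifs <;> simp_all
      all_goals rfl
  · simp [CounterState.set_eq_self hcnt]

/-- Update the best count and the best block. -/
def updateBest : Block Reg Unit :=
  seq (addTo .t₁ .cnt .t₃) (seq (subFrom .t₁ .t₂ .best .t₃) (ifDec .t₃
    (seq (clear .t₃) (seq (clear .best) (seq (addTo .t₁ .cnt .best) (seq (clear .bz)
      (addTo .t₁ .z .bz))))) (ret ())))

/-- The comparison is strict, matching `argmaxBelow`: cnt − best, truncated, is positive exactly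
when the new count is larger. -/
theorem runs_updateBest (hσ : Ready σ) (hc : σ.reg .cnt ≤ E.bound) (hb : σ.reg .best ≤ E.bound)
    (hz : σ.reg .z ≤ E.bound) : updateBest.Runs E σ ()
      (if σ.reg .best < σ.reg .cnt then (σ.set .best (σ.reg .cnt)).set .bz (σ.reg .z) else σ) := by
  obtain ⟨-, -, -, h1, h2, h3, h4⟩ := hσ
  refine runs_seq (runs_addTo (by decide) (by decide) (by decide) h1 ?_) (runs_seq
    (runs_subFrom (by decide) (by decide) (by decide) (by decide) ?_ ?_ ?_) ?_)
  · simpa [h3]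
  · simp [CounterState.reg_set, h1]
  · simp [CounterState.reg_set, h2]
  · simpa [CounterState.reg_set]
  · simp only [CounterState.reg_set, h3, reduceCtorEq, if_true, if_false, zero_add]
    by_cases h : σ.reg .best < σ.reg .cnt
    · obtain ⟨k, hk⟩ : ∃ k, σ.reg .cnt - σ.reg .best = k + 1 :=
        ⟨_, (Nat.sub_add_cancel (by omega)).symm⟩
      refine (runs_ifDec_succ (n := k) (by simp [hk]) (runs_seq runs_clear
        (runs_seq runs_clear (runs_seq (runs_addTo (by decide) (by decide) (by decide) ?_ ?_) (runs_seq runs_clear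
          (runs_addTo (by decide) (by decide) (by decide) ?_ ?_)))))).congr ?_
      · simp [CounterState.reg_set, h1]
      · simpa [CounterState.reg_set]
      · simp [CounterState.reg_set, h1]
      · simpa [CounterState.reg_set]
      · rw [if_pos h]
        ext r
        · simp only [CounterState.reg_set]
          split_ifs <;> simp_all
        all_goals rfl
    · refine (runs_ifDec_zero ?_ runs_ret).congr ?_
      · simp; omega
      · rw [if_neg h, show σ.reg .cnt - σ.reg .best = 0 by omega, CounterState.set_set,
          CounterState.set_eq_self h3]

/-- Choose the next block. -/
def chooseBlock : Block Reg Unit :=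
  forUp .D .z .cz (seq (lookup .u .z) (seq (moveTo .R .st) (seq (mulAddTo .t₁ .t₂ .l .w .st)
    (seq countSeeds (seq updateBest (seq (clear .cnt) (clear .st)))))))

/-- Nothing is pending between two blocks. -/
structure Rest (w d m s : ℕ) (σ : CounterState Reg) : Prop extends Idle w d m s σ where
  fl : σ.reg .fl = 0
  st : σ.reg .st = 0
  R₂ : σ.reg .R₂ = 0
  sd : σ.reg .sd = 0
  cy : σ.reg .cy = 0
  cnt : σ.reg .cnt = 0
  z : σ.reg .z = 0
  cz : σ.reg .cz = 0
  best : σ.reg .best = 0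
  bz : σ.reg .bz = 0

/-- Only the chosen block matters afterwards, so the best count is left existential. Candidates are
judged at the state reached after the block, in layer l, where l steps remain. -/
theorem runs_chooseBlock (hE : Setup E w d m s tab q xs) (hsim : Simulates E w d m s tab sim)
    (hσ : Rest w d m s σ) (hu : σ.reg .u < w) (hl : σ.reg .l < m) (hV : σ.reg .V ≤ E.bound) :
    ∃ b, chooseBlock.Runs E σ () ((σ.set .best b).set .bz
      (bestBlock w d s tab sim (σ.reg .V) (σ.reg .l) (σ.reg .u))) := by
  have h1 := hE.S_le
  have h2 := hE.wm_le
  have h3 := hE.D_le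
  have h4 := hE.m_le
  set c := fun z => hitCount s sim (σ.reg .V) (tab (σ.reg .u) z + σ.reg .l * w) with hc
  refine ⟨(argmaxBelow c (2 ^ d)).1, (runs_forUp (by decide) (k := 2 ^ d) (by omega)
    (fun j => (σ.set .best (argmaxBelow c j).1).set .bz (argmaxBelow c j).2) ?_ ?_ ?_ ?_
    ?_).congr_left ?_⟩
  · simp [CounterState.reg_set, hσ.D]
  · simp [CounterState.reg_set, hσ.t₁]
  · simp [CounterState.reg_set, hσ.z]
  · simp [CounterState.reg_set, hσ.cz]
  · intro j hj
    have ht := hE.tab_lt _ _ hu hj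
    have hlw : (σ.reg .l + 1) * w ≤ m * w := Nat.mul_le_mul_right _ hl
    have hmw : m * w = w * m := mul_comm _ _
    rw [add_mul, one_mul] at hlw
    have hb : (argmaxBelow c j).1 ≤ 2 ^ s := argmaxBelow_fst_le c fun j _ => hitCount_le _ _ _ _
    have hi : Idle w d m s ((((σ.set .best (argmaxBelow c j).1).set .bz
        (argmaxBelow c j).2).set .z j).set .cz (2 ^ d - 1 - j)) :=
      (((hσ.toIdle.set rfl).set rfl).set rfl).set rfl
    have hcl : c j ≤ 2 ^ s := hitCount_le _ _ _ _
    refine runs_seq ((runs_lookup hE hi.toLoaded hi.R rfl rfl ?_ ?_)) (runs_seq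
      (runs_moveTo (by decide) ?_) (runs_seq (runs_mulAddTo (by decide) (by decide) (by decide)
      (by decide) (by decide) (by decide) (by decide) (by decide) ?_ ?_ ?_ ?_) (runs_seq
      ((runs_countSeeds hE hsim (hi.set (r := .st) (n := tab (σ.reg .u) j + σ.reg .l * w) rfl)
        ?_ ?_ ?_ ?_ ?_ ?_ ?_).congr_left ?_) (runs_seq (runs_updateBest
        ((hi.set rfl).set rfl).toReady ?_ ?_ ?_) (runs_seq runs_clear (runs_clear.congr ?_))))))
    · simpa [CounterState.reg_set]
    · simpa [CounterState.reg_set]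
    · simp [CounterState.reg_set, hσ.st]; omega
    · simp [CounterState.reg_set, hσ.t₁]
    · simp [CounterState.reg_set, hσ.t₂]
    · simp [CounterState.reg_set]; omega
    · simp [CounterState.reg_set, hσ.st, hσ.w]; omega
    · simp [CounterState.reg_set, hσ.fl]
    · simp; omega
    · simp [CounterState.reg_set, hσ.R₂]
    · simp [CounterState.reg_set, hσ.sd]
    · simp [CounterState.reg_set, hσ.cy]
    · simp [CounterState.reg_set, hσ.cnt]
    · simpa [CounterState.reg_set]
    · ext r
      · simp only [CounterState.reg_set, reduceCtorEq, if_true, if_false, hσ.st, hσ.w]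
        split_ifs <;> simp_all [hσ.R]
      all_goals rfl
    · simp [CounterState.reg_set]; exact hcl.trans (by omega)
    · simp [CounterState.reg_set]; omega
    · simp [CounterState.reg_set]; omega
    · simp only [CounterState.reg_set, reduceCtorEq, if_true, if_false]
      change ((if (argmaxBelow c j).1 < c j then _ else _ : CounterState Reg).set .cnt 0).set .st 0
        = _
      rw [argmaxBelow]
      split_ifs with hlt
      · ext r
        · simp only [CounterState.reg_set]
          split_ifs <;> simp_all [hσ.st, hσ.cnt]
        all_goals rfl
      · ext r
        · simp only [CounterState.reg_set]
          split_ifs <;> simp_all [hσ.st, hσ.cnt]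
        all_goals rfl
  · simp only [argmaxBelow]
    rw [CounterState.set_eq_self hσ.best, CounterState.set_eq_self hσ.bz]

end Block

/-! ### The path, loading of the input and the whole program -/

namespace Block

variable {E : RunEnv} {σ : CounterState Reg} {w d m s q : ℕ} {tab : ℕ → ℕ → ℕ} {xs : List Bool}
  {sim : ℕ → ℕ → ℕ → ℕ}

theorem Rest.set {w d m s : ℕ} {σ : CounterState Reg} (h : Rest w d m s σ) {r : Reg} {n : ℕ}
    (hr : r = .u ∨ r = .V ∨ r = .l) : Rest w d m s (σ.set r n) := by
  have h1 : Idle w d m s (σ.set r n) := h.toIdle.set (by rcases hr with rfl | rfl | rfl <;> rfl)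
  refine ⟨h1, ?_, ?_, ?_, ?_, ?_, ?_, ?_, ?_, ?_, ?_⟩ <;> rcases hr with rfl | rfl | rfl <;>
    simp [CounterState.reg_set, h.fl, h.st, h.R₂, h.sd, h.cy, h.cnt, h.z, h.cz, h.best, h.bz]

theorem Rest.put_true {w d m s : ℕ} {σ : CounterState Reg} (h : Rest w d m s σ) {l : List Bool} :
    Rest w d m s (σ.put true l) :=
  ⟨h.toIdle.put_true, by simp [h.fl], by simp [h.st], by simp [h.R₂], by simp [h.sd],
    by simp [h.cy], by simp [h.cnt], by simp [h.z], by simp [h.cz], by simp [h.best],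
    by simp [h.bz]⟩

theorem bestBlock_lt (w d s : ℕ) (tab : ℕ → ℕ → ℕ) (sim : ℕ → ℕ → ℕ → ℕ) (V l u : ℕ) :
    bestBlock w d s tab sim V l u < 2 ^ d :=
  argmaxBelow_lt _ (by positivity)

theorem pathState_lt (htab : ∀ v k, v < w → k < 2 ^ d → tab v k < w) (hq : q < w) (V j : ℕ) :
    pathState w d m s tab sim V q j < w := by
  induction j with
  | zero => exact hq
  | succ j ih => exact htab _ _ ih (bestBlock_lt _ _ _ _ _ _ _ _)

/-- Choose and output the blocks one by one. -/
def putPath : Block Reg Unit :=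
  seq (addTo .t₁ .m .l) (whileDec .l (seq chooseBlock (seq (putFixed true .bz .d)
    (seq (lookup .u .bz) (seq (clear .u) (seq (moveTo .R .u)
      (seq (clear .bz) (clear .best))))))))

/-- The loop decrements `l` before choosing, so `l` is the number of steps left after the block
being chosen. The target need not be below w: for an answer of the simulator outside layer 0 some
path is still written. -/
theorem runs_putPath (hE : Setup E w d m s tab q xs) (hsim : Simulates E w d m s tab sim)
    (hσ : Rest w d m s σ) (hu : σ.reg .u = q) (hl : σ.reg .l = 0) (hV : σ.reg .V ≤ E.bound) :
    ∃ σ', putPath.Runs E σ () σ' ∧ σ'.out = σ.out ++ (List.range m).flatMap fun j =>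
      (List.range d).map (pathBlock w d m s tab sim (σ.reg .V) q j).testBit := by
  have hm := hE.m_le
  have hw := hE.w_le
  have hD := hE.D_le
  have hd := hE.d_le
  refine ⟨_, runs_seq (runs_addTo (by decide) (by decide) (by decide) hσ.t₁ ?_)
    ((runs_whileDec m (fun j => (σ.set .u (pathState w d m s tab sim (σ.reg .V) q j)).put true
      ((List.range j).flatMap fun j =>
      (List.range d).map (pathBlock w d m s tab sim (σ.reg .V) q j).testBit)) ?_).congr_left
      ?_), ?_⟩
  · rw [hσ.m, hl]; omega
  · intro j hj
    set u := pathState w d m s tab sim (σ.reg .V) q j with hu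
    have huw : u < w := pathState_lt hE.tab_lt hE.q_lt _ j
    set z := pathBlock w d m s tab sim (σ.reg .V) q j with hz
    have hzD : z < 2 ^ d := bestBlock_lt _ _ _ _ _ _ _ _
    have hnext : pathState w d m s tab sim (σ.reg .V) q (j + 1) = tab u z := rfl
    have htw := hE.tab_lt _ _ huw hzD
    have h1 : Rest w d m s (((σ.set .u u).put true ((List.range j).flatMap fun j =>
      (List.range d).map (pathBlock w d m s tab sim (σ.reg .V) q j).testBit)).set .l
        (m - 1 - j)) :=
      ((hσ.set (by decide)).put_true).set (by decide)
    rw [hnext, List.range_succ, List.flatMap_append, List.flatMap_singleton, ← hz,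
      ← CounterState.put_put]
    simp only [CounterState.set_put] at h1 ⊢
    generalize ((List.range j).flatMap fun j =>
      (List.range d).map (pathBlock w d m s tab sim (σ.reg .V) q j).testBit) = o at *
    obtain ⟨b, hb⟩ := runs_chooseBlock hE hsim h1 (by simpa [CounterState.reg_set])
      (by simp; omega) (by simpa [CounterState.reg_set])
    have hbz : bestBlock w d s tab sim (((σ.set .u u).set .l (m - 1 - j)).put true o |>.reg .V)
        (((σ.set .u u).set .l (m - 1 - j)).put true o |>.reg .l)
        (((σ.set .u u).set .l (m - 1 - j)).put true o |>.reg .u) = z := by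
      simp [CounterState.reg_set, hz, pathBlock, hu]
    rw [hbz] at hb
    have h2 : Idle w d m s (((((σ.set .u u).set .l (m - 1 - j)).put true o).set .best b).set
      .bz z) := (h1.toIdle.set rfl).set rfl
    refine runs_seq hb (runs_seq (runs_putFixed h2.toReady (by decide) (by decide) ?_ ?_)
      (runs_seq (runs_lookup hE h2.put_true.toLoaded h2.put_true.R rfl rfl ?_ ?_)
        (runs_seq runs_clear (runs_seq (runs_moveTo (by decide) ?_)
          (runs_seq runs_clear (runs_clear.congr ?_))))))
    · simp; omega
    · simp [CounterState.reg_set, hσ.d]; omega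
    · simpa [CounterState.reg_set]
    · simpa [CounterState.reg_set]
    · simp [CounterState.reg_set]; omega
    · simp only [CounterState.set_put, CounterState.reg_put, CounterState.reg_set, reduceCtorEq,
        if_true, if_false, hσ.d]
      congr 2
      ext r
      · simp only [CounterState.reg_set]
        have e1 := hσ.R
        have e2 := hσ.bz
        have e3 := hσ.best
        clear * - e1 e2 e3
        split_ifs <;> simp_all
      all_goals rfl
  · rw [hl, hσ.m, zero_add, List.range_zero, List.flatMap_nil, CounterState.put_nil, pathState,
      CounterState.set_eq_self hu]
  · rfl

/-- Increment the counter `r` by `n`. -/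
def incBy (r : Reg) : ℕ → Block Reg Unit
  | 0 => ret ()
  | n + 1 => seq (inc r) (incBy r n)

theorem runs_incBy {r : Reg} {n : ℕ} (h : σ.reg r + n ≤ E.bound) :
    (incBy r n).Runs E σ () (σ.set r (σ.reg r + n)) := by
  induction n generalizing σ with
  | zero => exact runs_ret.congr (by simp [CounterState.set_reg])
  | succ n ih =>
    refine runs_seq (runs_inc (by omega)) ((ih ?_).congr ?_)
    · simp; omega
    · simp; congr 1; omega

/-- Read field number `n + w D` of the input into the counter `r`. -/
def readField (n : ℕ) (r : Reg) : Block Reg Unit :=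
  seq (incBy .J n) (seq (mulAddTo .t₁ .t₂ .w .D .J) (seq getField (moveTo .R r)))

/-- The shift by w·D serves the two fields behind the table. The four parameters are read while the
counter `D` is still 0, when the shift vanishes. -/
theorem runs_readField {n v : ℕ} {r : Reg} (hσ : Ready σ) (hR : σ.reg .R = 0) (hr : σ.reg r = 0)
    (hrR : r ≠ .R) (hrJ : r ≠ .J) (hw : σ.reg .w ≤ E.bound)
    (hb : n + σ.reg .w * σ.reg .D ≤ E.bound) (hv : v ≤ E.bound)
    (hget : ∀ ρ : CounterState Reg, ρ.inputHead = 0 → ρ.reg .J = n + σ.reg .w * σ.reg .D →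
      ρ.reg .R = 0 → ρ.reg .P = 0 → ρ.reg .t₁ = 0 →
      getField.Runs E ρ () ((ρ.set .J 0).set .R v)) :
    (readField n r).Runs E σ () (σ.set r v) := by
  refine runs_seq (runs_incBy ?_) (runs_seq (runs_mulAddTo (by decide) (by decide) (by decide)
    (by decide) (by decide) (by decide) (by decide) (by decide) ?_ ?_ ?_ ?_)
    (runs_seq (hget _ ?_ ?_ ?_ ?_ ?_) ((runs_moveTo hrR.symm ?_).congr ?_)))
  · rw [hσ.J]; omega
  · simp [CounterState.reg_set, hσ.t₁]
  · simp [CounterState.reg_set, hσ.t₂]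
  · simpa [CounterState.reg_set]
  · simpa [CounterState.reg_set, hσ.J]
  · simp [hσ.inputHead]
  · simp [CounterState.reg_set, hσ.J]
  · simp [CounterState.reg_set, hR]
  · simp [CounterState.reg_set, hσ.P]
  · simp [CounterState.reg_set, hσ.t₁]
  · simpa [CounterState.reg_set, hrR, hrJ, hr]
  · ext t
    · simp only [CounterState.reg_set]
      have := hσ.J
      split_ifs <;> simp_all
    all_goals rfl

/-- Set the counter `p` to two to the power `r`. -/
def powTwo (r p : Reg) : Block Reg Unit :=
  seq (inc p) (seq (addTo .t₁ r .t₃) (whileDec .t₃ (double .t₁ p)))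

theorem runs_powTwo {r p : Reg} (hσ : Ready σ) (hp : σ.reg p = 0) (hrp : r ≠ p)
    (hr : r ≠ .t₁ ∧ r ≠ .t₃) (hp' : p ≠ .t₁ ∧ p ≠ .t₃) (hb : 2 ^ σ.reg r ≤ E.bound) :
    (powTwo r p).Runs E σ () (σ.set p (2 ^ σ.reg r)) := by
  have h1 : 1 ≤ 2 ^ σ.reg r := Nat.one_le_two_pow
  have h2 : σ.reg r < 2 ^ σ.reg r := Nat.lt_two_pow_self
  obtain ⟨hr1, hr3⟩ := hr
  obtain ⟨hp1, hp3⟩ := hp'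
  refine runs_seq (runs_inc ?_) (runs_seq (runs_addTo hr3 hr1 (by decide) ?_ ?_)
    (((runs_whileDec (σ.reg r) (fun j => σ.set p (2 ^ j)) fun j hj => ?_).congr_left ?_).congr ?_))
  · omega
  · simp [CounterState.reg_set, hp1.symm, hσ.t₁]
  · simp [CounterState.reg_set, hrp, hp3.symm, hσ.t₃]; omega
  · have h3 : 2 ^ (j + 1) ≤ 2 ^ σ.reg r := Nat.pow_le_pow_right (by norm_num) hj
    rw [pow_succ] at h3
    refine (runs_double hp1 ?_ ?_).congr ?_
    · simp [CounterState.reg_set, hp1.symm, hσ.t₁]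
    · simp [CounterState.reg_set, hp3]; omega
    · ext t
      · simp only [CounterState.reg_set]
        split_ifs <;> simp_all [pow_succ, mul_comm]
      all_goals rfl
  · ext t
    · simp only [CounterState.reg_set]
      have := hσ.t₃
      split_ifs <;> simp_all
    all_goals rfl
  · ext t
    · simp only [CounterState.reg_set]
      have := hσ.t₃
      split_ifs <;> simp_all
    all_goals rfl

/-- Load the parameters, the initial state and the seed. -/
def load : Block Reg Unit :=
  seq (readField 0 .w) (seq (readField 1 .d) (seq (readField 2 .m) (seq (readField 3 .s)
    (seq (powTwo .d .D) (seq (powTwo .s .S) (seq (readField 4 .u) (readField 5 .sd)))))))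

/-- The state after loading. -/
def loadedState (w d m s q x : ℕ) : CounterState Reg :=
  ((((((((⟨fun _ => 0, 0, [], []⟩ : CounterState Reg).set .w w).set .d d).set .m m).set .s s).set
    .D (2 ^ d)).set .S (2 ^ s)).set .u q).set .sd x

/-- The fields are numbered consecutively: parameters 0 to 3, then w·2^d table entries, the initial
state at 4 + w·2^d and the seed at 5 + w·2^d. Hence the powers of two are computed before the last
two are read. -/
theorem runs_load (hE : Setup E w d m s tab q xs) :
    load.Runs E ⟨fun _ => 0, 0, [], []⟩ () (loadedState w d m s q (binVal xs)) := by
  have h1 := hE.w_le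
  have h2 := hE.d_le
  have h3 := hE.m_le
  have h4 := hE.s_le
  have h5 := hE.D_le
  have h6 := hE.S_le
  have h7 := hE.wD_le
  have hq := hE.q_lt
  have hx := binVal_lt xs
  rw [hE.length_xs] at hx
  have r0 : Ready (⟨fun _ => 0, 0, [], []⟩ : CounterState Reg) := by constructor <;> rfl
  have hget : ∀ (n v k : ℕ), ([w, d, m, s] ++ (List.range (w * 2 ^ d)).map
      (fun i => tab (i / 2 ^ d) (i % 2 ^ d)) ++ [q])[n]? = some v → k = n → 2 * v ≤ E.bound →
      ∀ ρ : CounterState Reg, ρ.inputHead = 0 → ρ.reg .J = k →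
      ρ.reg .R = 0 → ρ.reg .P = 0 → ρ.reg .t₁ = 0 →
      getField.Runs E ρ () ((ρ.set .J 0).set .R v) := by
    intro n v k hv hk hb ρ g1 g2 g3 g4 g5
    exact runs_getField_nat hE.input g1 hv (g2.trans hk) g3 g4 g5 (by omega) hb
  refine runs_seq (runs_readField r0 rfl rfl (by decide) (by decide) (by simp)
    (by simp) (v := w) (by omega) (hget 0 _ _ (by simp) (by simp) h1)) ?_
  refine runs_seq (runs_readField (r0.set (by decide)) ?_ ?_ (by decide) (by decide) ?_
    ?_ (v := d) (by omega) (hget 1 _ _ (by simp) ?_ h2)) ?_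
  · simp [CounterState.reg_set]
  · simp [CounterState.reg_set]
  · simp; omega
  · simp [CounterState.reg_set]; omega
  · simp [CounterState.reg_set]
  refine runs_seq (runs_readField ((r0.set (by decide)).set (by decide)) ?_ ?_ (by decide)
    (by decide) ?_ ?_ (v := m) (by omega) (hget 2 _ _ (by simp) ?_ h3)) ?_
  · simp [CounterState.reg_set]
  · simp [CounterState.reg_set]
  · simp [CounterState.reg_set]; omega
  · simp [CounterState.reg_set]; omega
  · simp [CounterState.reg_set]
  refine runs_seq (runs_readField (((r0.set (by decide)).set (by decide)).set (by decide)) ?_ ?_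
    (by decide) (by decide) ?_ ?_ (v := s) (by omega) (hget 3 _ _ (by simp) ?_ h4)) ?_
  · simp [CounterState.reg_set]
  · simp [CounterState.reg_set]
  · simp [CounterState.reg_set]; omega
  · simp [CounterState.reg_set]; omega
  · simp [CounterState.reg_set]
  refine runs_seq (runs_powTwo ((((r0.set (by decide)).set (by decide)).set (by decide)).set
    (by decide)) ?_ (by decide) (by decide) (by decide) ?_) ?_
  · simp [CounterState.reg_set]
  · simp [CounterState.reg_set]; omega
  refine runs_seq (runs_powTwo (((((r0.set (by decide)).set (by decide)).set (by decide)).set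
    (by decide)).set (by decide)) ?_ (by decide) (by decide) (by decide) ?_) ?_
  · simp [CounterState.reg_set]
  · simp [CounterState.reg_set]; omega
  refine runs_seq (runs_readField ((((((r0.set (by decide)).set (by decide)).set (by decide)).set
    (by decide)).set (by decide)).set (by decide)) ?_ ?_
    (by decide) (by decide) ?_ ?_ (v := q) (by omega)
    (hget (4 + w * 2 ^ d) _ _ ?_ ?_ (by omega))) ?_
  · simp [CounterState.reg_set]
  · simp [CounterState.reg_set]
  · simp [CounterState.reg_set]; omega
  · simp [CounterState.reg_set]; omega
  · rw [List.getElem?_append_right (by simp; omega)]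
    rw [show ∀ i, i = 0 → [q][i]? = some q by rintro i rfl; rfl]
    simp; omega
  · simp [CounterState.reg_set]
  refine (runs_readField (((((((r0.set (by decide)).set (by decide)).set (by decide)).set
    (by decide)).set (by decide)).set (by decide)).set (by decide)) ?_ ?_
    (by decide) (by decide) ?_ ?_ (v := binVal xs) (by omega) ?_).congr ?_
  · simp [CounterState.reg_set]
  · simp [CounterState.reg_set]
  · simp [CounterState.reg_set]; omega
  · simp [CounterState.reg_set]; omega
  · intro ρ g1 g2 g3 g4 g5
    refine runs_getField (B := []) (l := xs) (hE.input.trans (by rw [List.append_nil]))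
      (Or.inl rfl) g1 (g2.trans ?_) g3 g4 g5 (by rw [hE.length_xs]; omega)
    simp [CounterState.reg_set]; omega
  · simp [loadedState, CounterState.reg_set]

/-- The generator. -/
def generator : Block Reg Unit :=
  seq load (seq (inc .fl) (seq (addTo .t₁ .u .st) (seq askSim (seq (moveTo .R₂ .V)
    (seq (clear .sd) (seq (clear .st) (seq (clear .fl) putPath)))))))

/-- The flag is raised for a single consultation, from q in layer 0 with the actual seed, which
yields the target. After that the seed counter is cleared and reused to enumerate all seeds, with
the flag at 0. -/
theorem runs_generator (hE : Setup E w d m s tab q xs) (hsim : Simulates E w d m s tab sim) :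
    ∃ σ', generator.Runs E ⟨fun _ => 0, 0, [], []⟩ () σ' ∧
      σ'.out = (List.range m).flatMap fun j =>
        (List.range d).map (pathBlock w d m s tab sim (sim 1 q (binVal xs)) q j).testBit := by
  have h1 := hE.w_le
  have hq := hE.q_lt
  have h2 := hE.wm_le
  have hwm : w * 1 ≤ w * m := Nat.mul_le_mul_left _ hE.m_pos
  have hx := binVal_lt xs
  rw [hE.length_xs] at hx
  have hV := (hsim 1 q (binVal xs) (by omega) hx).2
  set V := sim 1 q (binVal xs) with hVdef
  have hL : Idle w d m s (loadedState w d m s q (binVal xs)) := by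
    refine ⟨⟨⟨?_, ?_, ?_, ?_, ?_, ?_, ?_⟩, ?_, ?_, ?_, ?_, ?_, ?_⟩, ?_, ?_, ?_, ?_, ?_, ?_, ?_, ?_,
      ?_, ?_⟩ <;> simp [loadedState, CounterState.reg_set]
  have hrest : Rest w d m s ((((loadedState w d m s q (binVal xs)).set .V V).set .sd 0)) := by
    refine ⟨(hL.set rfl).set rfl, ?_, ?_, ?_, ?_, ?_, ?_, ?_, ?_, ?_, ?_⟩ <;>
      simp [loadedState, CounterState.reg_set]
  obtain ⟨σ', hr, ho⟩ := runs_putPath hE hsim hrest (by simp [loadedState, CounterState.reg_set])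
    (by simp [loadedState, CounterState.reg_set])
    (by simp [CounterState.reg_set]; omega)
  refine ⟨σ', runs_seq (runs_load hE) (runs_seq (runs_inc ?_) (runs_seq (runs_addTo (by decide)
    (by decide) (by decide) ?_ ?_) (runs_seq (runs_askSim hE hsim ((hL.set rfl).set rfl)
    ?_ ?_ ?_ ?_) (runs_seq (runs_moveTo (by decide) ?_) (runs_seq runs_clear (runs_seq runs_clear
    (runs_seq runs_clear (hr.congr_left ?_)))))))), ?_⟩
  · simp [loadedState, CounterState.reg_set]; omega
  · simp [loadedState, CounterState.reg_set]
  · simp [loadedState, CounterState.reg_set]; omega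
  · simp [loadedState, CounterState.reg_set]
  · simp [loadedState, CounterState.reg_set]; omega
  · simpa [loadedState, CounterState.reg_set]
  · simp [loadedState, CounterState.reg_set]
  · simp [loadedState, CounterState.reg_set, ← hVdef]; omega
  · clear hr ho hrest hL
    ext r
    · simp only [loadedState, CounterState.reg_set]
      cases r <;> simp [hVdef]
    all_goals rfl
  · rw [ho]
    simp [loadedState, CounterState.reg_set]

end Block

/-! ### Simulators and hitting probabilities -/

theorem uniformImage_toReal {n : ℕ} {α : Type*} [DecidableEq α] (g : BitString n → α) (a : α) :
    (uniformImage g a).toReal = (∑ x, if g x = a then (1 : ℝ) else 0) / 2 ^ n := by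
  rw [uniformImage, PMF.map_apply, tsum_fintype, ENNReal.toReal_sum]
  · rw [Finset.sum_div]
    refine Finset.sum_congr rfl fun x _ => ?_
    by_cases h : g x = a
    · simp [h]
    · simp [h, Ne.symm h]
  · intro x _
    split_ifs
    · exact PMF.apply_ne_top _ _
    · simp

theorem sum_toReal_eq_one {α : Type*} [Fintype α] (μ : PMF α) : ∑ a, (μ a).toReal = 1 := by
  rw [← ENNReal.toReal_sum fun a _ => PMF.apply_ne_top _ _,
    ← tsum_fintype (L := .unconditional α), PMF.tsum_coe]
  rfl

theorem tvDist_nonneg {α : Type*} [Fintype α] (μ ν : PMF α) : 0 ≤ tvDist μ ν := by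
  unfold tvDist; positivity

/-- The differences sum to 0, so the one at `a` is balanced by the others. Hence it accounts for at
most half of the L¹ distance, and no factor 2 is lost. -/
theorem abs_sub_le_tvDist {α : Type*} [Fintype α] [DecidableEq α] (μ ν : PMF α) (a : α) :
    |(μ a).toReal - (ν a).toReal| ≤ tvDist μ ν := by
  have h : ∑ b, ((μ b).toReal - (ν b).toReal) = 0 := by
    rw [Finset.sum_sub_distrib, sum_toReal_eq_one, sum_toReal_eq_one, sub_self]
  rw [← Finset.add_sum_erase _ _ (Finset.mem_univ a)] at h
  have h' : |(μ a).toReal - (ν a).toReal| ≤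
      ∑ b ∈ Finset.univ.erase a, |(μ b).toReal - (ν b).toReal| := by
    rw [eq_neg_of_add_eq_zero_left h, abs_neg]
    exact Finset.abs_sum_le_sum_abs _ _
  rw [tvDist, ← Finset.add_sum_erase _ _ (Finset.mem_univ a)]
  linarith

/-- A one-sided bound suffices because both masses total 1: if x ≥ −δ then |x| ≤ x + 2δ, and the
terms x sum to 0. -/
theorem tvDist_le_card_mul {α : Type*} [Fintype α] {μ ν : PMF α} {δ : ℝ} (hδ : 0 ≤ δ)
    (h : ∀ a, (ν a).toReal - (μ a).toReal ≤ δ) : tvDist μ ν ≤ Fintype.card α * δ := by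
  have h0 : ∑ b, ((μ b).toReal - (ν b).toReal) = 0 := by
    rw [Finset.sum_sub_distrib, sum_toReal_eq_one, sum_toReal_eq_one, sub_self]
  have h1 : ∑ a, |(μ a).toReal - (ν a).toReal| ≤
      ∑ a, (((μ a).toReal - (ν a).toReal) + 2 * δ) := by
    refine Finset.sum_le_sum fun a _ => abs_le.2 ⟨?_, ?_⟩ <;> have := h a <;> linarith
  rw [Finset.sum_add_distrib, h0, Finset.sum_const, Finset.card_univ, nsmul_eq_mul] at h1
  rw [tvDist]
  linarith

/-- The probability that the automaton `A` reaches `t` from a given state in `n` steps. -/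
noncomputable def hitProb {w d : ℕ} (A : Automaton w d) (t : Fin w) : ℕ → Fin w → ℝ
  | 0, u => if u = t then 1 else 0
  | n + 1, u => (∑ z, hitProb A t n (A u z)) / 2 ^ d

/-- Splitting off the first block turns the count of block sequences into the recursion that defines
`hitProb`. -/
theorem sum_foldl_eq_hitProb {w d : ℕ} (A : Automaton w d) (t : Fin w) (m : ℕ) (u : Fin w) :
    (∑ y : Fin m → BitString d, if Fin.foldl m (fun v i => A v (y i)) u = t then (1 : ℝ) else 0) =
      2 ^ (m * d) * hitProb A t m u := by
  induction m generalizing u with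
  | zero => simp [hitProb]
  | succ m ih =>
    rw [← (Fin.consEquiv fun _ : Fin (m + 1) => BitString d).sum_comp, Fintype.sum_prod_type]
    simp only [Fin.foldl_succ, Fin.consEquiv_apply, Fin.cons_zero, Fin.cons_succ, hitProb]
    simp only [ih]
    rw [← Finset.mul_sum, add_mul, one_mul, pow_add]
    field_simp

theorem uniformImage_run_toReal {w d : ℕ} (A : Automaton w d) (t : Fin w) (m : ℕ) (u : Fin w) :
    (uniformImage (Automaton.run m A u) t).toReal = hitProb A t m u := by
  rw [uniformImage_toReal, div_eq_iff (by positivity), mul_comm (hitProb A t m u),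
    ← sum_foldl_eq_hitProb]
  refine Fintype.sum_equiv ((finProdFinEquiv.arrowCongr (Equiv.refl Bool)).symm.trans
    (Equiv.curry (Fin m) (Fin d) Bool)) _ _ fun x => ?_
  rfl

theorem foldl_eq_of_step {α : Type*} (m : ℕ) (f : α → Fin m → α) (g : ℕ → α)
    (h : ∀ i : Fin m, f (g i) i = g (i + 1)) : Fin.foldl m f (g 0) = g m := by
  induction m generalizing g with
  | zero => simp
  | succ m ih =>
    rw [Fin.foldl_succ]
    have h0 := h 0
    simp only [Fin.val_zero, zero_add] at h0
    rw [h0]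
    exact ih (fun x i => f x i.succ) (fun j => g (j + 1)) fun i => by simpa using h i.succ

/-! ### The layered automaton -/

/-- The transition table of `Q`, as a function on natural numbers. -/
def tableVal {w d : ℕ} (Q : Automaton w d) (v k : ℕ) : ℕ :=
  if h : v < w then Q ⟨v, h⟩ (bitStringOfNat d k) else 0

theorem tableVal_val {w d : ℕ} (Q : Automaton w d) (v : Fin w) (k : ℕ) :
    tableVal Q v k = Q v (bitStringOfNat d k) := by
  simp [tableVal]

theorem tableVal_lt {w d : ℕ} (Q : Automaton w d) {v : ℕ} (k : ℕ) (hv : v < w) :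
    tableVal Q v k < w := by
  simp [tableVal, hv]

/-- Truncated subtraction keeps layer 0 inside itself, and the other layers descend, so no step
leaves the m layers. -/
theorem layerEntry_lt {w m : ℕ} {tab : ℕ → ℕ → ℕ} {f l v k : ℕ} (hl : l < m) (hv : v < w)
    (htab : tab v k < w) : layerEntry w tab f l v k < w * m := by
  have h1 : layerEntry w tab f l v k < w + (l - 1) * w := by
    rw [layerEntry]; split_ifs <;> omega
  have h2 : (l - 1 + 1) * w ≤ m * w := Nat.mul_le_mul_right _ (by omega)
  rw [add_mul, one_mul] at h2
  rw [mul_comm w m]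
  omega

/-- The automaton with `m` layers of copies of the states of `Q`: in layer `l`, there are `l` steps
left; in layer `0`, the state is frozen if `f = 0`, and otherwise moves as in `Q`. -/
def layeredAutomaton {w d : ℕ} (m : ℕ) (Q : Automaton w d) (f : ℕ) : Automaton (w * m) d :=
  fun n z => ⟨layerEntry w (tableVal Q) f (n / w) (n % w) (Nat.ofBits z), by
    have hw : 0 < w := Nat.pos_of_mul_pos_right (lt_of_le_of_lt (Nat.zero_le _) n.2)
    exact layerEntry_lt (Nat.div_lt_of_lt_mul n.2) (Nat.mod_lt _ hw)
      (tableVal_lt _ _ (Nat.mod_lt _ hw))⟩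

/-- The copy of the state `u` in layer `l`. -/
def layerState {w m : ℕ} {l : ℕ} (hl : l < m) (u : Fin w) : Fin (w * m) :=
  ⟨u + l * w, by
    have h2 : (l + 1) * w ≤ m * w := Nat.mul_le_mul_right _ hl
    rw [add_mul, one_mul] at h2
    rw [mul_comm w m]
    omega⟩

theorem bitStringOfNat_ofBits {d : ℕ} (z : BitString d) : bitStringOfNat d (Nat.ofBits z) = z := by
  funext j
  simp [bitStringOfNat]

theorem ofBits_bitStringOfNat {d k : ℕ} (hk : k < 2 ^ d) :
    Nat.ofBits (bitStringOfNat d k) = k := by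
  refine Nat.eq_of_testBit_eq fun i => ?_
  rcases lt_or_ge i d with h | h
  · rw [Nat.testBit_ofBits_lt _ _ h]; rfl
  · rw [Nat.testBit_ofBits_ge _ _ h, Nat.testBit_lt_two_pow
      (hk.trans_le (Nat.pow_le_pow_right (by norm_num) h))]

theorem layeredAutomaton_val {w d m : ℕ} (Q : Automaton w d) (f : ℕ) {l : ℕ} (hl : l < m)
    (u : Fin w) (z : BitString d) : (layeredAutomaton m Q f (layerState hl u) z : ℕ) =
      (if l = 0 ∧ f = 0 then (u : ℕ) else Q u z) + (l - 1) * w := by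
  have hw : 0 < w := u.pos
  have h1 : ((u : ℕ) + l * w) / w = l := by
    rw [Nat.add_mul_div_right _ _ hw, Nat.div_eq_of_lt u.2, zero_add]
  have h2 : ((u : ℕ) + l * w) % w = u := by
    rw [Nat.add_mul_mod_self_right, Nat.mod_eq_of_lt u.2]
  simp only [layeredAutomaton, layerState, h1, h2, layerEntry, tableVal_val,
    bitStringOfNat_ofBits]

theorem layerState_inj {w m : ℕ} {l : ℕ} (hl : l < m) {u v : Fin w} :
    layerState hl u = layerState hl v ↔ u = v := by
  simp [layerState, Fin.ext_iff]

/-- After l steps the walk is in layer 0 and stays put, so further steps are harmless. Thus the one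
run length m for which the simulator is available gives the probabilities for all shorter lengths.
-/
theorem hitProb_layered_frozen {w d m : ℕ} (Q : Automaton w d) (hm : 0 < m) (t : Fin w) (n : ℕ)
    {l : ℕ} (hl : l < m) (hn : l ≤ n) (u : Fin w) :
    hitProb (layeredAutomaton m Q 0) (layerState hm t) n (layerState hl u) = hitProb Q t l u := by
  induction n generalizing l u with
  | zero =>
    obtain rfl : l = 0 := by omega
    simp [hitProb, layerState_inj]
  | succ n ih =>
    rcases l with _ | l
    · have h : ∀ z, layeredAutomaton m Q 0 (layerState hl u) z = layerState hl u := by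
        intro z
        ext
        rw [layeredAutomaton_val]
        simp [layerState]
      simp only [hitProb, h, ih hl (Nat.zero_le _)]
      simp only [Finset.sum_const, Finset.card_univ, Fintype.card_pi, Fintype.card_bool,
        Finset.prod_const, Fintype.card_fin, nsmul_eq_mul, Nat.cast_pow, Nat.cast_ofNat]
      field_simp
    · have h : ∀ z, layeredAutomaton m Q 0 (layerState hl u) z =
          layerState (show l < m by omega) (Q u z) := by
        intro z
        ext
        rw [layeredAutomaton_val]
        simp [layerState]
      simp only [hitProb, h, ih (show l < m by omega) (by omega)]

/-- Layer 0 with the flag raised is a closed copy of `Q`. This draws the target after a full m steps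
without needing a further layer m. -/
theorem hitProb_layered_moving {w d m : ℕ} (Q : Automaton w d) (hm : 0 < m) (t : Fin w) (n : ℕ)
    (u : Fin w) :
    hitProb (layeredAutomaton m Q 1) (layerState hm t) n (layerState hm u) = hitProb Q t n u := by
  induction n generalizing u with
  | zero => simp [hitProb, layerState_inj]
  | succ n ih =>
    have h : ∀ z, layeredAutomaton m Q 1 (layerState hm u) z = layerState hm (Q u z) := by
      intro z
      ext
      rw [layeredAutomaton_val]
      simp [layerState]
    simp only [hitProb, h, ih]

/-! ### The greedy path -/

/-- The first part is an inequality rather than an equality because of the initial pair (0, 0).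
Together the two parts say that the chosen place attains the maximum. -/
theorem argmaxBelow_spec (c : ℕ → ℕ) (n : ℕ) :
    (argmaxBelow c n).1 ≤ c (argmaxBelow c n).2 ∧ ∀ j < n, c j ≤ (argmaxBelow c n).1 := by
  induction n with
  | zero => simp [argmaxBelow]
  | succ n ih =>
    simp only [argmaxBelow]
    split_ifs with h
    · refine ⟨le_rfl, fun j hj => ?_⟩
      rcases Nat.lt_succ_iff_lt_or_eq.1 hj with hj | rfl
      · exact (ih.2 j hj).trans h.le
      · exact le_rfl
    · refine ⟨ih.1, fun j hj => ?_⟩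
      rcases Nat.lt_succ_iff_lt_or_eq.1 hj with hj | rfl
      · exact ih.2 j hj
      · exact not_lt.1 h

theorem hitCount_le_bestBlock (w d s : ℕ) (tab : ℕ → ℕ → ℕ) (sim : ℕ → ℕ → ℕ → ℕ) (V l u : ℕ)
    {k : ℕ} (hk : k < 2 ^ d) : hitCount s sim V (tab u k + l * w) ≤
      hitCount s sim V (tab u (bestBlock w d s tab sim V l u) + l * w) :=
  ((argmaxBelow_spec _ _).2 k hk).trans
    (argmaxBelow_spec (fun z => hitCount s sim V (tab u z + l * w)) (2 ^ d)).1

section Greedy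

variable {w d m s : ℕ}

/-- The simulator for the layered automaton, as a function on natural numbers. -/
def simVal (Sim : Automaton (w * m) d × Fin (w * m) → BitString s → Fin (w * m))
    (Q : Automaton w d) (f a y : ℕ) : ℕ :=
  if h : a < w * m then Sim (layeredAutomaton m Q f, ⟨a, h⟩) (bitStringOfNat s y) else 0

variable {Sim : Automaton (w * m) d × Fin (w * m) → BitString s → Fin (w * m)} {ε : ℝ}

theorem simVal_val (Q : Automaton w d) (f y : ℕ) (a : Fin (w * m)) :
    simVal Sim Q f a y = Sim (layeredAutomaton m Q f, a) (bitStringOfNat s y) := by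
  simp [simVal]

/-- Numbers below 2^s correspond bijectively to seeds, so the exhaustive count gives the exact
output distribution of the simulator. -/
theorem hitCount_div (Q : Automaton w d) (a t : Fin (w * m)) :
    (hitCount s (simVal Sim Q) t a : ℝ) / 2 ^ s =
      (uniformImage (Sim (layeredAutomaton m Q 0, a)) t).toReal := by
  rw [uniformImage_toReal, Finset.sum_boole, hitCount, Nat.count_eq_card_filter_range]
  congr 2
  refine Finset.card_bij (fun y _ => bitStringOfNat s y) ?_ ?_ ?_
  · intro y hy
    simpa [simVal_val, Fin.ext_iff] using (Finset.mem_filter.1 hy).2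
  · intro y hy y' hy' h
    rw [← ofBits_bitStringOfNat (Finset.mem_range.1 (Finset.mem_filter.1 hy).1), h,
      ofBits_bitStringOfNat (Finset.mem_range.1 (Finset.mem_filter.1 hy').1)]
  · intro x hx
    refine ⟨Nat.ofBits x, ?_, bitStringOfNat_ofBits x⟩
    simp only [Finset.mem_filter, Finset.mem_range, Nat.ofBits_lt_two_pow, true_and, simVal_val,
      bitStringOfNat_ofBits]
    rw [(Finset.mem_filter.1 hx).2]

/-- By freezing, the true m-step probability from layer l is the l-step probability in `Q`; the
simulator approximates each point probability within ε. -/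
theorem abs_hitCount_sub_le (hSim : IsSimulator ε (automatonClass (w * m) d m) Sim) (hm : 0 < m)
    (Q : Automaton w d) (t u : Fin w) {l : ℕ} (hl : l < m) :
    |(hitCount s (simVal Sim Q) t (u + l * w) : ℝ) / 2 ^ s - hitProb Q t l u| ≤ ε := by
  have h1 := hitCount_div (Sim := Sim) Q (layerState hl u) (layerState hm t)
  have h2 := uniformImage_run_toReal (layeredAutomaton m Q 0) (layerState hm t) m
    (layerState hl u)
  rw [hitProb_layered_frozen Q hm t m hl hl.le u] at h2
  have h3 : ((layerState hm t : Fin (w * m)) : ℕ) = t := by simp [layerState]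
  rw [h3] at h1
  rw [show (u : ℕ) + l * w = (layerState hl u : Fin (w * m)) from rfl, h1, ← h2]
  exact (abs_sub_le_tvDist _ _ _).trans (hSim (layeredAutomaton m Q 0, layerState hl u))

/-- The states along the greedy path to `t`. -/
def greedyState (Sim : Automaton (w * m) d × Fin (w * m) → BitString s → Fin (w * m))
    (Q : Automaton w d) (q : Fin w) (V j : ℕ) : Fin w :=
  ⟨pathState w d m s (tableVal Q) (simVal Sim Q) V q j,
    Block.pathState_lt (fun _ k hv _ => tableVal_lt Q k hv) q.2 V j⟩

theorem greedyState_succ (Q : Automaton w d) (q : Fin w) (V j : ℕ) :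
    greedyState Sim Q q V (j + 1) = Q (greedyState Sim Q q V j)
      (bitStringOfNat d (pathBlock w d m s (tableVal Q) (simVal Sim Q) V q j)) := by
  ext
  exact tableVal_val Q (greedyState Sim Q q V j) _

/-- The probability with l + 1 steps left is an average over blocks, so it is enough to compare each
block with the chosen one. The chosen block has the largest estimate, and both estimates are within
ε of the truth. -/
theorem hitProb_le_greedyState (hSim : IsSimulator ε (automatonClass (w * m) d m) Sim)
    (Q : Automaton w d) (q t : Fin w) (j l : ℕ) (hj : j + l + 1 = m) :
    hitProb Q t (l + 1) (greedyState Sim Q q t j) ≤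
      hitProb Q t l (greedyState Sim Q q t (j + 1)) + 2 * ε := by
  have hm : 0 < m := by omega
  have hl : l < m := by omega
  set u := greedyState Sim Q q t j with hu
  have hz : pathBlock w d m s (tableVal Q) (simVal Sim Q) t q j =
      bestBlock w d s (tableVal Q) (simVal Sim Q) t l u := by
    rw [pathBlock, show m - 1 - j = l by omega]; rfl
  rw [greedyState_succ, ← hu, hz, hitProb, div_le_iff₀ (by positivity)]
  set z := bestBlock w d s (tableVal Q) (simVal Sim Q) t l u
  have key : ∀ y : BitString d, hitProb Q t l (Q u y) ≤
      hitProb Q t l (Q u (bitStringOfNat d z)) + 2 * ε := by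
    intro y
    obtain ⟨k, hk, rfl⟩ := exists_bitStringOfNat y
    have h1 := abs_le.1 (abs_hitCount_sub_le hSim hm Q t (Q u (bitStringOfNat d k)) hl)
    have h2 := abs_le.1 (abs_hitCount_sub_le hSim hm Q t (Q u (bitStringOfNat d z)) hl)
    have h3 := hitCount_le_bestBlock w d s (tableVal Q) (simVal Sim Q) t l u hk
    rw [tableVal_val, tableVal_val] at h3
    have h4 : (hitCount s (simVal Sim Q) t (Q u (bitStringOfNat d k) + l * w) : ℝ) / 2 ^ s ≤
        (hitCount s (simVal Sim Q) t (Q u (bitStringOfNat d z) + l * w) : ℝ) / 2 ^ s := by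
      gcongr
    linarith [h1.1, h2.2]
  refine (Finset.sum_le_sum fun y _ => key y).trans (le_of_eq ?_)
  simp
  ring

/-- Losing at most 2ε in each of m steps, the final probability with 0 steps left is still positive.
It is an indicator, so the final state is the target. -/
theorem greedyState_eq (hSim : IsSimulator ε (automatonClass (w * m) d m) Sim)
    (Q : Automaton w d) (q t : Fin w) (h : 2 * m * ε < hitProb Q t m q) :
    greedyState Sim Q q t m = t := by
  have key : ∀ j l, j + l = m → hitProb Q t m q ≤
      hitProb Q t l (greedyState Sim Q q t j) + 2 * j * ε := by
    intro j
    induction j with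
    | zero =>
      intro l hl
      obtain rfl : l = m := by omega
      simp [greedyState, pathState]
    | succ j ih =>
      intro l hl
      have h1 := ih (l + 1) (by omega)
      have h2 := hitProb_le_greedyState hSim Q q t j l (by omega)
      push_cast
      linarith
  have h1 := key m 0 (by omega)
  by_contra hne
  rw [hitProb, if_neg hne] at h1
  linarith

/-- The generator, as a function. -/
def greedyGen (Sim : Automaton (w * m) d × Fin (w * m) → BitString s → Fin (w * m))
    (a : Automaton w d × Fin w) (x : BitString s) : BitString (m * d) := fun p =>
  (pathBlock w d m s (tableVal a.1) (simVal Sim a.1)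
    (simVal Sim a.1 1 a.2 (Nat.ofBits x)) a.2 (p / d)).testBit (p % d)

theorem run_greedyGen (Q : Automaton w d) (q : Fin w) (x : BitString s) :
    Automaton.run m Q q (greedyGen Sim (Q, q) x) =
      greedyState Sim Q q (simVal Sim Q 1 q (Nat.ofBits x)) m := by
  set V := simVal Sim Q 1 q (Nat.ofBits x) with hV
  have h0 : q = greedyState Sim Q q V 0 := rfl
  conv_lhs => rw [Automaton.run, h0]
  refine foldl_eq_of_step m _ (greedyState Sim Q q V) fun i => ?_
  rw [greedyState_succ]
  congr 1
  funext j
  have hd : 0 < d := j.pos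
  simp only [greedyGen, finProdFinEquiv_apply_val, bitStringOfNat, ← h0, ← hV]
  rw [Nat.add_mul_div_left _ _ hd, Nat.div_eq_of_lt j.2, Nat.add_mul_mod_self_left,
    Nat.mod_eq_of_lt j.2, zero_add]

theorem isTargetedPRG_greedyGen (hSim : IsSimulator ε (automatonClass (w * m) d m) Sim)
    (hm : 0 < m) : IsTargetedPRG (2 * m * w ^ 2 * ε) (automatonClass w d m) (greedyGen Sim) := by
  rintro ⟨Q, q⟩
  have hw : (1 : ℝ) ≤ w := by exact_mod_cast q.pos
  have hm1 : (1 : ℝ) ≤ m := by exact_mod_cast hm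
  -- Nonnegativity is not assumed: it follows because the simulator condition bounds an actual
  -- distance by ε.
  have hε : 0 ≤ ε := (tvDist_nonneg _ _).trans (hSim (layeredAutomaton m Q 1, layerState hm q))
  have hδ : 0 ≤ 2 * m * ε := by positivity
  have key : tvDist (uniformImage fun x => automatonClass w d m (Q, q) (greedyGen Sim (Q, q) x))
      (uniformImage (automatonClass w d m (Q, q))) ≤ Fintype.card (Fin w) * (2 * m * ε) := by
    refine tvDist_le_card_mul hδ fun a => ?_
    have hT := uniformImage_run_toReal Q a m q
    change (uniformImage (Automaton.run m Q q) a).toReal - _ ≤ _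
    rw [hT]
    -- An unlikely target costs at most its own probability 2mε. For a likely one, every seed on
    -- which the simulator outputs it leads the greedy path to it.
    by_cases hbad : hitProb Q a m q ≤ 2 * m * ε
    · linarith [ENNReal.toReal_nonneg (a := uniformImage (fun x => automatonClass w d m (Q, q)
        (greedyGen Sim (Q, q) x)) a)]
    · have h1 := uniformImage_run_toReal (layeredAutomaton m Q 1) (layerState hm a) m
        (layerState hm q)
      rw [hitProb_layered_moving] at h1
      have h2 := (abs_sub_le_tvDist (uniformImage (Sim (layeredAutomaton m Q 1, layerState hm q)))
        (uniformImage (Automaton.run m (layeredAutomaton m Q 1) (layerState hm q)))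
        (layerState hm a)).trans (hSim (layeredAutomaton m Q 1, layerState hm q))
      rw [h1] at h2
      have h3 : (uniformImage (Sim (layeredAutomaton m Q 1, layerState hm q))
          (layerState hm a)).toReal ≤ (uniformImage (fun x => automatonClass w d m (Q, q)
          (greedyGen Sim (Q, q) x)) a).toReal := by
        rw [uniformImage_toReal, uniformImage_toReal]
        gcongr with x
        split_ifs with h4 h5 h5
        · exact le_rfl
        · refine absurd ?_ h5
          have h6 : simVal Sim Q 1 q (Nat.ofBits x) = a := by
            -- In layer 0 a state and its copy have the same number, so the simulator's answer can
            -- be used directly as a target.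
            have h7 := simVal_val (Sim := Sim) Q 1 (Nat.ofBits x) (layerState hm q)
            rw [bitStringOfNat_ofBits, h4] at h7
            simpa [layerState] using h7
          change Automaton.run m Q q _ = a
          rw [run_greedyGen, h6]
          exact greedyState_eq hSim Q q a (not_le.1 hbad)
        · norm_num
        · exact le_rfl
      have h8 : ε ≤ 2 * m * ε := by nlinarith
      linarith [(abs_le.1 h2).1]
  refine key.trans ?_
  rw [Fintype.card_fin]
  -- The argument gives 2mwε; the remaining factor w is slack.
  have h9 : (w : ℝ) ≤ w ^ 2 := by nlinarith
  calc (w : ℝ) * (2 * m * ε) ≤ w ^ 2 * (2 * m * ε) := by gcongr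
    _ = 2 * m * w ^ 2 * ε := by ring

end Greedy

/-! ### Agreement of the encodings, the bound on the counters and the conclusion -/

theorem flatMap_range_mul {α : Type*} (F : ℕ → ℕ → List α) (a b : ℕ) :
    (List.range (a * b)).flatMap (fun n => F (n / b) (n % b)) =
      (List.range a).flatMap fun i => (List.range b).flatMap (F i) := by
  induction a with
  | zero => simp
  | succ a ih =>
    rw [add_mul, one_mul, List.range_add, List.flatMap_append, ih, List.range_succ,
      List.flatMap_append, List.flatMap_singleton, List.flatMap_map]
    congr 1
    refine List.flatMap_congr fun i hi => ?_
    have hi := List.mem_range.1 hi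
    have hb : 0 < b := by omega
    rw [mul_comm, Nat.mul_add_div hb, Nat.div_eq_of_lt hi, Nat.mul_add_mod, Nat.mod_eq_of_lt hi,
      add_zero]

theorem flatMap_finRange {α : Type*} (F : ℕ → List α) (n : ℕ) :
    ((List.finRange n).flatMap fun i : Fin n => F i) = (List.range n).flatMap F := by
  rw [← List.map_coe_finRange_eq_range, List.flatMap_map]

theorem ofFn_eq_map_range {α : Type*} (g : ℕ → α) (n : ℕ) :
    (List.ofFn fun i : Fin n => g i) = (List.range n).map g := by
  apply List.ext_getElem <;> simp

theorem encodeAutomaton_eq {w d : ℕ} (Q : Automaton w d) :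
    encodeAutomaton Q = ((List.range (w * 2 ^ d)).map
      (fun i => tableVal Q (i / 2 ^ d) (i % 2 ^ d))).flatMap encodeNat := by
  rw [List.flatMap_map, flatMap_range_mul (fun i j => encodeNat (tableVal Q i j)),
    ← flatMap_finRange]
  simp only [tableVal_val]
  rfl

/-- With the numbering v + l·w, enumerating states in increasing order means layer by layer, which
is the order of the nested loops that write the table. -/
theorem encodeAutomaton_layered {w d : ℕ} (m : ℕ) (Q : Automaton w d) (f : ℕ) :
    encodeAutomaton (layeredAutomaton m Q f) = layerTable w d m (tableVal Q) f := by
  rw [layerTable, ← flatMap_range_mul (fun l v => (List.range (2 ^ d)).flatMap fun k =>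
    encodeNat (layerEntry w (tableVal Q) f l v k)), mul_comm m w, ← flatMap_finRange]
  refine List.flatMap_congr fun n _ => List.flatMap_congr fun k hk => ?_
  simp only [layeredAutomaton, ofBits_bitStringOfNat (List.mem_range.1 hk)]

theorem testBit_binVal (l : List Bool) (j : ℕ) : (binVal l).testBit j = l.getD j false := by
  induction l generalizing j with
  | nil => simp [binVal]
  | cons b l ih =>
    rw [binVal, add_comm, show 2 * binVal l + b.toNat = Nat.bit b (binVal l) by
      cases b <;> simp [Nat.bit]]
    cases j with
    | zero => simp
    | succ j => rw [Nat.testBit_bit_succ, ih]; simp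

theorem binVal_ofFn {s : ℕ} (x : BitString s) : binVal (List.ofFn x) = Nat.ofBits x := by
  refine Nat.eq_of_testBit_eq fun j => ?_
  rw [testBit_binVal]
  rcases lt_or_ge j s with h | h
  · rw [Nat.testBit_ofBits_lt _ _ h]; simp [h]
  · rw [Nat.testBit_ofBits_ge _ _ h]; simp [h]

/-- The environment in which the generator runs. -/
def generatorEnv (w d m s : ℕ) (f : List TapeSym → List Bool) (inp : List TapeSym) : RunEnv where
  bound := 8 * ((w + 1) * (m + 1)) * (2 ^ d * 2 ^ s)
  oracle := f
  input := inp

/-- The bound is a product, so that its logarithm is a sum of the permitted terms. The factor 8 and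
the shifts by 1 absorb the doublings and the extra field indices, also when some parameters are 0 or
1. -/
theorem setup_generatorEnv {w d m s : ℕ} (hm : 0 < m) (f : List TapeSym → List Bool)
    (Q : Automaton w d) (q : Fin w) (x : BitString s) :
    Setup (generatorEnv w d m s f (encodeInput m Q q x)) w d m s (tableVal Q) q (List.ofFn x) := by
  have hD : 1 ≤ 2 ^ d := Nat.one_le_two_pow
  have hS : 1 ≤ 2 ^ s := Nat.one_le_two_pow
  have hd : d < 2 ^ d := Nat.lt_two_pow_self
  have hs : s < 2 ^ s := Nat.lt_two_pow_self
  have hDS : 2 ^ d ≤ 2 ^ d * 2 ^ s := Nat.le_mul_of_pos_right _ (by positivity)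
  have hSD : 2 ^ s ≤ 2 ^ d * 2 ^ s := Nat.le_mul_of_pos_left _ (by positivity)
  have hwm : 1 ≤ (w + 1) * (m + 1) := Nat.mul_pos (by omega) (by omega)
  have hexp : (w + 1) * (m + 1) = w * m + w + m + 1 := by ring
  have h1 : 8 * ((w + 1) * (m + 1)) ≤ (generatorEnv w d m s f (encodeInput m Q q x)).bound :=
    Nat.le_mul_of_pos_right _ (by positivity)
  have h2 : 8 * (2 ^ d * 2 ^ s) ≤ (generatorEnv w d m s f (encodeInput m Q q x)).bound :=
    Nat.mul_le_mul_right _ (by omega)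
  have h3 : (8 * (w + 1)) * 2 ^ d ≤ (generatorEnv w d m s f (encodeInput m Q q x)).bound :=
    Nat.mul_le_mul (by rw [hexp]; have := Nat.zero_le (w * m); omega) hDS
  have h4 : 8 * (w + 1) * 2 ^ d = 8 * (w * 2 ^ d) + 8 * 2 ^ d := by ring
  have h5 := Nat.zero_le (w * m)
  refine ⟨?_, fun v k hv _ => tableVal_lt Q k hv, q.2, hm, List.length_ofFn, ?_, ?_, ?_, ?_, ?_,
    ?_, ?_, ?_⟩
  · change encodeInput m Q q x = _
    rw [encodeInput, encodeInstance, encodeAutomaton_eq]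
    simp [List.append_assoc]
  all_goals omega

theorem simulates_generatorEnv {w d m s : ℕ} {f : List TapeSym → List Bool}
    {Sim : Automaton (w * m) d × Fin (w * m) → BitString s → Fin (w * m)}
    (hf : IsOracleFor f Sim) (Q : Automaton w d) (inp : List TapeSym) :
    Simulates (generatorEnv w d m s f inp) w d m s (tableVal Q) (simVal Sim Q) := by
  intro g a y ha _
  have h := hf (layeredAutomaton m Q g) ⟨a, ha⟩ (bitStringOfNat s y)
  rw [encodeInstance, encodeAutomaton_layered,
    show List.ofFn (bitStringOfNat s y) = _ from ofFn_eq_map_range y.testBit s] at h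
  have h' := simVal_val (Sim := Sim) Q g y ⟨a, ha⟩
  rw [← h'] at h
  refine ⟨h, ?_⟩
  rw [show a = ((⟨a, ha⟩ : Fin (w * m)) : ℕ) from rfl, h']
  exact Fin.isLt _

/-- The constant is 3 for the factor 8, 1 each for rounding log w and log m, and the 4 spare cells:
3 + 1 + 1 + 4 = 9. -/
theorem space_generatorEnv_le (w d m s : ℕ) (f : List TapeSym → List Bool) (inp : List TapeSym) :
    (generatorEnv w d m s f inp).space ≤ 9 * (s + d + Nat.log 2 w + Nat.log 2 m + 1) := by
  have hw : w + 1 ≤ 2 ^ (Nat.log 2 w + 1) := Nat.lt_pow_succ_log_self (by norm_num) w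
  have hm : m + 1 ≤ 2 ^ (Nat.log 2 m + 1) := Nat.lt_pow_succ_log_self (by norm_num) m
  have h : 8 * ((w + 1) * (m + 1)) * (2 ^ d * 2 ^ s) ≤
      2 ^ (3 + (Nat.log 2 w + 1 + (Nat.log 2 m + 1)) + (d + s)) := by
    rw [pow_add, pow_add 2 3, pow_add 2 (Nat.log 2 w + 1), pow_add 2 d]
    gcongr
    norm_num
  have h' := Nat.log_mono_right (b := 2) h
  rw [Nat.log_pow (by norm_num)] at h'
  rw [RunEnv.space]
  change Nat.log 2 (8 * ((w + 1) * (m + 1)) * (2 ^ d * 2 ^ s)) + 4 ≤ _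
  omega

/-- Bit p of the output is bit p mod d of block number p div d, so listing the bits in order is
listing the blocks one after another. -/
theorem ofFn_greedyGen {w d m s : ℕ}
    (Sim : Automaton (w * m) d × Fin (w * m) → BitString s → Fin (w * m))
    (Q : Automaton w d) (q : Fin w) (x : BitString s) :
    List.ofFn (greedyGen Sim (Q, q) x) = (List.range m).flatMap fun j => (List.range d).map
      (pathBlock w d m s (tableVal Q) (simVal Sim Q)
        (simVal Sim Q 1 q (binVal (List.ofFn x))) q j).testBit := by
  simp only [binVal_ofFn, List.map_eq_flatMap]
  rw [← flatMap_range_mul, ← List.map_eq_flatMap]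
  exact ofFn_eq_map_range (fun p => (pathBlock w d m s (tableVal Q) (simVal Sim Q)
    (simVal Sim Q 1 q (Nat.ofBits x)) q (p / d)).testBit (p % d)) (m * d)

theorem mainTheorem3 :
    ∃ (G : LLMachine) (C : ℕ), ∀ (w d m s : ℕ), 0 < m → ∀ (ε : ℝ)
      (Sim : Automaton (w * m) d × Fin (w * m) → BitString s → Fin (w * m)),
      IsSimulator ε (automatonClass (w * m) d m) Sim →
      ∀ f : List TapeSym → List Bool, IsOracleFor f Sim →
      ∃ Gen : Automaton w d × Fin w → BitString s → BitString (m * d),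
        IsTargetedPRG (2 * m * w ^ 2 * ε) (automatonClass w d m) Gen ∧
        ∀ (Q : Automaton w d) (q : Fin w) (x : BitString s),
          G.Computes f (encodeInput m Q q x) (List.ofFn (Gen (Q, q) x)) ∧
          G.UsesSpaceAtMost f (encodeInput m Q q x)
            (C * (s + d + Nat.log 2 w + Nat.log 2 m + 1)) := by
  refine ⟨Block.generator.machine finite_reg, 9, fun w d m s hm ε Sim hSim f hf =>
    ⟨greedyGen Sim, isTargetedPRG_greedyGen hSim hm, fun Q q x => ?_⟩⟩
  have hE := setup_generatorEnv hm f Q q x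
  obtain ⟨σ, hrun, hout⟩ := Block.runs_generator hE (simulates_generatorEnv hf Q _)
  have hbound := hE.D_le
  have hpos : 0 < 2 ^ d := by positivity
  obtain ⟨hc, hs⟩ := Block.machine_correct (hR := finite_reg) (by omega) hrun
  rw [hout, ← ofFn_greedyGen] at hc
  exact ⟨hc, fun c hreach t => (hs c hreach t).trans_le (space_generatorEnv_le _ _ _ _ _ _)⟩
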